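/- \textbf{Conventions.} A \emph{cofibration category} is a category $\mathcal C$ with two classes of morphisms, cofibrations and weak equivalences, such that: isomorphisms are weak equivalences and weak equivalences satisfy 2-out-of-3; isomorphisms are cofibrations and cofibrations are closed under composition; pushouts along a cofibration exist, and cofibrations, as well as acyclic cofibrations (cofibrations that are weak equivalences), are stable under pushout along arbitrary morphisms; there is an initial object and every morphism out of an initial object is a cofibration; every morphism factors as a cofibration followed by a weak equivalence. Let $\gamma\colon\mathcal C\to\mathrm{Ho}(\mathcal C)$ be the localization at the weak equivalences. Let $\mathcal C$ be pointed, that is, the initial objects are also terminal; write $*$ for the zero object and $Y/X=Y\cup_X *$ for a cofibration $X\to Y$. A cone of $X$ is a cofibration $X\to A$ such that $A\to *$ is a weak equivalence; fix a cone $X\to CX$ for every object $X$ and set $\Sigma X=CX/X$. A cone extension of $f\colon X\to Y$ with respect to cones $A$ of $X$ and $B$ of $Y$ consists of a morphism $\bar f\colon A\to K$ and an acyclic cofibration $s\colon B\to K$ which agree on $X$ (via $f$) and induce a cofibration $A\cup_X B\to K$; the morphism $\gamma(A/X\to K/Y\xleftarrow{\sim}B/Y)$ does not depend on the choice of the cone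 extension. With $A=CX$ and $B=CY$ this defines $\Sigma f$, and it induces a functor $\Sigma\colon\mathrm{Ho}(\mathcal C)\to\mathrm{Ho}(\mathcal C)$; $\mathcal C$ is \emph{stable} if this $\Sigma$ is an equivalence. The \emph{elementary exact triangle} of a cofibration $f\colon X\to Y$ is $X\xrightarrow{\gamma(f)}Y\to Y/X\xrightarrow{\delta(f)}\Sigma X$ with $\delta(f)=\gamma(Y/X\xleftarrow{\sim}CX\cup_XY\to\Sigma X)$. A functor of cofibration categories is \emph{exact} if it preserves initial objects, cofibrations, weak equivalences and pushouts along cofibrations. A functor $F\colon\mathcal C\times\mathcal D\to\mathcal E$ of cofibration categories is \emph{biexact} if it is exact in each variable and for all cofibrations $X\to Y$ in $\mathcal C$ and $X'\to Y'$ in $\mathcal D$ the morphism $F(X,Y')\cup_{F(X,X')}F(Y,X')\to F(Y,Y')$ is a cofibration. It induces a functor $\mathrm{Ho}(F)\colon\mathrm{Ho}(\mathcal C)\times\mathrm{Ho}(\mathcal D)\to\mathrm{Ho}(\mathcal E)$ with $\mathrm{Ho}(F)\circ(\gamma\times\gamma)=\gamma\circ F$. A functor $G\colon\mathcal S\times\mathcal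 T\to\mathcal U$ of triangulated categories is \emph{biexact} if it is equipped with natural isomorphisms $\theta\colon G(\Sigma-,-)\to\Sigma G(-,-)$ and $\zeta\colon G(-,\Sigma-)\to\Sigma G(-,-)$ such that every $G(X,-)$ with $\zeta(X,-)$ and every $G(-,X')$ with $\theta(-,X')$ is exact, and $(\Sigma\zeta)\theta=-(\Sigma\theta)\zeta$ as morphisms $G(\Sigma X,\Sigma X')\to\Sigma^2G(X,X')$. A commutative square with edges $f\colon T\to U$, $g\colon T\to V$, $g'\colon U\to X$, $f'\colon V\to X$ is \emph{homotopy cartesian} if there is an exact triangle $T\xrightarrow{(f,-g)}U\oplus V\xrightarrow{(g',f')}X\to\Sigma T$. A biexact functor $G$ \emph{admits a strong Verdier structure} if for all exact triangles $X\xrightarrow{f}Y\xrightarrow{g}Z\xrightarrow{h}\Sigma X$ in $\mathcal S$ and $X'\xrightarrow{f'}Y'\xrightarrow{g'}Z'\xrightarrow{h'}\Sigma X'$ in $\mathcal T$ there are an object $W$ and exact triangles \begin{gather*} G(X,Y')\xrightarrow{j}W\xrightarrow{q}G(Z,X')\xrightarrow{\theta G(h,f')}\Sigma G(X,Y'),\\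 W\xrightarrow{i}G(Y,Y')\xrightarrow{G(g,g')}G(Z,Z')\xrightarrow{p}\Sigma W,\\ G(Y,X')\xrightarrow{j'}W\xrightarrow{q'}G(X,Z')\xrightarrow{\zeta G(f,h')}\Sigma G(Y,X') \end{gather*} such that \begin{gather*} q'j=G(X,g'),\quad ij=G(f,Y'),\quad ij'=G(Y,f'),\quad qj'=G(g,X'),\\ (\Sigma q)p=\zeta G(Z,h'),\quad(\Sigma q')p=\theta G(h,Z'), \end{gather*} the five squares \begin{gather*} j'\,G(f,X')=j\,G(X,f'),\quad G(Z,f')\,q=G(g,Y')\,i,\quad G(Y,g')\,i=G(f,Z')\,q',\\ (\Sigma j)\,\theta G(h,Y')=p\,G(Z,g'),\quad p\,G(g,Z')=(\Sigma j')\,\zeta G(Y,h') \end{gather*} commute and are homotopy cartesian, and the square $\Sigma(\zeta G(X,h'))\,\Sigma q'=-\Sigma(\theta G(h,X'))\,\Sigma q$ anticommutes and becomes homotopy cartesian after replacing one of its morphisms by its negative. \textbf{Theorem.} Let $F\colon\mathcal C\times\mathcal D\to\mathcal E$ be a biexact functor between stable cofibration categories. Then $\mathrm{Ho}(\mathcal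 C)$, $\mathrm{Ho}(\mathcal D)$ and $\mathrm{Ho}(\mathcal E)$ are triangulated categories with suspension $\Sigma$, where the exact triangles are those isomorphic to an elementary exact triangle, and with respect to these triangulations the induced functor $\mathrm{Ho}(F)\colon\mathrm{Ho}(\mathcal C)\times\mathrm{Ho}(\mathcal D)\to\mathrm{Ho}(\mathcal E)$ is a biexact functor of triangulated categories that admits a strong Verdier structure. Here the isomorphisms $\theta$ and $\zeta$ are the canonical ones: $\theta(X,X')=\gamma\bigl(F(CX,X')/F(X,X')\to K/F(X,X')\xleftarrow{\sim}C F(X,X')/F(X,X')\bigr)$ for any cone extension $K$ of the identity of $F(X,X')$ with respect to the cones $F(CX,X')$ and $CF(X,X')$, where $F(\Sigma X,X')$ is identified with $F(CX,X')/F(X,X')$; and similarly for $\zeta$. -/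

import Mathlib

open CategoryTheory Category Limits HomotopicalAlgebra Pretriangulated
open scoped ZeroObject Prod

universe v u v₁ v₂ v₃ u₁ u₂ u₃

/-! ## Biexact functors of triangulated categories and strong Verdier structures -/

namespace TriangulatedBifunctor

/-- The square with top `g : A ⟶ V`, left `f : A ⟶ U`, right `f' : V ⟶ X` and bottom `g' : U ⟶ X`
is homotopy cartesian if it commutes and there is an exact triangle `A ⟶ U ⊞ V ⟶ X ⟶ A⟦1⟧` with
first morphism `(f, -g)` and second morphism `(g', f')`. -/
def IsHomotopyCartesian {T : Type u} [Category.{v} T] [Preadditive T] [HasZeroObject T]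
    [HasShift T ℤ] [∀ n : ℤ, (shiftFunctor T n).Additive] [Pretriangulated T]
    {A U V X : T} (g : A ⟶ V) (f : A ⟶ U) (f' : V ⟶ X) (g' : U ⟶ X) : Prop :=
  f ≫ g' = g ≫ f' ∧
    ∃ d : X ⟶ A⟦(1 : ℤ)⟧, Triangle.mk (biprod.lift f (-g)) (biprod.desc g' f') d ∈ distTriang T

variable {S : Type u₁} [Category.{v₁} S] [Preadditive S] [HasZeroObject S] [HasShift S ℤ]
  [∀ n : ℤ, (shiftFunctor S n).Additive] [Pretriangulated S]
  {T : Type u₂} [Category.{v₂} T] [Preadditive T] [HasZeroObject T] [HasShift T ℤ]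
  [∀ n : ℤ, (shiftFunctor T n).Additive] [Pretriangulated T]
  {U : Type u₃} [Category.{v₃} U] [Preadditive U] [HasZeroObject U] [HasShift U ℤ]
  [∀ n : ℤ, (shiftFunctor U n).Additive] [Pretriangulated U]

/-- The structure of a biexact functor on a bifunctor `F : S × T ⥤ U` of triangulated categories:
natural isomorphisms `θ : F(ΣX, X') ≅ ΣF(X, X')` and `ζ : F(X, ΣX') ≅ ΣF(X, X')` which make `F`
exact in each variable and for which the square from `F(ΣX, ΣX')` to `Σ²F(X, X')` anticommutes. -/
structure Biexact (F : S × T ⥤ U) where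
  θ : (shiftFunctor S (1 : ℤ)).prod (𝟭 T) ⋙ F ≅ F ⋙ shiftFunctor U (1 : ℤ)
  ζ : (𝟭 S).prod (shiftFunctor T (1 : ℤ)) ⋙ F ≅ F ⋙ shiftFunctor U (1 : ℤ)
  exact_right (X : S) (t' : Triangle T) : t' ∈ distTriang T →
    Triangle.mk (F.map (𝟙 X ×ₘ t'.mor₁)) (F.map (𝟙 X ×ₘ t'.mor₂))
      (F.map (𝟙 X ×ₘ t'.mor₃) ≫ ζ.hom.app (X, t'.obj₁)) ∈ distTriang U
  exact_left (X' : T) (t : Triangle S) : t ∈ distTriang S →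
    Triangle.mk (F.map (t.mor₁ ×ₘ 𝟙 X')) (F.map (t.mor₂ ×ₘ 𝟙 X'))
      (F.map (t.mor₃ ×ₘ 𝟙 X') ≫ θ.hom.app (t.obj₁, X')) ∈ distTriang U
  anticomm (X : S) (X' : T) :
    θ.hom.app (X, X'⟦(1 : ℤ)⟧) ≫ (ζ.hom.app (X, X'))⟦(1 : ℤ)⟧' =
      -(ζ.hom.app (X⟦(1 : ℤ)⟧, X') ≫ (θ.hom.app (X, X'))⟦(1 : ℤ)⟧')

namespace Biexact

variable {F : S × T ⥤ U} (B : Biexact F)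

/-- The morphism `F(Z, X') ⟶ ΣF(X, X')` induced by `h : Z ⟶ ΣX`. -/
abbrev connLeft {Z X : S} (h : Z ⟶ X⟦(1 : ℤ)⟧) (X' : T) :
    F.obj (Z, X') ⟶ (F.obj (X, X'))⟦(1 : ℤ)⟧ :=
  F.map (h ×ₘ 𝟙 X') ≫ B.θ.hom.app (X, X')

/-- The morphism `F(X, Z') ⟶ ΣF(X, X')` induced by `h' : Z' ⟶ ΣX'`. -/
abbrev connRight (X : S) {Z' X' : T} (h' : Z' ⟶ X'⟦(1 : ℤ)⟧) :
    F.obj (X, Z') ⟶ (F.obj (X, X'))⟦(1 : ℤ)⟧ :=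
  F.map (𝟙 X ×ₘ h') ≫ B.ζ.hom.app (X, X')

/-- The data of an object `W` and three exact triangles as in a Verdier structure, for the
triangles `X ⟶ Y ⟶ Z ⟶ ΣX` and `X' ⟶ Y' ⟶ Z' ⟶ ΣX'` with morphisms `f, g, h` and `f', g', h'`,
making the diagram of `F` applied to the two triangles commute. -/
structure VerdierDiagram {X Y Z : S} (f : X ⟶ Y) (g : Y ⟶ Z) (h : Z ⟶ X⟦(1 : ℤ)⟧)
    {X' Y' Z' : T} (f' : X' ⟶ Y') (g' : Y' ⟶ Z') (h' : Z' ⟶ X'⟦(1 : ℤ)⟧) where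
  W : U
  j : F.obj (X, Y') ⟶ W
  q : W ⟶ F.obj (Z, X')
  i : W ⟶ F.obj (Y, Y')
  p : F.obj (Z, Z') ⟶ W⟦(1 : ℤ)⟧
  j' : F.obj (Y, X') ⟶ W
  q' : W ⟶ F.obj (X, Z')
  -- the three exact triangles
  mem₁ : Triangle.mk j q (F.map (h ×ₘ f') ≫ B.θ.hom.app (X, Y')) ∈ distTriang U
  mem₂ : Triangle.mk i (F.map (g ×ₘ g')) p ∈ distTriang U
  mem₃ : Triangle.mk j' q' (F.map (f ×ₘ h') ≫ B.ζ.hom.app (Y, X')) ∈ distTriang U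
  -- the commutative triangles
  tri₁ : j ≫ q' = F.map (𝟙 X ×ₘ g')
  tri₂ : j ≫ i = F.map (f ×ₘ 𝟙 Y')
  tri₃ : j' ≫ i = F.map (𝟙 Y ×ₘ f')
  tri₄ : j' ≫ q = F.map (g ×ₘ 𝟙 X')
  tri₅ : p ≫ q⟦(1 : ℤ)⟧' = B.connRight Z h'
  tri₆ : p ≫ q'⟦(1 : ℤ)⟧' = B.connLeft h Z'
  -- the commutative squares, and the anticommutative square with target `Σ²F(X, X')`
  sq₁ : F.map (f ×ₘ 𝟙 X') ≫ j' = F.map (𝟙 X ×ₘ f') ≫ j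
  sq₂ : q ≫ F.map (𝟙 Z ×ₘ f') = i ≫ F.map (g ×ₘ 𝟙 Y')
  sq₃ : i ≫ F.map (𝟙 Y ×ₘ g') = q' ≫ F.map (f ×ₘ 𝟙 Z')
  sq₄ : B.connLeft h Y' ≫ j⟦(1 : ℤ)⟧' = F.map (𝟙 Z ×ₘ g') ≫ p
  sq₅ : F.map (g ×ₘ 𝟙 Z') ≫ p = B.connRight Y h' ≫ j'⟦(1 : ℤ)⟧'
  sq₆ : q'⟦(1 : ℤ)⟧' ≫ (B.connRight X h')⟦(1 : ℤ)⟧' =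
    -(q⟦(1 : ℤ)⟧' ≫ (B.connLeft h X')⟦(1 : ℤ)⟧')

/-- A Verdier diagram is strong if its squares `sq₁` to `sq₆` are homotopy cartesian. In the
anticommutative square `sq₆`, one of the morphisms has to be replaced by its negative; it does not
matter which one. -/
structure VerdierDiagram.IsStrong {X Y Z : S} {f : X ⟶ Y} {g : Y ⟶ Z} {h : Z ⟶ X⟦(1 : ℤ)⟧}
    {X' Y' Z' : T} {f' : X' ⟶ Y'} {g' : Y' ⟶ Z'} {h' : Z' ⟶ X'⟦(1 : ℤ)⟧}
    (V : B.VerdierDiagram f g h f' g' h') : Prop where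
  cart₁ : IsHomotopyCartesian (F.map (f ×ₘ 𝟙 X')) (F.map (𝟙 X ×ₘ f')) V.j' V.j
  cart₂ : IsHomotopyCartesian V.q V.i (F.map (𝟙 Z ×ₘ f')) (F.map (g ×ₘ 𝟙 Y'))
  cart₃ : IsHomotopyCartesian V.i V.q' (F.map (𝟙 Y ×ₘ g')) (F.map (f ×ₘ 𝟙 Z'))
  cart₄ : IsHomotopyCartesian (B.connLeft h Y') (F.map (𝟙 Z ×ₘ g')) (V.j⟦(1 : ℤ)⟧') V.p
  cart₅ : IsHomotopyCartesian (F.map (g ×ₘ 𝟙 Z')) (B.connRight Y h') V.p (V.j'⟦(1 : ℤ)⟧')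
  cart₆ : IsHomotopyCartesian (V.q'⟦(1 : ℤ)⟧') (V.q⟦(1 : ℤ)⟧') ((B.connRight X h')⟦(1 : ℤ)⟧')
    (-(B.connLeft h X')⟦(1 : ℤ)⟧')

/-- A biexact functor admits a strong Verdier structure if any two exact triangles have a strong
Verdier diagram. -/
def AdmitsStrongVerdierStructure : Prop :=
  ∀ (t : Triangle S) (t' : Triangle T), t ∈ distTriang S → t' ∈ distTriang T →
    ∃ V : B.VerdierDiagram t.mor₁ t.mor₂ t.mor₃ t'.mor₁ t'.mor₂ t'.mor₃, V.IsStrong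

end Biexact

end TriangulatedBifunctor

/-! ## Cofibration categories -/

/-- A cofibration category: a category with cofibrations and weak equivalences such that
isomorphisms are weak equivalences and weak equivalences have the two-out-of-three property,
isomorphisms are cofibrations and cofibrations are closed under composition, pushouts along
cofibrations exist and preserve cofibrations and acyclic cofibrations, there is an initial object
and all morphisms from initial objects are cofibrations, and every morphism factors as a
cofibration followed by a weak equivalence. -/
class CofibrationCategory (C : Type u) [Category.{v} C] extends
    CategoryWithCofibrations C, CategoryWithWeakEquivalences C where
  weakEquivalence_of_isIso {X Y : C} (f : X ⟶ Y) [IsIso f] : WeakEquivalence f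
  twoOutOfThree : (HomotopicalAlgebra.weakEquivalences C).HasTwoOutOfThreeProperty
  cofibration_of_isIso {X Y : C} (f : X ⟶ Y) [IsIso f] : Cofibration f
  cofibration_comp {X Y Z : C} (f : X ⟶ Y) (g : Y ⟶ Z) [Cofibration f] [Cofibration g] :
    Cofibration (f ≫ g)
  hasPushout {X Y Z : C} (f : X ⟶ Y) (g : X ⟶ Z) [Cofibration f] : HasPushout f g
  cofibration_of_isPushout {X Y Z P : C} {f : X ⟶ Y} {g : X ⟶ Z} {f' : Y ⟶ P} {g' : Z ⟶ P}
    (sq : IsPushout f g f' g') [Cofibration f] : Cofibration g'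
  weakEquivalence_of_isPushout {X Y Z P : C} {f : X ⟶ Y} {g : X ⟶ Z} {f' : Y ⟶ P} {g' : Z ⟶ P}
    (sq : IsPushout f g f' g') [Cofibration f] [WeakEquivalence f] : WeakEquivalence g'
  hasInitial : HasInitial C
  cofibration_of_isInitial {X Y : C} (hX : IsInitial X) (f : X ⟶ Y) : Cofibration f
  exists_factorization {X Y : C} (f : X ⟶ Y) :
    ∃ (Z : C) (i : X ⟶ Z) (w : Z ⟶ Y), Cofibration i ∧ WeakEquivalence w ∧ i ≫ w = f

namespace CofibrationCategory

attribute [instance] hasPushout twoOutOfThree cofibration_comp weakEquivalence_of_isIso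
  cofibration_of_isIso

section Basic

variable {C : Type u} [Category.{v} C] [CofibrationCategory C]

instance {X Y Z : C} (f : X ⟶ Y) (g : X ⟶ Z) [Cofibration f] :
    Cofibration (pushout.inr f g) :=
  cofibration_of_isPushout (IsPushout.of_hasPushout f g)

instance {X Y Z : C} (f : X ⟶ Y) (g : X ⟶ Z) [Cofibration f] [WeakEquivalence f] :
    WeakEquivalence (pushout.inr f g) :=
  weakEquivalence_of_isPushout (IsPushout.of_hasPushout f g)

lemma cofibration_inl {X Y Z : C} (f : X ⟶ Y) (g : X ⟶ Z) [Cofibration f] [Cofibration g] :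
    Cofibration (pushout.inl f g) :=
  cofibration_of_isPushout (IsPushout.of_hasPushout f g).flip

lemma weakEquivalence_inl {X Y Z : C} (f : X ⟶ Y) (g : X ⟶ Z) [Cofibration f] [Cofibration g]
    [WeakEquivalence g] : WeakEquivalence (pushout.inl f g) :=
  weakEquivalence_of_isPushout (IsPushout.of_hasPushout f g).flip

lemma we_comp {X Y Z : C} (f : X ⟶ Y) (g : Y ⟶ Z) (hf : WeakEquivalence f)
    (hg : WeakEquivalence g) : WeakEquivalence (f ≫ g) :=
  ⟨(weakEquivalences C).comp_mem f g hf.mem hg.mem⟩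

lemma we_of_postcomp {X Y Z : C} (f : X ⟶ Y) (g : Y ⟶ Z) (hg : WeakEquivalence g)
    (hfg : WeakEquivalence (f ≫ g)) : WeakEquivalence f :=
  ⟨(weakEquivalences C).of_postcomp f g hg.mem hfg.mem⟩

lemma we_of_precomp {X Y Z : C} (f : X ⟶ Y) (g : Y ⟶ Z) (hf : WeakEquivalence f)
    (hfg : WeakEquivalence (f ≫ g)) : WeakEquivalence g :=
  ⟨(weakEquivalences C).of_precomp f g hf.mem hfg.mem⟩

instance : (weakEquivalences C).ContainsIdentities where
  id_mem X := (weakEquivalence_of_isIso (𝟙 X)).mem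

end Basic

/-! ## The homotopy category -/

/-- The homotopy category: the localization at the weak equivalences. -/
abbrev Ho (C : Type u) [Category.{v} C] [CofibrationCategory C] : Type _ :=
  (weakEquivalences C).Localization

/-- The localization functor. -/
abbrev γ (C : Type u) [Category.{v} C] [CofibrationCategory C] : C ⥤ Ho C :=
  (weakEquivalences C).Q

instance isIso_γ_map {C : Type u} [Category.{v} C] [CofibrationCategory C] {X Y : C} (w : X ⟶ Y)
    [WeakEquivalence w] : IsIso ((γ C).map w) :=
  (weakEquivalences C).Q_inverts w (mem_weakEquivalences w)

/-! ## Pointed cofibration categories: quotients, cones, suspension -/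

/- A cofibration category is pointed if its initial objects are terminal, that is, if it has a
zero object. -/
section Zero

variable {C : Type u} [Category.{v} C] [HasZeroObject C]

/-- The unique morphism to the zero object. -/
noncomputable abbrev toZero (X : C) : X ⟶ (0 : C) := (isZero_zero C).from_ X

/-- The unique morphism from the zero object. -/
noncomputable abbrev fromZero (X : C) : (0 : C) ⟶ X := (isZero_zero C).to_ X

lemma comp_toZero {X Y : C} (f : X ⟶ Y) : f ≫ toZero Y = toZero X :=
  (isZero_zero C).eq_of_tgt _ _

lemma fromZero_ext {X : C} (f g : (0 : C) ⟶ X) : f = g := (isZero_zero C).eq_of_src _ _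

end Zero

section Pointed

variable {C : Type u} [Category.{v} C] [CofibrationCategory C] [HasZeroObject C]

instance (X : C) : Cofibration (fromZero X) :=
  cofibration_of_isInitial (isZero_zero C).isInitial _

/-- The quotient `Y/X = Y ∪_X *` of a cofibration `X ⟶ Y`. -/
noncomputable abbrev quot {X Y : C} (f : X ⟶ Y) [Cofibration f] : C := pushout f (toZero X)

/-- The projection `Y ⟶ Y/X`. -/
noncomputable abbrev quotπ {X Y : C} (f : X ⟶ Y) [Cofibration f] : Y ⟶ quot f :=
  pushout.inl f (toZero X)

lemma comp_quotπ {X Y : C} (f : X ⟶ Y) [Cofibration f] :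
    f ≫ quotπ f = toZero X ≫ fromZero (quot f) := by
  rw [pushout.condition, fromZero_ext (pushout.inr f (toZero X))]

lemma quot_ext {X Y Z : C} (f : X ⟶ Y) [Cofibration f] {a b : quot f ⟶ Z}
    (h : quotπ f ≫ a = quotπ f ≫ b) : a = b :=
  pushout.hom_ext h (fromZero_ext _ _)

/-- The morphism `Y/X ⟶ Z` induced by a morphism `Y ⟶ Z` that is trivial on `X`. -/
noncomputable def quotDesc {X Y Z : C} (f : X ⟶ Y) [Cofibration f] (b : Y ⟶ Z)
    (h : f ≫ b = toZero X ≫ fromZero Z) : quot f ⟶ Z :=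
  pushout.desc b (fromZero Z) h

@[simp]
lemma quotπ_desc {X Y Z : C} (f : X ⟶ Y) [Cofibration f] (b : Y ⟶ Z)
    (h : f ≫ b = toZero X ≫ fromZero Z) : quotπ f ≫ quotDesc f b h = b :=
  pushout.inl_desc _ _ _

/-- The morphism `Y/X ⟶ Y'/X'` induced by a commutative square. -/
noncomputable def quotMap {X Y X' Y' : C} (f : X ⟶ Y) (f' : X' ⟶ Y') [Cofibration f]
    [Cofibration f'] (a : X ⟶ X') (b : Y ⟶ Y') (h : f ≫ b = a ≫ f') : quot f ⟶ quot f' :=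
  quotDesc f (b ≫ quotπ f') (by
    rw [reassoc_of% h, comp_quotπ, ← assoc, comp_toZero])

@[simp]
lemma quotπ_map {X Y X' Y' : C} (f : X ⟶ Y) (f' : X' ⟶ Y') [Cofibration f]
    [Cofibration f'] (a : X ⟶ X') (b : Y ⟶ Y') (h : f ≫ b = a ≫ f') :
    quotπ f ≫ quotMap f f' a b h = b ≫ quotπ f' :=
  quotπ_desc _ _ _

lemma quotMap_comp {X Y X' Y' X'' Y'' : C} (f : X ⟶ Y) (f' : X' ⟶ Y') (f'' : X'' ⟶ Y'')
    [Cofibration f] [Cofibration f'] [Cofibration f''] (a : X ⟶ X') (b : Y ⟶ Y')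
    (h : f ≫ b = a ≫ f') (a' : X' ⟶ X'') (b' : Y' ⟶ Y'') (h' : f' ≫ b' = a' ≫ f'')
    (a'' : X ⟶ X'') (b'' : Y ⟶ Y'') (h'' : f ≫ b'' = a'' ≫ f'') (hb : b ≫ b' = b'') :
    quotMap f f' a b h ≫ quotMap f' f'' a' b' h' = quotMap f f'' a'' b'' h'' := by
  subst hb
  apply quot_ext
  rw [← assoc, quotπ_map, assoc, quotπ_map, quotπ_map, assoc]

/-- If the square `a ≫ f' = f ≫ b` is a pushout square, then the induced morphism on quotients is
an isomorphism. -/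
lemma isIso_quotMap {X Y X' Y' : C} (f : X ⟶ Y) (f' : X' ⟶ Y') [Cofibration f]
    [Cofibration f'] (a : X ⟶ X') (b : Y ⟶ Y') (sq : IsPushout f a b f') :
    IsIso (quotMap f f' a b sq.w) := by
  let inv : quot f' ⟶ quot f := quotDesc f' (sq.desc (quotπ f) (toZero X' ≫ fromZero _) (by
    rw [comp_quotπ, ← assoc, comp_toZero])) (sq.inr_desc _ _ _)
  have hinv : quotπ f' ≫ inv = sq.desc (quotπ f) (toZero X' ≫ fromZero _) (by
    rw [comp_quotπ, ← assoc, comp_toZero]) := quotπ_desc _ _ _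
  refine ⟨inv, ?_, ?_⟩
  · apply quot_ext
    rw [← assoc, quotπ_map, assoc, hinv, sq.inl_desc, comp_id]
  · apply quot_ext
    rw [comp_id]
    apply sq.hom_ext
    · rw [reassoc_of% hinv, ← assoc, sq.inl_desc, quotπ_map]
    · rw [reassoc_of% hinv, ← assoc, sq.inr_desc, assoc, comp_quotπ]
      congr 1
      exact fromZero_ext _ _

/-- An acyclic cofibration `s` under `X` induces a weak equivalence on quotients. -/
lemma weakEquivalence_quotMap {X Y Z : C} (i : X ⟶ Y) (t : X ⟶ Z) (s : Y ⟶ Z) [Cofibration i]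
    [Cofibration t] [Cofibration s] [WeakEquivalence s] (h : i ≫ s = 𝟙 X ≫ t) :
    WeakEquivalence (quotMap i t (𝟙 X) s h) := by
  have h₁ : IsPushout (toZero X) i (pushout.inr i (toZero X)) (quotπ i) :=
    (IsPushout.of_hasPushout i (toZero X)).flip
  have h₂ : IsPushout (toZero X) (i ≫ s) (pushout.inr t (toZero X)) (quotπ t) := by
    rw [h, id_comp]
    exact (IsPushout.of_hasPushout t (toZero X)).flip
  have h₃ : IsPushout (quotπ i) s (quotMap i t (𝟙 X) s h) (quotπ t) := by
    refine IsPushout.of_top (h₁₁ := toZero X) (v₁₁ := i) (v₁₂ := pushout.inr i (toZero X))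
      ?_ (quotπ_map _ _ _ _ _) h₁
    rwa [fromZero_ext (pushout.inr i (toZero X) ≫ quotMap i t (𝟙 X) s h)
      (pushout.inr t (toZero X))]
  exact weakEquivalence_of_isPushout h₃.flip

/-- An object `A` is weakly contractible if `A ⟶ *` is a weak equivalence. -/
abbrev WeaklyContractible (A : C) : Prop := WeakEquivalence (toZero A)

lemma we_of_contractible {A B : C} (f : A ⟶ B) (hA : WeaklyContractible A)
    (hB : WeaklyContractible B) : WeakEquivalence f :=
  we_of_postcomp f (toZero B) hB (by rwa [comp_toZero])

lemma contractible_of_we {A B : C} (f : A ⟶ B) [hf : WeakEquivalence f]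
    (hA : WeaklyContractible A) : WeaklyContractible B :=
  we_of_precomp f (toZero B) hf (by rwa [comp_toZero])

lemma isPushout_quot {X Y : C} (i : X ⟶ Y) [Cofibration i] :
    IsPushout i (toZero X) (quotπ i) (fromZero (quot i)) := by
  rw [fromZero_ext (fromZero (quot i)) (pushout.inr i (toZero X))]
  exact IsPushout.of_hasPushout i (toZero X)

lemma isPushout_coprod (X Y : C) : IsPushout (fromZero X) (fromZero Y)
    (pushout.inl (fromZero X) (fromZero Y)) (pushout.inr (fromZero X) (fromZero Y)) :=
  IsPushout.of_hasPushout _ _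

/-- Collapsing a weakly contractible subobject is a weak equivalence. -/
lemma weakEquivalence_quotπ {A T : C} (i : A ⟶ T) [Cofibration i] (hA : WeaklyContractible A) :
    WeakEquivalence (quotπ i) := by
  -- a cylinder object `I` of `A`
  obtain ⟨I, k, w, hk, hw, fac⟩ := exists_factorization
    (pushout.desc (f := fromZero A) (g := fromZero A) (𝟙 A) (𝟙 A) (fromZero_ext _ _))
  let k₀ : A ⟶ I := pushout.inl _ _ ≫ k
  let k₁ : A ⟶ I := pushout.inr _ _ ≫ k
  have ck₀ : Cofibration k₀ := by
    have := cofibration_inl (fromZero A) (fromZero A)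
    dsimp only [k₀]; infer_instance
  have ck₁ : Cofibration k₁ := by dsimp only [k₁]; infer_instance
  have fk₀ : k₀ ≫ w = 𝟙 A := by simp only [k₀, assoc, fac, pushout.inl_desc]
  have fk₁ : k₁ ≫ w = 𝟙 A := by simp only [k₁, assoc, fac, pushout.inr_desc]
  have wk₀ : WeakEquivalence k₀ := we_of_postcomp k₀ w hw (by rw [fk₀]; infer_instance)
  have wk₁ : WeakEquivalence k₁ := we_of_postcomp k₁ w hw (by rw [fk₁]; infer_instance)
  -- the object `N = T ∪ I`, glued at one end of the cylinder
  let u : pushout (fromZero A) (fromZero A) ⟶ pushout (fromZero T) (fromZero A) :=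
    pushout.desc (i ≫ pushout.inl _ _) (pushout.inr _ _) (fromZero_ext _ _)
  have hu₀ : pushout.inl _ _ ≫ u = i ≫ pushout.inl _ _ := pushout.inl_desc _ _ _
  have hu₁ : pushout.inr _ _ ≫ u = pushout.inr _ _ := pushout.inr_desc _ _ _
  have sq₁ : IsPushout i (pushout.inl (fromZero A) (fromZero A))
      (pushout.inl (fromZero T) (fromZero A)) u := by
    refine IsPushout.of_left (h₁₁ := fromZero A) (v₁₁ := fromZero A)
      (h₂₁ := pushout.inr (fromZero A) (fromZero A)) ?_ hu₀.symm (isPushout_coprod A A)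
    rw [hu₁, fromZero_ext (fromZero A ≫ i) (fromZero T)]
    exact isPushout_coprod T A
  let e₀ : T ⟶ pushout k u := pushout.inl _ _ ≫ pushout.inr k u
  let e₁ : A ⟶ pushout k u := pushout.inr _ _ ≫ pushout.inr k u
  have ce₁ : Cofibration e₁ := by dsimp only [e₁]; infer_instance
  have sq₂ : IsPushout i k₀ e₀ (pushout.inl k u) := sq₁.paste_vert (IsPushout.of_hasPushout k u).flip
  have we₀ : WeakEquivalence e₀ := weakEquivalence_of_isPushout sq₂.flip
  have he₁ : k₁ ≫ pushout.inl k u = e₁ := by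
    dsimp only [k₁, e₁]
    rw [assoc, pushout.condition, reassoc_of% hu₁]
  -- the object `J`, a cylinder object of `T` containing `N`
  let n : pushout k u ⟶ T := pushout.desc (w ≫ i) (pushout.desc (𝟙 T) i (fromZero_ext _ _)) (by
    rw [reassoc_of% fac]
    apply pushout.hom_ext
    · rw [reassoc_of% hu₀, pushout.inl_desc, pushout.inl_desc_assoc, comp_id, id_comp]
    · rw [reassoc_of% hu₁, pushout.inr_desc, pushout.inr_desc_assoc, id_comp])
  have hn₀ : e₀ ≫ n = 𝟙 T := by
    dsimp only [e₀, n]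
    rw [assoc, pushout.inr_desc, pushout.inl_desc]
  have hn₁ : e₁ ≫ n = i := by
    dsimp only [e₁, n]
    rw [assoc, pushout.inr_desc, pushout.inr_desc]
  obtain ⟨J, j, p, hj, hp, facJ⟩ := exists_factorization
    (pushout.desc (f := e₁) (g := i) n (𝟙 T) (by rw [hn₁, comp_id]))
  let m : pushout k u ⟶ J := pushout.inl e₁ i ≫ j
  let t₁ : T ⟶ J := pushout.inr e₁ i ≫ j
  have cm : Cofibration m := by
    have := cofibration_inl e₁ i
    dsimp only [m]; infer_instance
  have ct₁ : Cofibration t₁ := by dsimp only [t₁]; infer_instance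
  have hm : m ≫ p = n := by simp only [m, assoc, facJ, pushout.inl_desc]
  have ht₁ : t₁ ≫ p = 𝟙 T := by simp only [t₁, assoc, facJ, pushout.inr_desc]
  have wt₁ : WeakEquivalence t₁ := we_of_postcomp t₁ p hp (by rw [ht₁]; infer_instance)
  have wt₀ : WeakEquivalence (e₀ ≫ m) :=
    we_of_postcomp _ p hp (by rw [assoc, hm, hn₀]; infer_instance)
  have wm : WeakEquivalence m := we_of_precomp e₀ m we₀ wt₀
  have hmt : e₁ ≫ m = i ≫ t₁ := by
    dsimp only [m, t₁]
    rw [pushout.condition_assoc]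
  -- collapse the free end of the cylinder
  have w₁ := weakEquivalence_quotMap e₁ (i ≫ t₁) m (by rw [hmt, id_comp])
  have w₂ := weakEquivalence_quotMap i (i ≫ t₁) t₁ (id_comp _).symm
  have w₃ : WeakEquivalence (e₀ ≫ quotπ e₁) := by
    have hI : WeaklyContractible (quot k₁) := by
      have h₀ : WeakEquivalence (fromZero (quot k₁)) :=
        weakEquivalence_of_isPushout (isPushout_quot k₁)
      exact contractible_of_we (fromZero (quot k₁)) (by
        rw [WeaklyContractible, (isZero_zero C).eq_of_tgt (toZero (0 : C)) (𝟙 _)]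
        infer_instance)
    have c : Cofibration (k₀ ≫ quotπ k₁) := by
      let z : pushout (fromZero A) (fromZero A) ⟶ A :=
        pushout.desc (𝟙 A) (toZero A ≫ fromZero A) (fromZero_ext _ _)
      have hz₀ : pushout.inl _ _ ≫ z = 𝟙 A := pushout.inl_desc _ _ _
      have hz₁ : pushout.inr _ _ ≫ z = toZero A ≫ fromZero A := pushout.inr_desc _ _ _
      have s₁ : IsPushout (pushout.inr (fromZero A) (fromZero A)) (toZero A) z (fromZero A) := by
        refine IsPushout.of_top (h₁₁ := fromZero A) (v₁₁ := fromZero A)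
          (v₁₂ := pushout.inl (fromZero A) (fromZero A)) ?_ hz₁ (isPushout_coprod A A)
        rw [hz₀, (isZero_zero C).eq_of_src (fromZero A ≫ toZero A) (𝟙 _)]
        exact IsPushout.of_vert_isIso ⟨by simp⟩
      have hc : k ≫ quotπ k₁ = z ≫ k₀ ≫ quotπ k₁ := by
        apply pushout.hom_ext
        · rw [reassoc_of% hz₀]
          simp only [k₀, assoc]
        · rw [reassoc_of% hz₁, ← assoc]
          change k₁ ≫ quotπ k₁ = _
          rw [comp_quotπ]
          congr 1
          exact fromZero_ext _ _
      have s₂ : IsPushout k z (quotπ k₁) (k₀ ≫ quotπ k₁) := by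
        refine IsPushout.of_left (h₁₁ := pushout.inr (fromZero A) (fromZero A))
          (v₁₁ := toZero A) (h₂₁ := fromZero A) ?_ hc s₁
        rw [fromZero_ext (fromZero A ≫ k₀ ≫ quotπ k₁) (fromZero (quot k₁))]
        exact isPushout_quot k₁
      exact cofibration_of_isPushout s₂
    have hw : WeakEquivalence (k₀ ≫ quotπ k₁) := we_of_contractible _ hA hI
    let φ : quot k₁ ⟶ quot e₁ := quotMap k₁ e₁ (𝟙 A) (pushout.inl k u) (by rw [he₁, id_comp])
    have hφ : quotπ k₁ ≫ φ = pushout.inl k u ≫ quotπ e₁ := quotπ_map _ _ _ _ _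
    have s₃ : IsPushout (pushout.inl k u) (quotπ k₁) (quotπ e₁) φ := by
      refine IsPushout.of_left (h₁₁ := k₁) (v₁₁ := toZero A) (h₂₁ := fromZero (quot k₁))
        ?_ hφ.symm (isPushout_quot k₁)
      rw [he₁, fromZero_ext (fromZero (quot k₁) ≫ φ) (fromZero (quot e₁))]
      exact isPushout_quot e₁
    exact weakEquivalence_of_isPushout (sq₂.paste_vert s₃).flip
  have w₄ : WeakEquivalence ((e₀ ≫ m) ≫ quotπ (i ≫ t₁)) := by
    have := we_comp _ _ w₃ w₁
    rw [assoc, quotπ_map] at this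
    rw [assoc]
    exact this
  have w₅ := we_of_precomp _ _ wt₀ w₄
  have w₆ := we_comp _ _ wt₁ w₅
  rw [← quotπ_map i (i ≫ t₁) (𝟙 A) t₁ (id_comp _).symm] at w₆
  exact we_of_postcomp _ _ w₂ w₆

/-- A cone of `X`: a cofibration from `X` to a weakly contractible object. -/
structure ConeOf (X : C) where
  pt : C
  ι : X ⟶ pt
  cofibration : Cofibration ι
  contractible : WeaklyContractible pt

attribute [instance] ConeOf.cofibration

/-- A cone extension of `f : X ⟶ Y` with respect to cones `A` of `X` and `B` of `Y`: morphisms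
`map : A ⟶ pt` and an acyclic cofibration `s : B ⟶ pt`, compatible with `f`, such that the induced
morphism `A ∪_X B ⟶ pt` is a cofibration. -/
structure ConeExtension {X Y : C} (f : X ⟶ Y) (A : ConeOf X) (B : ConeOf Y) where
  pt : C
  map : A.pt ⟶ pt
  s : B.pt ⟶ pt
  comm : A.ι ≫ map = (f ≫ B.ι) ≫ s
  cofibration_s : Cofibration s
  weakEquivalence_s : WeakEquivalence s
  cofibration_desc : Cofibration (pushout.desc map s comm)

attribute [instance] ConeExtension.cofibration_s ConeExtension.weakEquivalence_s
  ConeExtension.cofibration_desc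

namespace ConeExtension

lemma exists_coneExtension {X Y : C} (f : X ⟶ Y) (A : ConeOf X) (B : ConeOf Y) :
    Nonempty (ConeExtension f A B) := by
  obtain ⟨Z, i, w, hi, hw, -⟩ := exists_factorization (toZero (pushout A.ι (f ≫ B.ι)))
  have hZ : WeaklyContractible Z := by
    rw [WeaklyContractible, (isZero_zero C).eq_of_tgt (toZero Z) w]
    exact hw
  exact ⟨{
    pt := Z
    map := pushout.inl _ _ ≫ i
    s := pushout.inr _ _ ≫ i
    comm := by rw [← assoc, pushout.condition, assoc]
    cofibration_s := inferInstance
    weakEquivalence_s := we_of_contractible _ B.contractible hZ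
    cofibration_desc := by
      convert hi
      apply pushout.hom_ext
      · exact pushout.inl_desc _ _ _
      · exact pushout.inr_desc _ _ _ }⟩

variable {X Y : C} {f : X ⟶ Y} {A : ConeOf X} {B : ConeOf Y}

instance (E : ConeExtension f A B) :
    WeakEquivalence (quotMap B.ι (B.ι ≫ E.s) (𝟙 Y) E.s (id_comp _).symm) :=
  weakEquivalence_quotMap _ _ _ _

/-- The morphism `γ(A/X ⟶ pt/Y ⟵ B/Y)` in the homotopy category. -/
noncomputable def hoMap (E : ConeExtension f A B) :
    (γ C).obj (quot A.ι) ⟶ (γ C).obj (quot B.ι) :=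
  (γ C).map (quotMap A.ι (B.ι ≫ E.s) f E.map (by rw [E.comm, assoc])) ≫
    inv ((γ C).map (quotMap B.ι (B.ι ≫ E.s) (𝟙 Y) E.s (id_comp _).symm))

/-- The morphism `hoMap` can be computed using any acyclic cofibration `B ⟶ D`. -/
lemma hoMap_comp (E : ConeExtension f A B) {D : C} (m : A.pt ⟶ D) (s : B.pt ⟶ D) [Cofibration s]
    [WeakEquivalence s] (comm : A.ι ≫ m = (f ≫ B.ι) ≫ s) :
    E.hoMap ≫ (γ C).map (quotMap B.ι (B.ι ≫ s) (𝟙 Y) s (id_comp _).symm) =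
      (γ C).map (quotMap A.ι (B.ι ≫ s) f m (by rw [comm, assoc])) := by
  let G := pushout (pushout.desc E.map E.s E.comm) (pushout.desc m s comm)
  obtain ⟨Z, i, w, hi, hw, -⟩ := exists_factorization (toZero G)
  have hZ : WeaklyContractible Z := by
    rw [WeaklyContractible, (isZero_zero C).eq_of_tgt (toZero Z) w]
    exact hw
  let a : E.pt ⟶ Z := pushout.inl (pushout.desc E.map E.s E.comm) (pushout.desc m s comm) ≫ i
  let b : D ⟶ Z := pushout.inr (pushout.desc E.map E.s E.comm) (pushout.desc m s comm) ≫ i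
  have hb : WeakEquivalence b :=
    we_of_contractible _ (contractible_of_we s B.contractible) hZ
  have hb' : Cofibration b := by dsimp only [b]; infer_instance
  have hab : pushout.desc E.map E.s E.comm ≫ a = pushout.desc m s comm ≫ b := by
    dsimp only [a, b]
    rw [pushout.condition_assoc]
  have hm : E.map ≫ a = m ≫ b := by
    have := (pushout.inl A.ι (f ≫ B.ι)) ≫= hab
    rwa [pushout.inl_desc_assoc, pushout.inl_desc_assoc] at this
  have hs : E.s ≫ a = s ≫ b := by
    have := (pushout.inr A.ι (f ≫ B.ι)) ≫= hab
    rwa [pushout.inr_desc_assoc, pushout.inr_desc_assoc] at this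
  have hsb : WeakEquivalence (s ≫ b) := we_comp _ _ inferInstance hb
  have e₁ := weakEquivalence_quotMap B.ι (B.ι ≫ s ≫ b) (s ≫ b) (id_comp _).symm
  have e₂ := weakEquivalence_quotMap (B.ι ≫ s) (B.ι ≫ s ≫ b) b (by rw [assoc, id_comp])
  let qa : quot (B.ι ≫ E.s) ⟶ quot (B.ι ≫ s ≫ b) :=
    quotMap _ _ (𝟙 Y) a (by rw [assoc, id_comp, hs])
  let qb : quot (B.ι ≫ s) ⟶ quot (B.ι ≫ s ≫ b) :=
    quotMap _ _ (𝟙 Y) b (by rw [assoc, id_comp])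
  have h₁ : quotMap B.ι (B.ι ≫ E.s) (𝟙 Y) E.s (id_comp _).symm ≫ qa =
      quotMap B.ι (B.ι ≫ s) (𝟙 Y) s (id_comp _).symm ≫ qb := by
    apply quot_ext
    simp only [qa, qb, ← assoc, quotπ_map]
    simp only [assoc, quotπ_map, reassoc_of% hs]
  have h₂ : quotMap A.ι (B.ι ≫ E.s) f E.map (by rw [E.comm, assoc]) ≫ qa =
      quotMap A.ι (B.ι ≫ s) f m (by rw [comm, assoc]) ≫ qb := by
    apply quot_ext
    simp only [qa, qb, ← assoc, quotπ_map]
    simp only [assoc, quotπ_map, reassoc_of% hm]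
  have : IsIso ((γ C).map qb) := isIso_γ_map qb
  rw [← cancel_mono ((γ C).map qb), assoc, ← Functor.map_comp, ← h₁, Functor.map_comp, hoMap,
    assoc, IsIso.inv_hom_id_assoc, ← Functor.map_comp, h₂, Functor.map_comp]

lemma hoMap_id (E : ConeExtension (𝟙 X) A A) : E.hoMap = 𝟙 _ := by
  have h := E.hoMap_comp (𝟙 A.pt) (𝟙 A.pt) (by simp)
  have : WeakEquivalence (quotMap A.ι (A.ι ≫ 𝟙 A.pt) (𝟙 X) (𝟙 A.pt) (id_comp _).symm) :=
    weakEquivalence_quotMap _ _ _ _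
  rw [← cancel_mono ((γ C).map (quotMap A.ι (A.ι ≫ 𝟙 A.pt) (𝟙 X) (𝟙 A.pt) (id_comp _).symm)),
    h]
  exact (id_comp _).symm

lemma hoMap_hoMap {Z : C} {g : Y ⟶ Z} {D : ConeOf Z} (E : ConeExtension f A B)
    (E' : ConeExtension g B D) (E'' : ConeExtension (f ≫ g) A D) :
    E.hoMap ≫ E'.hoMap = E''.hoMap := by
  let l : E.pt ⟶ pushout E.s E'.map := pushout.inl _ _
  let r : E'.pt ⟶ pushout E.s E'.map := pushout.inr _ _
  have hlr : E.s ≫ l = E'.map ≫ r := pushout.condition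
  have hr : Cofibration r := by dsimp only [r]; infer_instance
  have hr' : WeakEquivalence r := by dsimp only [r]; infer_instance
  have hs : WeakEquivalence (E'.s ≫ r) := we_comp _ _ inferInstance hr'
  have hc : A.ι ≫ E.map ≫ l = ((f ≫ g) ≫ D.ι) ≫ E'.s ≫ r := by
    have h₁ := E.comm
    have h₂ := E'.comm
    simp only [assoc] at h₁ h₂ ⊢
    rw [reassoc_of% h₁, hlr, reassoc_of% h₂]
  have h := E''.hoMap_comp (E.map ≫ l) (E'.s ≫ r) hc
  have e₁ := weakEquivalence_quotMap D.ι (D.ι ≫ E'.s ≫ r) (E'.s ≫ r) (id_comp _).symm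
  let qr : quot (D.ι ≫ E'.s) ⟶ quot (D.ι ≫ E'.s ≫ r) :=
    quotMap _ _ (𝟙 Z) r (by rw [assoc, id_comp])
  let ql : quot (B.ι ≫ E.s) ⟶ quot (D.ι ≫ E'.s ≫ r) :=
    quotMap _ _ g l (by
      have h₂ := E'.comm
      simp only [assoc] at h₂ ⊢
      rw [hlr, reassoc_of% h₂])
  have k₁ : quotMap D.ι (D.ι ≫ E'.s) (𝟙 Z) E'.s (id_comp _).symm ≫ qr =
      quotMap D.ι (D.ι ≫ E'.s ≫ r) (𝟙 Z) (E'.s ≫ r) (id_comp _).symm :=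
    quotMap_comp _ _ _ _ _ _ _ _ _ _ _ _ rfl
  have k₂ : quotMap B.ι (D.ι ≫ E'.s) g E'.map (by rw [E'.comm, assoc]) ≫ qr =
      quotMap B.ι (B.ι ≫ E.s) (𝟙 Y) E.s (id_comp _).symm ≫ ql := by
    apply quot_ext
    simp only [qr, ql, ← assoc, quotπ_map]
    simp only [assoc, quotπ_map, reassoc_of% hlr]
  have k₃ : quotMap A.ι (B.ι ≫ E.s) f E.map (by rw [E.comm, assoc]) ≫ ql =
      quotMap A.ι (D.ι ≫ E'.s ≫ r) (f ≫ g) (E.map ≫ l) (by rw [hc, assoc]) :=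
    quotMap_comp _ _ _ _ _ _ _ _ _ _ _ _ rfl
  rw [← cancel_mono ((γ C).map
    (quotMap D.ι (D.ι ≫ E'.s ≫ r) (𝟙 Z) (E'.s ≫ r) (id_comp _).symm)), h, ← k₁,
    Functor.map_comp, ← k₃, Functor.map_comp]
  dsimp only [hoMap]
  rw [assoc, assoc, assoc, IsIso.inv_hom_id_assoc, ← Functor.map_comp, k₂, Functor.map_comp,
    IsIso.inv_hom_id_assoc]

lemma isIso_hoMap (E : ConeExtension f A B) [Cofibration f] [WeakEquivalence f] :
    IsIso E.hoMap := by
  have hl : WeakEquivalence (pushout.inl A.ι f) := weakEquivalence_inl _ _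
  let B₀ : ConeOf Y :=
    { pt := pushout A.ι f
      ι := pushout.inr A.ι f
      cofibration := inferInstance
      contractible := contractible_of_we (pushout.inl A.ι f) A.contractible }
  obtain ⟨E₀⟩ := exists_coneExtension f A B₀
  obtain ⟨E₁⟩ := exists_coneExtension (𝟙 Y) B₀ B
  obtain ⟨E₂⟩ := exists_coneExtension (𝟙 Y) B B₀
  obtain ⟨E₃⟩ := exists_coneExtension (𝟙 Y ≫ 𝟙 Y) B₀ B₀
  obtain ⟨E₄⟩ := exists_coneExtension (𝟙 Y ≫ 𝟙 Y) B B
  obtain ⟨E₅⟩ := exists_coneExtension (f ≫ 𝟙 Y) A B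
  have h₃ : E₃.hoMap = 𝟙 _ := by
    have key : ∀ (φ : Y ⟶ Y) (_ : φ = 𝟙 Y) (E : ConeExtension φ B₀ B₀), E.hoMap = 𝟙 _ := by
      rintro _ rfl E
      exact E.hoMap_id
    exact key _ (comp_id _) E₃
  have h₄ : E₄.hoMap = 𝟙 _ := by
    have key : ∀ (φ : Y ⟶ Y) (_ : φ = 𝟙 Y) (E : ConeExtension φ B B), E.hoMap = 𝟙 _ := by
      rintro _ rfl E
      exact E.hoMap_id
    exact key _ (comp_id _) E₄
  have h₁ : IsIso E₁.hoMap :=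
    ⟨E₂.hoMap, (E₁.hoMap_hoMap E₂ E₃).trans h₃, (E₂.hoMap_hoMap E₁ E₄).trans h₄⟩
  have h₀ : IsIso E₀.hoMap := by
    have h := E₀.hoMap_comp (pushout.inl A.ι f) (𝟙 _) (by rw [comp_id]; exact pushout.condition)
    have i₁ : WeakEquivalence (quotMap B₀.ι (B₀.ι ≫ 𝟙 _) (𝟙 Y) (𝟙 _) (id_comp _).symm) :=
      weakEquivalence_quotMap _ _ _ _
    have i₂ := isIso_quotMap A.ι (B₀.ι ≫ 𝟙 _) f (pushout.inl A.ι f)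
      (by rw [comp_id]; exact IsPushout.of_hasPushout A.ι f)
    have i₃ := (inferInstance : IsIso ((γ C).map (quotMap A.ι (B₀.ι ≫ 𝟙 _) f
      (pushout.inl A.ι f) (by rw [comp_id]; exact pushout.condition))))
    rw [← h] at i₃
    exact IsIso.of_isIso_comp_right E₀.hoMap
      ((γ C).map (quotMap B₀.ι (B₀.ι ≫ 𝟙 _) (𝟙 Y) (𝟙 _) (id_comp _).symm))
  have h₅ : E₅.hoMap = E.hoMap := by
    have key : ∀ (φ : X ⟶ Y) (_ : φ = f) (E₅ : ConeExtension φ A B), E₅.hoMap = E.hoMap := by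
      rintro φ rfl E₅
      have h := E₅.hoMap_comp E.map E.s E.comm
      rw [← E.hoMap_comp E.map E.s E.comm] at h
      exact (cancel_mono _).1 h
    exact key _ (comp_id _) E₅
  rw [← h₅, ← E₀.hoMap_hoMap E₁ E₅]
  infer_instance

/-- `hoMap` does not depend on the choice of the cone extension. -/
lemma hoMap_eq (E E' : ConeExtension f A B) : E.hoMap = E'.hoMap := by
  have h := E.hoMap_comp E'.map E'.s E'.comm
  rw [← E'.hoMap_comp E'.map E'.s E'.comm] at h
  exact (cancel_mono _).1 h

end ConeExtension

end Pointed

section Suspension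

/-- A choice of a cone `X ⟶ CX` for every object `X`. -/
class ChosenCones (C : Type u) [Category.{v} C] [CofibrationCategory C] [HasZeroObject C] where
  cone (X : C) : ConeOf X

variable (C : Type u) [Category.{v} C] [CofibrationCategory C] [HasZeroObject C] [ChosenCones C]

variable {C} in
/-- The chosen cone of `X`. -/
abbrev cone (X : C) : ConeOf X := ChosenCones.cone X

variable {C} in
/-- The suspension `CX/X` of an object `X`. -/
noncomputable abbrev susp (X : C) : C := quot (cone X).ι

/-- The suspension as a functor `C ⥤ Ho C`, sending `f : X ⟶ Y` to
`γ(CX/X ⟶ pt/Y ⟵ CY/Y)` for a cone extension of `f`. -/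
noncomputable def suspFunctor₀ : C ⥤ Ho C where
  obj X := (γ C).obj (susp X)
  map {X Y} f := (ConeExtension.exists_coneExtension f (cone X) (cone Y)).some.hoMap
  map_id _ := ConeExtension.hoMap_id _
  map_comp _ _ := (ConeExtension.hoMap_hoMap _ _ _).symm

lemma suspFunctor₀_isInvertedBy : (weakEquivalences C).IsInvertedBy (suspFunctor₀ C) := by
  intro X Y f hf
  have key {X Y : C} (f : X ⟶ Y) [Cofibration f] [WeakEquivalence f] :
      IsIso ((suspFunctor₀ C).map f) := ConeExtension.isIso_hoMap _
  have hf : WeakEquivalence f := ⟨hf⟩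
  obtain ⟨Z, i, p, hi, hp, fac⟩ := exists_factorization
    (pushout.desc (f := fromZero X) (g := fromZero Y) f (𝟙 Y) (fromZero_ext _ _))
  let a : X ⟶ Z := pushout.inl (fromZero X) (fromZero Y) ≫ i
  let b : Y ⟶ Z := pushout.inr (fromZero X) (fromZero Y) ≫ i
  have ha : a ≫ p = f := by simp only [a, assoc, fac, pushout.inl_desc]
  have hb : b ≫ p = 𝟙 Y := by simp only [b, assoc, fac, pushout.inr_desc]
  have ca : Cofibration a := by
    have := cofibration_inl (fromZero X) (fromZero Y)
    dsimp only [a]; infer_instance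
  have cb : Cofibration b := by dsimp only [b]; infer_instance
  have wa : WeakEquivalence a := we_of_postcomp a p hp (by rwa [ha])
  have wb : WeakEquivalence b := we_of_postcomp b p hp (by rw [hb]; infer_instance)
  have ia := key a
  have ib := key b
  have hb' : (suspFunctor₀ C).map b ≫ (suspFunctor₀ C).map p = 𝟙 _ := by
    rw [← Functor.map_comp, hb, CategoryTheory.Functor.map_id]
  have ip : IsIso ((suspFunctor₀ C).map p) := by
    rw [← IsIso.inv_eq_of_hom_inv_id hb']
    infer_instance
  rw [← ha, Functor.map_comp]
  infer_instance

/-- The suspension functor on the homotopy category. -/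
noncomputable def suspension : Ho C ⥤ Ho C :=
  Localization.Construction.lift (suspFunctor₀ C) (suspFunctor₀_isInvertedBy C)

/-- A pointed cofibration category is stable if the suspension functor on its homotopy category is
an equivalence. -/
class IsStable : Prop where
  isEquivalence : (suspension C).IsEquivalence

variable {C}

/-- For a cofibration `f : X ⟶ Y`, the morphism `CX ∪_X Y ⟶ Y/X` that collapses `CX`. -/
noncomputable def collapseCone {X Y : C} (f : X ⟶ Y) [Cofibration f] :
    pushout (cone X).ι f ⟶ quot f :=
  pushout.desc (toZero _ ≫ fromZero _) (quotπ f) (by rw [comp_quotπ, ← assoc, comp_toZero])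

instance {X Y : C} (f : X ⟶ Y) [Cofibration f] : WeakEquivalence (collapseCone f) := by
  have hc := cofibration_inl (cone X).ι f
  have h₁ := weakEquivalence_quotπ (pushout.inl (cone X).ι f) (cone X).contractible
  have sq := (IsPushout.of_hasPushout (cone X).ι f).flip
  have h₂ := isIso_quotMap f (pushout.inl (cone X).ι f) (cone X).ι (pushout.inr (cone X).ι f) sq
  refine we_of_postcomp (collapseCone f) (quotMap _ _ _ _ sq.w) inferInstance ?_
  have h₃ : collapseCone f ≫ quotMap _ _ _ _ sq.w = quotπ (pushout.inl (cone X).ι f) := by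
    apply pushout.hom_ext
    · rw [collapseCone, pushout.inl_desc_assoc, assoc, comp_quotπ]
      congr 1
      exact fromZero_ext _ _
    · rw [collapseCone, pushout.inr_desc_assoc, quotπ_map]
  rwa [h₃]

/-- For a cofibration `f : X ⟶ Y`, the morphism `CX ∪_X Y ⟶ CX/X` that collapses `Y`. -/
noncomputable def collapseBase {X Y : C} (f : X ⟶ Y) [Cofibration f] :
    pushout (cone X).ι f ⟶ susp X :=
  pushout.desc (quotπ _) (toZero _ ≫ fromZero _) (by rw [comp_quotπ, ← assoc, comp_toZero])

/-- The connecting morphism `γ(Y/X ⟵ CX ∪_X Y ⟶ CX/X)` of a cofibration `f : X ⟶ Y`. -/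
noncomputable def connecting {X Y : C} (f : X ⟶ Y) [Cofibration f] :
    (γ C).obj (quot f) ⟶ (suspension C).obj ((γ C).obj X) :=
  inv ((γ C).map (collapseCone f)) ≫ (γ C).map (collapseBase f)

end Suspension

/-! ## The triangulation of the homotopy category -/

/-- A triangulation of `Ho C` in which the translation functor is identified (by `shiftIso`) with
the suspension functor, and in which the distinguished triangles are exactly those isomorphic to
an elementary exact triangle `X ⟶ Y ⟶ Y/X ⟶ ΣX` of a cofibration `X ⟶ Y` in `C`. -/
class HoTriangulation (C : Type u) [Category.{v} C] [CofibrationCategory C] [HasZeroObject C]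
    [ChosenCones C] where
  preadditive : Preadditive (Ho C)
  hasZeroObject : HasZeroObject (Ho C)
  hasShift : HasShift (Ho C) ℤ
  additive (n : ℤ) : (shiftFunctor (Ho C) n).Additive
  pretriangulated : Pretriangulated (Ho C)
  isTriangulated : IsTriangulated (Ho C)
  shiftIso : shiftFunctor (Ho C) (1 : ℤ) ≅ suspension C
  mem_distTriang_iff (T : Triangle (Ho C)) : T ∈ distTriang (Ho C) ↔
    ∃ (X Y : C) (f : X ⟶ Y) (_ : Cofibration f),
      Nonempty (T ≅ Triangle.mk ((γ C).map f) ((γ C).map (quotπ f))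
        (connecting f ≫ shiftIso.inv.app ((γ C).obj X)))

attribute [reducible] HoTriangulation.preadditive HoTriangulation.hasShift
  HoTriangulation.pretriangulated

attribute [instance] HoTriangulation.preadditive HoTriangulation.hasZeroObject
  HoTriangulation.hasShift HoTriangulation.additive HoTriangulation.pretriangulated
  HoTriangulation.isTriangulated

/-! ## Exact and biexact functors of cofibration categories -/

/-- An exact functor between cofibration categories. -/
structure IsExactFunctor {C : Type u₁} [Category.{v₁} C] [CofibrationCategory C]
    {D : Type u₂} [Category.{v₂} D] [CofibrationCategory D] (G : C ⥤ D) : Prop where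
  isInitial {X : C} (hX : IsInitial X) : Nonempty (IsInitial (G.obj X))
  cofibration {X Y : C} (f : X ⟶ Y) : Cofibration f → Cofibration (G.map f)
  weakEquivalence {X Y : C} (f : X ⟶ Y) : WeakEquivalence f → WeakEquivalence (G.map f)
  isPushout {X Y Z P : C} {f : X ⟶ Y} {g : X ⟶ Z} {f' : Y ⟶ P} {g' : Z ⟶ P} :
    Cofibration f → IsPushout f g f' g' →
      IsPushout (G.map f) (G.map g) (G.map f') (G.map g')

namespace IsExactFunctor

variable {C : Type u₁} [Category.{v₁} C] [CofibrationCategory C] [HasZeroObject C]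
  {D : Type u₂} [Category.{v₂} D] [CofibrationCategory D] [HasZeroObject D] {G : C ⥤ D}

lemma isZero (hG : IsExactFunctor G) : IsZero (G.obj 0) :=
  (isZero_zero D).of_iso
    ((hG.isInitial (isZero_zero C).isInitial).some.uniqueUpToIso (isZero_zero D).isInitial)

/-- The image of a cone of `X` under an exact functor `G` is a cone of `G(X)`. -/
def mapCone (hG : IsExactFunctor G) {X : C} (A : ConeOf X) : ConeOf (G.obj X) where
  pt := G.obj A.pt
  ι := G.map A.ι
  cofibration := hG.cofibration A.ι A.cofibration
  contractible := by
    have h := we_comp _ (hG.isZero.iso (isZero_zero D)).hom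
      (hG.weakEquivalence _ A.contractible) inferInstance
    rwa [WeaklyContractible, (isZero_zero D).eq_of_tgt (toZero _) (_ ≫ _)]

/-- The canonical morphism (in fact, isomorphism) `G(A)/G(X) ⟶ G(A/X)` for a cone `A` of `X` and an
exact functor `G`. -/
noncomputable def quotComparison (hG : IsExactFunctor G) {X : C} (A : ConeOf X) :
    quot (hG.mapCone A).ι ⟶ G.obj (quot A.ι) :=
  quotDesc (hG.mapCone A).ι (G.map (quotπ A.ι)) (by
    change G.map A.ι ≫ G.map (quotπ A.ι) = _
    rw [← Functor.map_comp, comp_quotπ, Functor.map_comp, hG.isZero.eq_of_tgt (G.map (toZero X))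
      (toZero _ ≫ fromZero _), assoc, fromZero_ext (fromZero _ ≫ G.map _) (fromZero _)])

/-- The condition that `τ : γ(G(ΣX)) ⟶ γ(Σ(G(X)))` is the canonical morphism
`γ(G(CX)/G(X) ⟶ pt/G(X) ⟵ CG(X)/G(X))`, where `pt` is a cone extension of the identity of `G(X)`
with respect to the cones `G(CX)` and `CG(X)` of `G(X)`. -/
def IsSuspensionComparison [ChosenCones C] [ChosenCones D] (hG : IsExactFunctor G) (X : C)
    (τ : (γ D).obj (G.obj (susp X)) ⟶ (γ D).obj (susp (G.obj X))) : Prop :=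
  ∀ K : ConeExtension (𝟙 (G.obj X)) (hG.mapCone (cone X)) (cone (G.obj X)),
    (γ D).map (hG.quotComparison (cone X)) ≫ τ = K.hoMap

end IsExactFunctor

/-- A biexact functor of cofibration categories: it is exact in each variable, and for cofibrations
`f : X ⟶ Y` and `f' : X' ⟶ Y'` the morphism `F(X,Y') ∪_{F(X,X')} F(Y,X') ⟶ F(Y,Y')` is a
cofibration. -/
structure IsBiexactFunctor {C : Type u₁} [Category.{v₁} C] [CofibrationCategory C]
    {D : Type u₂} [Category.{v₂} D] [CofibrationCategory D]
    {E : Type u₃} [Category.{v₃} E] [CofibrationCategory E] (F : C × D ⥤ E) : Prop where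
  exact_left (X' : D) : IsExactFunctor (Prod.sectL C X' ⋙ F)
  exact_right (X : C) : IsExactFunctor (Prod.sectR X D ⋙ F)
  cofibration {X Y : C} {X' Y' : D} (f : X ⟶ Y) (f' : X' ⟶ Y') :
    Cofibration f → Cofibration f' →
      ∀ {W : E} (a : F.obj (X, Y') ⟶ W) (b : F.obj (Y, X') ⟶ W),
        IsPushout (F.map (𝟙 X ×ₘ f')) (F.map (f ×ₘ 𝟙 X')) a b →
        ∀ (c : W ⟶ F.obj (Y, Y')), a ≫ c = F.map (f ×ₘ 𝟙 Y') → b ≫ c = F.map (𝟙 Y ×ₘ f') →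
          Cofibration c

namespace IsBiexactFunctor

variable {C : Type u₁} [Category.{v₁} C] [CofibrationCategory C]
  {D : Type u₂} [Category.{v₂} D] [CofibrationCategory D]
  {E : Type u₃} [Category.{v₃} E] [CofibrationCategory E] {F : C × D ⥤ E}

lemma isInvertedBy (hF : IsBiexactFunctor F) :
    ((weakEquivalences C).prod (weakEquivalences D)).IsInvertedBy (F ⋙ γ E) := by
  rintro ⟨X, X'⟩ ⟨Y, Y'⟩ ⟨f, f'⟩ ⟨hf, hf'⟩
  have h₁ : WeakEquivalence (F.map (f ×ₘ 𝟙 X')) := (hF.exact_left X').weakEquivalence f ⟨hf⟩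
  have h₂ : WeakEquivalence (F.map (𝟙 Y ×ₘ f')) := (hF.exact_right Y).weakEquivalence f' ⟨hf'⟩
  have h : F.map (f ×ₘ f') = F.map (f ×ₘ 𝟙 X') ≫ F.map (𝟙 Y ×ₘ f') := by
    rw [← Functor.map_comp]
    simp
  have h₃ : WeakEquivalence (F.map (f ×ₘ f')) := by
    rw [h]
    exact we_comp _ _ h₁ h₂
  exact isIso_γ_map (F.map (f ×ₘ f'))

/-- The functor `Ho C × Ho D ⥤ Ho E` induced by a biexact functor `F`. -/
noncomputable def ho (hF : IsBiexactFunctor F) : Ho C × Ho D ⥤ Ho E :=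
  Localization.StrictUniversalPropertyFixedTarget.prodLift (F ⋙ γ E) hF.isInvertedBy

/-- The induced functor is characterized by this property. -/
lemma fac (hF : IsBiexactFunctor F) : (γ C).prod (γ D) ⋙ hF.ho = F ⋙ γ E :=
  Localization.StrictUniversalPropertyFixedTarget.prod_fac _ _

variable [HasZeroObject C] [ChosenCones C] [HoTriangulation C]
  [HasZeroObject D] [ChosenCones D] [HoTriangulation D]
  [HasZeroObject E] [ChosenCones E] [HoTriangulation E]

/-- The condition that the isomorphisms `θ` and `ζ` of a biexact structure on the induced functor
are the canonical ones of the exact functors `F(-, X')` and `F(X, -)`. -/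
structure IsCanonical (hF : IsBiexactFunctor F) (B : TriangulatedBifunctor.Biexact hF.ho) :
    Prop where
  left (X : C) (X' : D) : (hF.exact_left X').IsSuspensionComparison X
    (hF.ho.map ((HoTriangulation.shiftIso (C := C)).inv.app ((γ C).obj X) ×ₘ 𝟙 ((γ D).obj X')) ≫
      B.θ.hom.app ((γ C).obj X, (γ D).obj X') ≫
      (HoTriangulation.shiftIso (C := E)).hom.app ((γ E).obj (F.obj (X, X'))))
  right (X : C) (X' : D) : (hF.exact_right X).IsSuspensionComparison X'
    (hF.ho.map (𝟙 ((γ C).obj X) ×ₘ (HoTriangulation.shiftIso (C := D)).inv.app ((γ D).obj X')) ≫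
      B.ζ.hom.app ((γ C).obj X, (γ D).obj X') ≫
      (HoTriangulation.shiftIso (C := E)).hom.app ((γ E).obj (F.obj (X, X'))))

end IsBiexactFunctor

end CofibrationCategory

/-!
The argument has three layers: a description of `Ho C` that makes it triangulated, a supply of
homotopy cartesian squares, and a three by three grid in `E` from which the Verdier structure is
read off.

Up to homotopy, the acyclic cofibrations of a cofibration category admit a calculus of left
fractions. So every morphism of `Ho C` is a fraction `s⁻¹ f` with `s` an acyclic cofibration
(`exists_fraction`), and two morphisms of `C` become equal in `Ho C` only if they are homotopic
(`homotopic_of_γ_map_eq`). The suspension of an object and the connecting morphism of a cofiber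
sequence are computed by an arbitrary cone (`IsConeSeq.σ`, `IsCofiber.δ`, `IsCofiber.δ_eq`), which
makes them natural and compatible with exact functors.

For a cone `X ⟶ A` with quotient `S`, collapsing the second copy of `A` is a weak equivalence from
`A ∪_X A` to `S`, and collapsing `X` maps `A ∪_X A` to `S ∨ S`. Precomposition with the resulting
morphism `S ⟶ S ∨ S` of `Ho C` gives a natural operation `a - b` on morphisms out of a suspension,
with `a - 0 = a` and `a - a = 0`. By stability every object is a suspension, and together with the
existence of coproducts these two identities make `Ho C` additive (`preadditiveHo`). The
shift by `ℤ` comes from the category of sequences generated by an autoequivalence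
(`ShiftOfEquivalence`). The triangulation (`nonempty_hoTriangulation`) rests on rotation of
elementary triangles (`IsExact.rotate`) and on the extension of commutative squares to morphisms
of triangles (`IsCofiber.extends_of_comm`).

A pushout square along a cofibration is homotopy cartesian (`isHoCartesian_of_isPushout`), and so
is the square of connecting morphisms attached to a union of two cofibrations
(`IsUnion.isHoCartesian_suspension`). For composable cofibrations `A ⟶ W ⟶ B`, so is the square of
connecting morphisms on `B/A`, `ΣA`, `B/W` and `ΣW` (`isHoCartesian_of_comp`).

A biexact functor sends a pair of cofiber sequences to a grid of cofiber sequences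
(`IsCofiberGrid`, `IsBiexactFunctor.exists_isCofiberGrid`), in which the object `W` of the Verdier
structure is the union `F(X, Y') ∪ F(Y, X')` inside `F(Y, Y')`. The three triangles, the equations
and the six squares of the Verdier structure all come from this grid. Applied to two cones, the
grid also gives the sign in the anticommutativity of `θ` and `ζ` (`IsCofiberGrid.δ_comp_δ`,
`IsBiexactFunctor.anticomm`). Since `θ` and `ζ` are computed by arbitrary cones, an induced functor
carries connecting morphisms to connecting morphisms (`HoLift.map_δ`). Hence it preserves
triangles, and the result for the grid passes to all distinguished triangles by transport along
isomorphisms (`IsBiexactFunctor.admitsStrongVerdierStructure`).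
-/

namespace CofibrationCategory

/-! ### Homotopies and the calculus of left fractions -/

set_option linter.unusedSectionVars false

section Homotopy

variable {C : Type u} [Category.{v} C] [CofibrationCategory C] [HasZeroObject C]

/-- Brown's factorization: a morphism is a cofibration followed by a retraction of an acyclic
cofibration. -/
lemma exists_brown_factorization {X Y : C} (f : X ⟶ Y) :
    ∃ (Z : C) (a : X ⟶ Z) (p : Z ⟶ Y) (b : Y ⟶ Z), Cofibration a ∧ Cofibration b ∧
      WeakEquivalence b ∧ WeakEquivalence p ∧ a ≫ p = f ∧ b ≫ p = 𝟙 Y := by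
  obtain ⟨Z, i, p, hi, hp, fac⟩ := exists_factorization
    (pushout.desc (f := fromZero X) (g := fromZero Y) f (𝟙 Y) (fromZero_ext _ _))
  have := cofibration_inl (fromZero X) (fromZero Y)
  have hb : (pushout.inr (fromZero X) (fromZero Y) ≫ i) ≫ p = 𝟙 Y := by
    rw [assoc, fac, pushout.inr_desc]
  refine ⟨Z, pushout.inl _ _ ≫ i, p, pushout.inr _ _ ≫ i, inferInstance, inferInstance,
    we_of_postcomp _ p hp (by rw [hb]; infer_instance), hp, ?_, hb⟩
  rw [assoc, fac, pushout.inl_desc]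

/-- Every object embeds in a weakly contractible object. -/
lemma exists_cone (X : C) : ∃ (K : C) (i : X ⟶ K), Cofibration i ∧ WeaklyContractible K := by
  obtain ⟨Z, i, w, hi, hw, -⟩ := exists_factorization (toZero X)
  refine ⟨Z, i, hi, ?_⟩
  rw [WeaklyContractible, (isZero_zero C).eq_of_tgt (toZero Z) w]
  exact hw

/-- `f` and `g` become left homotopic after an acyclic cofibration of the target. The object `I`
is only required to be weakly equivalent to `X`; see `Homotopic.exists_cylinder`. -/
def Homotopic {X Y : C} (f g : X ⟶ Y) : Prop :=
  ∃ (I : C) (i₀ i₁ : X ⟶ I) (p : I ⟶ X) (Y' : C) (s : Y ⟶ Y') (H : I ⟶ Y'),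
    i₀ ≫ p = 𝟙 X ∧ i₁ ≫ p = 𝟙 X ∧ WeakEquivalence p ∧ Cofibration s ∧ WeakEquivalence s ∧
    i₀ ≫ H = f ≫ s ∧ i₁ ≫ H = g ≫ s

/-- The object `I` in the definition of `Homotopic` can be chosen to be a cylinder object. -/
lemma Homotopic.exists_cylinder {X Y : C} {f g : X ⟶ Y} (h : Homotopic f g) :
    ∃ (I : C) (k : pushout (fromZero X) (fromZero X) ⟶ I) (p : I ⟶ X) (Y' : C) (s : Y ⟶ Y')
      (H : I ⟶ Y'), Cofibration k ∧ Cofibration (pushout.inl _ _ ≫ k) ∧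
      Cofibration (pushout.inr _ _ ≫ k) ∧
      WeakEquivalence (pushout.inl _ _ ≫ k) ∧ WeakEquivalence (pushout.inr _ _ ≫ k) ∧
      WeakEquivalence p ∧ Cofibration s ∧ WeakEquivalence s ∧
      (pushout.inl _ _ ≫ k) ≫ p = 𝟙 X ∧ (pushout.inr _ _ ≫ k) ≫ p = 𝟙 X ∧
      (pushout.inl _ _ ≫ k) ≫ H = f ≫ s ∧ (pushout.inr _ _ ≫ k) ≫ H = g ≫ s := by
  obtain ⟨I, i₀, i₁, p, Y', s, H, h₀, h₁, hp, hs, hs', H₀, H₁⟩ := h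
  obtain ⟨J, k, w, hk, hw, fac⟩ := exists_factorization
    (pushout.desc (f := fromZero X) (g := fromZero X) i₀ i₁ (fromZero_ext _ _))
  have e₀ : pushout.inl _ _ ≫ k ≫ w = i₀ := by rw [fac, pushout.inl_desc]
  have e₁ : pushout.inr _ _ ≫ k ≫ w = i₁ := by rw [fac, pushout.inr_desc]
  have hwp := we_comp w p hw hp
  have := cofibration_inl (fromZero X) (fromZero X)
  have f₀ : (pushout.inl _ _ ≫ k) ≫ w ≫ p = 𝟙 X := by simp only [assoc, reassoc_of% e₀, h₀]
  have f₁ : (pushout.inr _ _ ≫ k) ≫ w ≫ p = 𝟙 X := by simp only [assoc, reassoc_of% e₁, h₁]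
  refine ⟨J, k, w ≫ p, Y', s, w ≫ H, hk, inferInstance, inferInstance,
    we_of_postcomp _ _ hwp (by rw [f₀]; infer_instance),
    we_of_postcomp _ _ hwp (by rw [f₁]; infer_instance), hwp, hs, hs', f₀, f₁, ?_, ?_⟩
  · simp only [assoc, reassoc_of% e₀, H₀]
  · simp only [assoc, reassoc_of% e₁, H₁]

lemma Homotopic.refl {X Y : C} (f : X ⟶ Y) : Homotopic f f :=
  ⟨X, 𝟙 X, 𝟙 X, 𝟙 X, Y, 𝟙 Y, f, by simp, by simp, inferInstance, inferInstance, inferInstance,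
    by simp, by simp⟩

lemma Homotopic.symm {X Y : C} {f g : X ⟶ Y} (h : Homotopic f g) : Homotopic g f := by
  obtain ⟨I, i₀, i₁, p, Y', s, H, h₀, h₁, hp, hs, hs', H₀, H₁⟩ := h
  exact ⟨I, i₁, i₀, p, Y', s, H, h₁, h₀, hp, hs, hs', H₁, H₀⟩

lemma Homotopic.trans {X Y : C} {f g k : X ⟶ Y} (h : Homotopic f g) (h' : Homotopic g k) :
    Homotopic f k := by
  obtain ⟨I, i, p, Y₁, s, H, -, -, ci, -, wi, wp, cs, ws, hp₀, hp₁, H₀, H₁⟩ := h.exists_cylinder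
  obtain ⟨J, j, q, Y₂, t, K, -, cj, -, wj, -, wq, ct, wt, hq₀, hq₁, K₀, K₁⟩ := h'.exists_cylinder
  let j₀ := pushout.inl _ _ ≫ j
  let i₁ := pushout.inr _ _ ≫ i
  have hl : WeakEquivalence (pushout.inl i₁ j₀) := weakEquivalence_inl _ _
  have hst : WeakEquivalence (s ≫ pushout.inl s t) :=
    we_comp _ _ ws (weakEquivalence_inl _ _)
  have := cofibration_inl s t
  refine ⟨pushout i₁ j₀, (pushout.inl _ _ ≫ i) ≫ pushout.inl _ _,
    (pushout.inr _ _ ≫ j) ≫ pushout.inr _ _, pushout.desc p q (hp₁.trans hq₀.symm),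
    pushout s t, s ≫ pushout.inl _ _, pushout.desc (H ≫ pushout.inl _ _) (K ≫ pushout.inr _ _) ?_,
    ?_, ?_, ?_, inferInstance, hst, ?_, ?_⟩
  · rw [← assoc, H₁, ← assoc, K₀, assoc, assoc, pushout.condition]
  · rw [assoc, pushout.inl_desc, hp₀]
  · rw [assoc, pushout.inr_desc, hq₁]
  · exact we_of_precomp _ _ hl (by rw [pushout.inl_desc]; exact wp)
  · rw [assoc, pushout.inl_desc, ← assoc, H₀, assoc]
  · rw [assoc, pushout.inr_desc, ← assoc, K₁, assoc, pushout.condition]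

lemma Homotopic.postcomp {X Y Z : C} {f g : X ⟶ Y} (h : Homotopic f g) (k : Y ⟶ Z) :
    Homotopic (f ≫ k) (g ≫ k) := by
  obtain ⟨I, i₀, i₁, p, Y', s, H, h₀, h₁, hp, hs, hs', H₀, H₁⟩ := h
  refine ⟨I, i₀, i₁, p, pushout s k, pushout.inr _ _, H ≫ pushout.inl _ _, h₀, h₁, hp,
    inferInstance, inferInstance, ?_, ?_⟩
  · rw [reassoc_of% H₀, pushout.condition, assoc]
  · rw [reassoc_of% H₁, pushout.condition, assoc]

lemma Homotopic.precomp {W X Y : C} {f g : X ⟶ Y} (h : Homotopic f g) (k : W ⟶ X) :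
    Homotopic (k ≫ f) (k ≫ g) := by
  obtain ⟨J, j₀, j₁, q, Y', s, K, hq₀, hq₁, hq, hs, hs', K₀, K₁⟩ := h
  obtain ⟨I, i, p, -, -, -, ci, -, -, -, -, wp, -, -, hp₀, hp₁, -, -⟩ :=
    (Homotopic.refl (𝟙 W)).exists_cylinder
  let e : pushout (fromZero W) (fromZero W) ⟶ J :=
    pushout.desc (k ≫ j₀) (k ≫ j₁) (fromZero_ext _ _)
  have hc : i ≫ p ≫ k = e ≫ q := by
    apply pushout.hom_ext
    · rw [pushout.inl_desc_assoc, assoc, hq₀, comp_id]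
      simp only [assoc] at hp₀
      rw [reassoc_of% hp₀]
    · rw [pushout.inr_desc_assoc, assoc, hq₁, comp_id]
      simp only [assoc] at hp₁
      rw [reassoc_of% hp₁]
  obtain ⟨J', d, w, cd, ww, fac⟩ := exists_factorization (pushout.desc (p ≫ k) q hc)
  have hd : WeakEquivalence (pushout.inr i e ≫ d) :=
    we_of_postcomp _ w ww (by rw [assoc, fac, pushout.inr_desc]; exact hq)
  have hw : WeakEquivalence (s ≫ pushout.inr (pushout.inr i e ≫ d) K) :=
    we_comp _ _ hs' inferInstance
  refine ⟨I, pushout.inl _ _ ≫ i, pushout.inr _ _ ≫ i, p, pushout (pushout.inr i e ≫ d) K,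
    s ≫ pushout.inr _ _, pushout.inl i e ≫ d ≫ pushout.inl _ _, hp₀, hp₁, wp, inferInstance,
    hw, ?_, ?_⟩
  · rw [assoc, pushout.condition_assoc, pushout.inl_desc_assoc, assoc]
    have := pushout.condition (f := pushout.inr i e ≫ d) (g := K)
    rw [assoc] at this
    rw [this, reassoc_of% K₀, assoc]
  · rw [assoc, pushout.condition_assoc, pushout.inr_desc_assoc, assoc]
    have := pushout.condition (f := pushout.inr i e ≫ d) (g := K)
    rw [assoc] at this
    rw [this, reassoc_of% K₁, assoc]

/-- Acyclic cofibrations are epimorphisms up to homotopy. -/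
lemma Homotopic.of_precomp {W X Y : C} {f g : X ⟶ Y} (w : W ⟶ X) [Cofibration w]
    [WeakEquivalence w] (h : Homotopic (w ≫ f) (w ≫ g)) : Homotopic f g := by
  obtain ⟨I, i₀, i₁, p, Y', s, H, h₀, h₁, hp, hs, hs', H₀, H₁⟩ := h
  -- A copy of `X` is glued along `w` to each end of the cylinder `I` of `W`.
  let E₁ := pushout w i₀
  let E₂ := pushout w (i₁ ≫ pushout.inr w i₀)
  let π₁ : E₁ ⟶ X := pushout.desc (𝟙 X) (p ≫ w) (by rw [reassoc_of% h₀, comp_id])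
  let π₂ : E₂ ⟶ X := pushout.desc (𝟙 X) π₁ (by
    rw [assoc, pushout.inr_desc, reassoc_of% h₁, comp_id])
  have hI : (pushout.inr w i₀ ≫ pushout.inr w (i₁ ≫ pushout.inr w i₀)) ≫ π₂ = p ≫ w := by
    rw [assoc, pushout.inr_desc, pushout.inr_desc]
  refine ⟨E₂, pushout.inl _ _ ≫ pushout.inr _ _, pushout.inl _ _, π₂, Y', s,
    pushout.desc (g ≫ s) (pushout.desc (f ≫ s) H ?_) ?_, ?_, ?_, ?_, hs, hs', ?_, ?_⟩
  · rw [H₀, assoc]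
  · rw [assoc, pushout.inr_desc, H₁, assoc]
  · rw [assoc, pushout.inr_desc, pushout.inl_desc]
  · rw [pushout.inl_desc]
  · refine we_of_precomp (pushout.inr w i₀ ≫ pushout.inr w (i₁ ≫ pushout.inr w i₀)) π₂
      (we_comp _ _ inferInstance inferInstance) ?_
    rw [hI]
    exact we_comp _ _ hp inferInstance
  · rw [assoc, pushout.inr_desc, pushout.inl_desc]
  · rw [pushout.inl_desc]

variable (C) in
/-- The homotopy relation on the morphisms of `C`. -/
def homotopyRel : HomRel C := fun _ _ f g => Homotopic f g

instance : Congruence (homotopyRel C) where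
  equivalence := ⟨Homotopic.refl, Homotopic.symm, Homotopic.trans⟩
  comp_left f _ _ h := Homotopic.precomp h f
  comp_right g h := Homotopic.postcomp h g

variable (C) in
/-- The classes of acyclic cofibrations in the quotient of `C` by the homotopy relation. -/
def acyclicClasses : MorphismProperty (Quotient (homotopyRel C)) := fun X Y φ =>
  ∃ s : X.as ⟶ Y.as, Cofibration s ∧ WeakEquivalence s ∧ (Quotient.functor (homotopyRel C)).map s = φ

instance : (acyclicClasses C).HasLeftCalculusOfFractions where
  id_mem X := ⟨𝟙 _, inferInstance, inferInstance, CategoryTheory.Functor.map_id _ _⟩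
  comp_mem := by
    rintro X Y Z _ _ ⟨s, hs, hs', rfl⟩ ⟨t, ht, ht', rfl⟩
    exact ⟨s ≫ t, inferInstance, we_comp _ _ hs' ht', Functor.map_comp _ _ _⟩
  exists_leftFraction := by
    rintro X Y ⟨s, ⟨s, hs, hs', rfl⟩, f⟩
    obtain ⟨f, rfl⟩ := (Quotient.functor (homotopyRel C)).map_surjective f
    exact ⟨⟨(Quotient.functor (homotopyRel C)).map (pushout.inl s f),
      (Quotient.functor (homotopyRel C)).map (pushout.inr s f),
      ⟨pushout.inr s f, inferInstance, inferInstance, rfl⟩⟩, by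
        rw [← Functor.map_comp, ← Functor.map_comp, pushout.condition]⟩
  ext := by
    rintro X' X Y f g s ⟨s, hs, hs', rfl⟩ h
    obtain ⟨f, rfl⟩ := (Quotient.functor (homotopyRel C)).map_surjective f
    obtain ⟨g, rfl⟩ := (Quotient.functor (homotopyRel C)).map_surjective g
    rw [← Functor.map_comp, ← Functor.map_comp, Quotient.functor_map_eq_iff] at h
    have h' : Homotopic f g := Homotopic.of_precomp s h
    refine ⟨Y, 𝟙 Y, ⟨𝟙 _, inferInstance, inferInstance, CategoryTheory.Functor.map_id _ _⟩, ?_⟩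
    rw [(Quotient.functor_map_eq_iff (homotopyRel C) f g).2 h']

/-- Morphisms of `C` that agree in the homotopy category are homotopic, after an acyclic
cofibration of the target. -/
lemma homotopic_of_γ_map_eq {X Y : C} {f g : X ⟶ Y} (h : (γ C).map f = (γ C).map g) :
    Homotopic f g := by
  -- Every weak equivalence is inverted by `L`, since acyclic cofibrations are and since a Brown
  -- factorization reduces to these. Hence `L` factors through `Ho C`, where `f` and `g` agree.
  let L := Quotient.functor (homotopyRel C) ⋙ (acyclicClasses C).Q
  have hL' {X Y : C} (s : X ⟶ Y) [hs : Cofibration s] [hs' : WeakEquivalence s] :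
      IsIso (L.map s) := (acyclicClasses C).Q_inverts _ ⟨s, hs, hs', rfl⟩
  have hL : (weakEquivalences C).IsInvertedBy L := by
    intro X Y w hw
    have hw : WeakEquivalence w := ⟨hw⟩
    obtain ⟨Z, a, p, b, ha, hb, hb', hp, fac, hbp⟩ := exists_brown_factorization w
    have ha' := we_of_postcomp a p hp (by rwa [fac])
    have e₁ := hL' a
    have e₂ := hL' b
    have e₃ : IsIso (L.map p) := by
      rw [← IsIso.inv_eq_of_hom_inv_id (f := L.map b) (g := L.map p)
        (by rw [← L.map_comp, hbp, L.map_id])]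
      infer_instance
    rw [← fac, L.map_comp]
    infer_instance
  have h₁ : L.map f = L.map g := by
    have e := Localization.Construction.fac L hL
    rw [Functor.congr_hom e.symm f, Functor.congr_hom e.symm g, Functor.comp_map, Functor.comp_map, h]
  rw [Functor.comp_map, Functor.comp_map,
    MorphismProperty.map_eq_iff_postcomp (acyclicClasses C).Q (acyclicClasses C)] at h₁
  obtain ⟨Z, _, ⟨t, ht, ht', rfl⟩, h₂⟩ := h₁
  rw [← Functor.map_comp, ← Functor.map_comp, Quotient.functor_map_eq_iff] at h₂
  obtain ⟨I, i₀, i₁, p, Y', s, H, h₀, h₁, hp, hs, hs', H₀, H₁⟩ := h₂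
  exact ⟨I, i₀, i₁, p, Y', t ≫ s, H, h₀, h₁, hp, inferInstance, we_comp _ _ ht' hs',
    by rw [H₀, assoc], by rw [H₁, assoc]⟩

end Homotopy

section Fractions

variable {C : Type u} [Category.{v} C] [CofibrationCategory C] [HasZeroObject C]

lemma exists_eq_γ_obj (A : Ho C) : ∃ X : C, A = (γ C).obj X :=
  ⟨(Localization.Construction.objEquiv _).symm A,
    ((Localization.Construction.objEquiv (weakEquivalences C)).apply_symm_apply A).symm⟩

/-- Every morphism of the homotopy category is a left fraction whose denominator is an acyclic
cofibration. -/
lemma exists_fraction {X Y : C} (φ : (γ C).obj X ⟶ (γ C).obj Y) :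
    ∃ (Y' : C) (f : X ⟶ Y') (s : Y ⟶ Y') (_ : Cofibration s) (_ : WeakEquivalence s),
      φ = (γ C).map f ≫ inv ((γ C).map s) := by
  have hγ : Function.Injective (γ C).obj :=
    (Localization.Construction.objEquiv (weakEquivalences C)).injective
  let P : MorphismProperty (Ho C) := fun A B φ => ∀ (X Y : C) (hA : (γ C).obj X = A)
    (hB : B = (γ C).obj Y), ∃ (Y' : C) (f : X ⟶ Y') (s : Y ⟶ Y') (_ : Cofibration s)
      (_ : WeakEquivalence s), (eqToHom hA ≫ φ ≫ eqToHom hB) ≫ (γ C).map s = (γ C).map f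
  have hcomp : P.IsStableUnderComposition := ⟨by
    rintro A B D φ ψ h₁ h₂ X Z rfl rfl
    obtain ⟨Y, rfl⟩ := exists_eq_γ_obj B
    obtain ⟨Y', f, s, hs, hs', e⟩ := h₁ X Y rfl rfl
    obtain ⟨Z', g, t, ht, ht', e'⟩ := h₂ Y Z rfl rfl
    simp only [eqToHom_refl, id_comp, comp_id] at e e' ⊢
    have := we_comp _ _ ht' (inferInstance : WeakEquivalence (pushout.inr s g))
    refine ⟨pushout s g, f ≫ pushout.inl _ _, t ≫ pushout.inr _ _, inferInstance, this, ?_⟩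
    rw [Functor.map_comp, assoc, reassoc_of% e', ← Functor.map_comp, ← pushout.condition,
      Functor.map_comp, reassoc_of% e, ← Functor.map_comp]⟩
  have hP : P = ⊤ := by
    apply Localization.Construction.morphismProperty_eq_top
    · intro X Y f X' Y' hX hY
      obtain rfl := hγ hX
      obtain rfl := hγ hY
      exact ⟨Y, f, 𝟙 _, inferInstance, inferInstance, by simp⟩
    · intro X Y w hw Y' X' hX hY
      obtain rfl := hγ hX
      obtain rfl := hγ hY
      have hw' : WeakEquivalence w := ⟨hw⟩
      obtain ⟨Z, a, p, b, ha, hb, hb', hp, fac, hbp⟩ := exists_brown_factorization w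
      have ha' := we_of_postcomp a p hp (by rwa [fac])
      refine ⟨Z, b, a, ha, ha', ?_⟩
      have e := (Localization.Construction.wIso w hw).inv_hom_id
      have h₁ : (Localization.Construction.wIso w hw).hom =
        (γ C).map a ≫ (γ C).map p := by rw [← Functor.map_comp, fac]; rfl
      have h₂ : (γ C).map b ≫ (γ C).map p = 𝟙 _ := by
        rw [← Functor.map_comp, hbp, CategoryTheory.Functor.map_id]
      rw [eqToHom_refl, eqToHom_refl, id_comp, comp_id, ← cancel_mono ((γ C).map p), h₂, assoc,
        ← h₁]
      exact e
  obtain ⟨Y', f, s, hs, hs', h⟩ := (by rw [hP]; trivial : P φ) X Y rfl rfl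
  exact ⟨Y', f, s, hs, hs', by simp [← h]⟩

end Fractions

end CofibrationCategory

namespace CofibrationCategory

set_option linter.unusedSectionVars false

/-! ### Cofiber sequences -/

section Cofiber

variable {C : Type u} [Category.{v} C] [CofibrationCategory C] [HasZeroObject C]

/-- The zero morphisms of a pointed cofibration category. -/
noncomputable instance zeroMorphisms (C : Type u) [Category.{v} C] [_h : CofibrationCategory C]
    [HasZeroObject C] : HasZeroMorphisms C := HasZeroObject.zeroMorphismsOfZeroObject

lemma toZero_comp_fromZero (X Y : C) : toZero X ≫ fromZero Y = 0 := by
  rw [(isZero_zero C).eq_of_tgt (toZero X) 0, zero_comp]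

lemma contractible_zero : WeaklyContractible (0 : C) := by
  rw [WeaklyContractible, (isZero_zero C).eq_of_tgt (toZero (0 : C)) (𝟙 _)]
  infer_instance

/-- `p : Y ⟶ Z` exhibits `Z` as the quotient of `Y` by the cofibration `f : X ⟶ Y`. The object `Z`
is not required to be the chosen quotient `quot f`, so that the notion is stable under exact
functors. -/
structure IsCofiber {X Y Z : C} (f : X ⟶ Y) (p : Y ⟶ Z) : Prop where
  cofibration : Cofibration f
  isPushout : IsPushout f (toZero X) p (fromZero Z)

lemma isCofiber_quotπ {X Y : C} (f : X ⟶ Y) [Cofibration f] : IsCofiber f (quotπ f) :=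
  ⟨inferInstance, isPushout_quot f⟩

namespace IsCofiber

section

variable {X Y Z : C} {f : X ⟶ Y} {p : Y ⟶ Z} (h : IsCofiber f p)

include h

lemma w : f ≫ p = 0 := by
  rw [h.isPushout.w, toZero_comp_fromZero]

lemma hom_ext {T : C} {a b : Z ⟶ T} (hab : p ≫ a = p ≫ b) : a = b :=
  h.isPushout.hom_ext hab (fromZero_ext _ _)

lemma exists_desc {T : C} (b : Y ⟶ T) (hb : f ≫ b = 0) : ∃ c : Z ⟶ T, p ≫ c = b :=
  ⟨h.isPushout.desc b (fromZero T) (by rw [hb, toZero_comp_fromZero]), h.isPushout.inl_desc _ _ _⟩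

lemma exists_iso {Z' : C} {p' : Y ⟶ Z'} (h' : IsCofiber f p') :
    ∃ e : Z ≅ Z', p ≫ e.hom = p' := by
  obtain ⟨a, ha⟩ := h.exists_desc p' h'.w
  obtain ⟨b, hb⟩ := h'.exists_desc p h.w
  refine ⟨⟨a, b, h.hom_ext ?_, h'.hom_ext ?_⟩, ha⟩
  · rw [reassoc_of% ha, hb, comp_id]
  · rw [reassoc_of% hb, ha, comp_id]

/-- The cobase change of a cofibration has the same quotient. -/
lemma of_isPushout {X' P : C} {g : X ⟶ X'} {u : Y ⟶ P} {v : X' ⟶ P} (sq : IsPushout f g u v)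
    {q : P ⟶ Z} (hu : u ≫ q = p) (hv : v ≫ q = 0) : IsCofiber v q := by
  have := h.cofibration
  refine ⟨cofibration_of_isPushout sq, (IsPushout.of_top (h₁₁ := f) (v₁₁ := g) (v₁₂ := u) ?_ ?_ sq)⟩
  · rw [hu, comp_toZero]
    exact h.isPushout
  · rw [hv, toZero_comp_fromZero]

lemma weakEquivalence (hX : WeaklyContractible X) : WeakEquivalence p := by
  have := h.cofibration
  obtain ⟨e, he⟩ := (isCofiber_quotπ f).exists_iso h
  rw [← he]
  exact we_comp _ _ (weakEquivalence_quotπ f hX) inferInstance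

/-- The comparison isomorphism with the chosen quotient. -/
lemma exists_quotIso : ∃ e : @quot C _ _ _ X Y f h.cofibration ≅ Z,
    @quotπ C _ _ _ X Y f h.cofibration ≫ e.hom = p :=
  have := h.cofibration
  (isCofiber_quotπ f).exists_iso h

/-- The comparison isomorphism with the chosen quotient. -/
noncomputable def quotIso : @quot C _ _ _ X Y f h.cofibration ≅ Z := h.exists_quotIso.choose

lemma quotπ_quotIso_hom : @quotπ C _ _ _ X Y f h.cofibration ≫ h.quotIso.hom = p :=
  h.exists_quotIso.choose_spec

lemma comp_quotIso_inv : p ≫ h.quotIso.inv = @quotπ C _ _ _ X Y f h.cofibration := by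
  rw [Iso.comp_inv_eq, h.quotπ_quotIso_hom]

end

section Comp

variable {A W B Q R S : C} {f : A ⟶ W} {g : W ⟶ B} {p : W ⟶ Q} {r : B ⟶ R} {s : B ⟶ S}

/-- For composable cofibrations `A ⟶ W ⟶ B`, the square `W, B, W/A, B/A` is a pushout. -/
lemma isPushout_of_comp (hf : IsCofiber f p) (hfg : IsCofiber (f ≫ g) r) {t : Q ⟶ R}
    (ht : p ≫ t = g ≫ r) : IsPushout g p r t := by
  refine (IsPushout.of_left (h₁₁ := f) (v₁₁ := toZero A) (h₂₁ := fromZero Q) ?_ ht.symm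
    hf.isPushout)
  rw [fromZero_ext (fromZero Q ≫ t) (fromZero R)]
  exact hfg.isPushout

lemma of_comp (hf : IsCofiber f p) (hfg : IsCofiber (f ≫ g) r) (hg : IsCofiber g s) {t : Q ⟶ R}
    (ht : p ≫ t = g ≫ r) {t' : R ⟶ S} (ht' : r ≫ t' = s) : IsCofiber t t' := by
  refine hg.of_isPushout (isPushout_of_comp hf hfg ht) ht' (hf.hom_ext ?_)
  rw [reassoc_of% ht, ht', hg.w, comp_zero]

end Comp

end IsCofiber

/-- The gluing lemma for weak equivalences between cofibrations with the same source. -/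
lemma weakEquivalence_of_isPushout_of_isPushout {A N U V P Q : C} {k : A ⟶ N} {f : A ⟶ U}
    {g : A ⟶ V} {a : N ⟶ P} {b : V ⟶ P} {a' : U ⟶ Q} {b' : V ⟶ Q} [Cofibration k] [Cofibration f]
    (sq : IsPushout k g a b) (sq' : IsPushout f g a' b') (w : N ⟶ U) [WeakEquivalence w]
    (hw : k ≫ w = f) (w' : P ⟶ Q) (h₁ : a ≫ w' = w ≫ a') (h₂ : b ≫ w' = b') :
    WeakEquivalence w' := by
  -- an object `M` under `A` containing `N` and `U` by acyclic cofibrations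
  obtain ⟨M, i, p, hi, hp, fac⟩ := exists_factorization
    (pushout.desc (f := k) (g := f) w (𝟙 U) (by rw [hw, comp_id]))
  have cl := cofibration_inl k f
  let m : N ⟶ M := pushout.inl k f ≫ i
  let n : U ⟶ M := pushout.inr k f ≫ i
  have hm : m ≫ p = w := by simp only [m, assoc, fac, pushout.inl_desc]
  have hn : n ≫ p = 𝟙 U := by simp only [n, assoc, fac, pushout.inr_desc]
  have hmn : k ≫ m = f ≫ n := by simp only [m, n, pushout.condition_assoc]
  have wm : WeakEquivalence m := we_of_postcomp m p hp (by rw [hm]; infer_instance)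
  have wn : WeakEquivalence n := we_of_postcomp n p hp (by rw [hn]; infer_instance)
  have cm : Cofibration m := by dsimp only [m]; infer_instance
  have cn : Cofibration n := by dsimp only [n]; infer_instance
  -- the pushout `R` of `M`
  let R := pushout (f ≫ n) g
  let r : V ⟶ R := pushout.inr (f ≫ n) g
  let x : P ⟶ R := sq.desc (m ≫ pushout.inl _ _) r (by
    rw [reassoc_of% hmn, ← assoc, pushout.condition])
  let y : Q ⟶ R := sq'.desc (n ≫ pushout.inl _ _) r (by rw [← assoc, pushout.condition])
  let z : R ⟶ Q := pushout.desc (p ≫ a') b' (by rw [assoc, reassoc_of% hn, sq'.w])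
  have sx : IsPushout m a (pushout.inl (f ≫ n) g) x := by
    refine IsPushout.of_left (h₁₁ := k) (v₁₁ := g) (h₂₁ := b) ?_ ?_ sq
    · rw [sq.inr_desc, hmn]
      exact IsPushout.of_hasPushout _ _
    · rw [sq.inl_desc]
  have sy : IsPushout n a' (pushout.inl (f ≫ n) g) y := by
    refine IsPushout.of_left (h₁₁ := f) (v₁₁ := g) (h₂₁ := b') ?_ ?_ sq'
    · rw [sq'.inr_desc]
      exact IsPushout.of_hasPushout _ _
    · rw [sq'.inl_desc]
  have wx : WeakEquivalence x := weakEquivalence_of_isPushout sx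
  have wy : WeakEquivalence y := weakEquivalence_of_isPushout sy
  have hyz : y ≫ z = 𝟙 Q := by
    apply sq'.hom_ext
    · rw [sq'.inl_desc_assoc, assoc, pushout.inl_desc, reassoc_of% hn, comp_id]
    · rw [sq'.inr_desc_assoc, pushout.inr_desc, comp_id]
  have wz : WeakEquivalence z := we_of_precomp y z wy (by rw [hyz]; infer_instance)
  have hxz : x ≫ z = w' := by
    apply sq.hom_ext
    · rw [sq.inl_desc_assoc, assoc, pushout.inl_desc, reassoc_of% hm, h₁]
    · rw [sq.inr_desc_assoc, pushout.inr_desc, h₂]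
  rw [← hxz]
  exact we_comp _ _ wx wz

end Cofiber

/-! ### Zero object and coproducts in the homotopy category -/

section

variable {C : Type u} [Category.{v} C] [CofibrationCategory C] [HasZeroObject C]

lemma isZero_γ_zero : IsZero ((γ C).obj (0 : C)) := by
  constructor
  · intro A
    obtain ⟨X, rfl⟩ := exists_eq_γ_obj A
    refine ⟨⟨⟨(γ C).map (fromZero X)⟩, fun φ => ?_⟩⟩
    obtain ⟨Y', f, s, hs, hs', rfl⟩ := exists_fraction φ
    change _ = (γ C).map (fromZero X)
    rw [IsIso.comp_inv_eq, ← Functor.map_comp, fromZero_ext f (fromZero X ≫ s)]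
  · intro A
    obtain ⟨X, rfl⟩ := exists_eq_γ_obj A
    refine ⟨⟨⟨(γ C).map (toZero X)⟩, fun φ => ?_⟩⟩
    obtain ⟨T, f, s, hs, hs', rfl⟩ := exists_fraction φ
    change _ = (γ C).map (toZero X)
    have : WeakEquivalence (toZero T) := contractible_of_we s contractible_zero
    rw [IsIso.comp_inv_eq, ← cancel_mono ((γ C).map (toZero T)), ← Functor.map_comp,
      ← Functor.map_comp, ← Functor.map_comp]
    congr 1
    exact (isZero_zero C).eq_of_tgt _ _

lemma isZero_γ_of_contractible {A : C} (hA : WeaklyContractible A) : IsZero ((γ C).obj A) :=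
  isZero_γ_zero.of_iso (asIso ((γ C).map (toZero A)))

/-- Morphisms out of the image of a coproduct are determined by their components. -/
lemma γ_coprod_hom_ext {X Y V : C} {a : X ⟶ V} {b : Y ⟶ V}
    (sq : IsPushout (fromZero X) (fromZero Y) a b) {Z : Ho C} {φ ψ : (γ C).obj V ⟶ Z}
    (h₁ : (γ C).map a ≫ φ = (γ C).map a ≫ ψ) (h₂ : (γ C).map b ≫ φ = (γ C).map b ≫ ψ) :
    φ = ψ := by
  obtain ⟨Z, rfl⟩ := exists_eq_γ_obj Z
  -- reduction to morphisms of `C`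
  have key : ∀ (T : C) (f g : V ⟶ T), (γ C).map (a ≫ f) = (γ C).map (a ≫ g) →
      (γ C).map (b ≫ f) = (γ C).map (b ≫ g) → (γ C).map f = (γ C).map g := by
    intro T f g h₁ h₂
    obtain ⟨I, i, p, Y₁, s, H, -, ci, -, wi, -, wp, cs, ws, hp₀, hp₁, H₀, H₁⟩ :=
      (homotopic_of_γ_map_eq h₁).exists_cylinder
    obtain ⟨J, j, q, Y₂, t, K, -, cj, -, wj, -, wq, ct, wt, hq₀, hq₁, K₀, K₁⟩ :=
      (homotopic_of_γ_map_eq h₂).exists_cylinder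
    generalize pushout.inl _ _ ≫ i = i₀ at *
    generalize pushout.inr _ _ ≫ i = i₁ at *
    generalize pushout.inl _ _ ≫ j = j₀ at *
    generalize pushout.inr _ _ ≫ j = j₁ at *
    -- the coproduct of the two cylinders, as an object under `V`
    let Q₁ := pushout i₀ a
    let Q₂ := pushout j₀ (b ≫ pushout.inr i₀ a)
    let e₀ : V ⟶ Q₂ := pushout.inr i₀ a ≫ pushout.inr j₀ (b ≫ pushout.inr i₀ a)
    let e₁ : V ⟶ Q₂ := sq.desc (i₁ ≫ pushout.inl i₀ a ≫ pushout.inr _ _) (j₁ ≫ pushout.inl _ _)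
      (fromZero_ext _ _)
    have we₀ : WeakEquivalence e₀ := we_comp _ _ inferInstance inferInstance
    let π : Q₂ ⟶ V := pushout.desc (q ≫ b) (pushout.desc (p ≫ a) (𝟙 V)
      (by rw [reassoc_of% hp₀, comp_id]))
      (by rw [reassoc_of% hq₀, assoc, pushout.inr_desc, comp_id])
    have hπ₀ : e₀ ≫ π = 𝟙 V := by
      dsimp only [e₀, π]
      rw [assoc, pushout.inr_desc, pushout.inr_desc]
    have hπ₁ : e₁ ≫ π = 𝟙 V := by
      dsimp only [e₁, π]
      apply sq.hom_ext
      · rw [sq.inl_desc_assoc, assoc, assoc, pushout.inr_desc, pushout.inl_desc,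
          reassoc_of% hp₁, comp_id]
      · rw [sq.inr_desc_assoc, assoc, pushout.inl_desc, reassoc_of% hq₁, comp_id]
    have wπ : WeakEquivalence π := we_of_precomp e₀ π we₀ (by rw [hπ₀]; infer_instance)
    have hγ : (γ C).map e₀ = (γ C).map e₁ := by
      rw [← cancel_mono ((γ C).map π), ← Functor.map_comp, ← Functor.map_comp, hπ₀, hπ₁]
    let r : T ⟶ pushout s t := s ≫ pushout.inl s t
    have hr : r = t ≫ pushout.inr s t := pushout.condition
    have wr : WeakEquivalence r := by
      have := weakEquivalence_inl s t
      exact we_comp _ _ ws this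
    let G : Q₂ ⟶ pushout s t := pushout.desc (K ≫ pushout.inr s t)
      (pushout.desc (H ≫ pushout.inl s t) (f ≫ r) (by rw [reassoc_of% H₀]))
      (by rw [assoc, pushout.inr_desc, reassoc_of% K₀, hr])
    have hG₀ : e₀ ≫ G = f ≫ r := by
      dsimp only [e₀, G]
      rw [assoc, pushout.inr_desc, pushout.inr_desc]
    have hG₁ : e₁ ≫ G = g ≫ r := by
      dsimp only [e₁, G]
      apply sq.hom_ext
      · rw [sq.inl_desc_assoc, assoc, assoc, pushout.inr_desc, pushout.inl_desc,
          reassoc_of% H₁]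
      · rw [sq.inr_desc_assoc, assoc, pushout.inl_desc, reassoc_of% K₁, hr]
    rw [← cancel_mono ((γ C).map r), ← Functor.map_comp, ← Functor.map_comp, ← hG₀, ← hG₁,
      (γ C).map_comp e₀, (γ C).map_comp e₁, hγ]
  obtain ⟨T₁, f, s, hs, hs', rfl⟩ := exists_fraction φ
  obtain ⟨T₂, g, t, ht, ht', rfl⟩ := exists_fraction ψ
  have e₁ : inv ((γ C).map s) ≫ (γ C).map (s ≫ pushout.inl s t) = (γ C).map (pushout.inl s t) := by
    simp
  have e₂ : inv ((γ C).map t) ≫ (γ C).map (s ≫ pushout.inl s t) = (γ C).map (pushout.inr s t) := by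
    rw [pushout.condition]
    simp
  have wr : WeakEquivalence (s ≫ pushout.inl s t) := by
    have := weakEquivalence_inl s t
    exact we_comp _ _ hs' this
  rw [← cancel_mono ((γ C).map (s ≫ pushout.inl s t)), assoc, assoc, e₁, e₂, ← Functor.map_comp,
    ← Functor.map_comp]
  have h₁' := h₁ =≫ (γ C).map (s ≫ pushout.inl s t)
  have h₂' := h₂ =≫ (γ C).map (s ≫ pushout.inl s t)
  simp only [assoc, e₁, e₂, ← Functor.map_comp] at h₁' h₂'
  exact key _ _ _ h₁' h₂'

/-- `γ` preserves coproducts. -/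
lemma exists_γ_coprod_desc {X Y V : C} {a : X ⟶ V} {b : Y ⟶ V}
    (sq : IsPushout (fromZero X) (fromZero Y) a b) {Z : Ho C} (φ : (γ C).obj X ⟶ Z)
    (ψ : (γ C).obj Y ⟶ Z) :
    ∃ χ : (γ C).obj V ⟶ Z, (γ C).map a ≫ χ = φ ∧ (γ C).map b ≫ χ = ψ := by
  obtain ⟨Z, rfl⟩ := exists_eq_γ_obj Z
  obtain ⟨T₁, f, s, hs, hs', rfl⟩ := exists_fraction φ
  obtain ⟨T₂, g, t, ht, ht', rfl⟩ := exists_fraction ψ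
  have wr : WeakEquivalence (s ≫ pushout.inl s t) := by
    have := weakEquivalence_inl s t
    exact we_comp _ _ hs' this
  refine ⟨(γ C).map (sq.desc (f ≫ pushout.inl s t) (g ≫ pushout.inr s t) (fromZero_ext _ _)) ≫
    inv ((γ C).map (s ≫ pushout.inl s t)), ?_, ?_⟩
  · rw [← assoc, IsIso.comp_inv_eq, ← Functor.map_comp, sq.inl_desc]
    simp
  · rw [← assoc, IsIso.comp_inv_eq, ← Functor.map_comp, sq.inr_desc, pushout.condition]
    simp

end

end CofibrationCategory

namespace CofibrationCategory

set_option linter.unusedSectionVars false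

/-! ### Suspensions computed by arbitrary cones -/

section Cone

variable {C : Type u} [Category.{v} C] [CofibrationCategory C] [HasZeroObject C]

/-- A cofibration `i : X ⟶ A` to a weakly contractible object, together with a quotient
`s : A ⟶ S`. The object `S` is a model of the suspension of `X`. -/
structure IsConeSeq {X A S : C} (i : X ⟶ A) (s : A ⟶ S) : Prop where
  isCofiber : IsCofiber i s
  contractible : WeaklyContractible A

namespace IsConeSeq

/-- The underlying cone. -/
abbrev coneOf {X A S : C} {i : X ⟶ A} {s : A ⟶ S} (h : IsConeSeq i s) : ConeOf X where
  pt := A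
  ι := i
  cofibration := h.isCofiber.cofibration
  contractible := h.contractible

lemma of_cofibration {X A : C} (i : X ⟶ A) [Cofibration i] (hA : WeaklyContractible A) :
    IsConeSeq i (quotπ i) := ⟨isCofiber_quotπ i, hA⟩

/-- Any cofibration to a weakly contractible object receives a map from any cone, after enlarging
the target. -/
lemma exists_extension {X A Y D : C} (i : X ⟶ A) [Cofibration i] (f : X ⟶ Y) (j : Y ⟶ D) :
    ∃ (K S : C) (a : A ⟶ K) (k : D ⟶ K) (s : K ⟶ S), i ≫ a = f ≫ j ≫ k ∧ Cofibration k ∧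
      WeaklyContractible K ∧ (Cofibration j → IsConeSeq (j ≫ k) s) := by
  obtain ⟨K, k, hk, hK⟩ := exists_cone (pushout i (f ≫ j))
  have hk' : Cofibration (pushout.inr i (f ≫ j) ≫ k) := inferInstance
  by_cases hj : Cofibration j
  · exact ⟨K, _, pushout.inl _ _ ≫ k, pushout.inr _ _ ≫ k, quotπ _,
      by rw [pushout.condition_assoc, assoc], hk', hK, fun _ => of_cofibration _ hK⟩
  · exact ⟨K, K, pushout.inl _ _ ≫ k, pushout.inr _ _ ≫ k, 𝟙 _,
      by rw [pushout.condition_assoc, assoc], hk', hK, fun h => (hj h).elim⟩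

end IsConeSeq

lemma ConeExtension.hoMap_congr {X Y : C} {f g : X ⟶ Y} {A : ConeOf X} {B : ConeOf Y} (h : f = g)
    (E : ConeExtension f A B) (E' : ConeExtension g A B) : E.hoMap = E'.hoMap := by
  subst h
  exact hoMap_eq _ _

lemma ConeExtension.hoMap_of_map {X Y : C} {f : X ⟶ Y} {A : ConeOf X} {B : ConeOf Y}
    (E : ConeExtension f A B) (b : A.pt ⟶ B.pt) (w : A.ι ≫ b = f ≫ B.ι) :
    E.hoMap = (γ C).map (quotMap A.ι B.ι f b w) := by
  have h := E.hoMap_comp b (𝟙 _) (by rw [w, comp_id])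
  have : WeakEquivalence (quotMap B.ι (B.ι ≫ 𝟙 _) (𝟙 Y) (𝟙 _) (id_comp _).symm) :=
    weakEquivalence_quotMap _ _ _ _
  rw [← cancel_mono ((γ C).map (quotMap B.ι (B.ι ≫ 𝟙 _) (𝟙 Y) (𝟙 _) (id_comp _).symm)), h,
    ← Functor.map_comp]
  congr 1
  apply quot_ext
  rw [quotπ_map, ← assoc, quotπ_map, assoc, quotπ_map, id_comp]

section

variable [ChosenCones C]

/-- The value of the suspension functor on the image of an object of `C`. -/
noncomputable def suspIso (X : C) : (γ C).obj (susp X) ≅ (suspension C).obj ((γ C).obj X) :=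
  Iso.refl ((γ C).obj (susp X))

lemma suspension_map_γ {X Y : C} (f : X ⟶ Y) (E : ConeExtension f (cone X) (cone Y)) :
    (suspension C).map ((γ C).map f) = (suspIso X).inv ≫ E.hoMap ≫ (suspIso Y).hom := by
  have e₁ : (suspension C).map ((γ C).map f) = (suspFunctor₀ C).map f :=
    eq_of_heq (Functor.hcongr_hom
      (Localization.Construction.fac (suspFunctor₀ C) (suspFunctor₀_isInvertedBy C)) f)
  have e₂ : (suspFunctor₀ C).map f = 𝟙 ((γ C).obj (susp X)) ≫ E.hoMap ≫ 𝟙 ((γ C).obj (susp Y)) := by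
    rw [id_comp, comp_id]
    exact ConeExtension.hoMap_eq _ _
  exact e₁.trans e₂

lemma connecting_eq {X Y : C} (f : X ⟶ Y) [Cofibration f] : connecting f =
    inv ((γ C).map (collapseCone f)) ≫ (γ C).map (collapseBase f) ≫ (suspIso X).hom := by
  have h : inv ((γ C).map (collapseCone f)) ≫ (γ C).map (collapseBase f) =
      inv ((γ C).map (collapseCone f)) ≫ (γ C).map (collapseBase f) ≫ 𝟙 ((γ C).obj (susp X)) := by
    rw [comp_id]
  exact h

lemma isConeSeq_cone (X : C) : IsConeSeq (cone X).ι (quotπ (cone X).ι) :=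
  .of_cofibration _ (cone X).contractible

/-- The canonical isomorphism `A/X ≅ ΣX` in the homotopy category for a cone `A` of `X`. -/
noncomputable def IsConeSeq.σ {X A S : C} {i : X ⟶ A} {s : A ⟶ S} (h : IsConeSeq i s) :
    (γ C).obj S ⟶ (suspension C).obj ((γ C).obj X) :=
  (γ C).map h.isCofiber.quotIso.inv ≫
    (ConeExtension.exists_coneExtension (𝟙 X) h.coneOf (cone X)).some.hoMap ≫ (suspIso X).hom

namespace IsConeSeq

lemma σ_eq {X A S : C} {i : X ⟶ A} {s : A ⟶ S} (h : IsConeSeq i s)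
    (E : ConeExtension (𝟙 X) h.coneOf (cone X)) :
    h.σ = (γ C).map h.isCofiber.quotIso.inv ≫ E.hoMap ≫ (suspIso X).hom := by
  rw [σ, ConeExtension.hoMap_eq _ E]

instance {X A S : C} {i : X ⟶ A} {s : A ⟶ S} (h : IsConeSeq i s) : IsIso h.σ := by
  have := ConeExtension.isIso_hoMap
    (ConeExtension.exists_coneExtension (𝟙 X) h.coneOf (cone X)).some
  dsimp only [σ]
  infer_instance

lemma σ_natural {X A S X' A' S' : C} {i : X ⟶ A} {s : A ⟶ S} (h : IsConeSeq i s) {i' : X' ⟶ A'}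
    {s' : A' ⟶ S'} (h' : IsConeSeq i' s') (a : X ⟶ X') (b : A ⟶ A') (c : S ⟶ S')
    (w₁ : i ≫ b = a ≫ i') (w₂ : s ≫ c = b ≫ s') :
    h.σ ≫ (suspension C).map ((γ C).map a) = (γ C).map c ≫ h'.σ := by
  obtain ⟨E₁⟩ := ConeExtension.exists_coneExtension (𝟙 X ≫ a) h.coneOf (cone X')
  obtain ⟨E₂⟩ := ConeExtension.exists_coneExtension (a ≫ 𝟙 X') h.coneOf (cone X')
  obtain ⟨E₃⟩ := ConeExtension.exists_coneExtension a h.coneOf h'.coneOf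
  obtain ⟨F⟩ := ConeExtension.exists_coneExtension (𝟙 X) h.coneOf (cone X)
  obtain ⟨F'⟩ := ConeExtension.exists_coneExtension (𝟙 X') h'.coneOf (cone X')
  obtain ⟨G⟩ := ConeExtension.exists_coneExtension a (cone X) (cone X')
  have := h.isCofiber.cofibration
  have := h'.isCofiber.cofibration
  have k₁ := ConeExtension.hoMap_hoMap F G E₁
  have k₂ := ConeExtension.hoMap_hoMap E₃ F' E₂
  rw [suspension_map_γ a G, σ_eq h F, σ_eq h' F', assoc, assoc, Iso.hom_inv_id_assoc,
    reassoc_of% k₁, ConeExtension.hoMap_congr (by simp) E₁ E₂, ← k₂, assoc,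
    E₃.hoMap_of_map b w₁, ← Functor.map_comp_assoc, ← Functor.map_comp_assoc]
  congr 2
  apply h.isCofiber.hom_ext
  have e₁ := h.isCofiber.comp_quotIso_inv
  have e₂ := h'.isCofiber.comp_quotIso_inv
  rw [reassoc_of% e₁, reassoc_of% w₂, e₂]
  exact quotπ_map _ _ _ _ _

lemma σ_natural_id {X A S A' S' : C} {i : X ⟶ A} {s : A ⟶ S} (h : IsConeSeq i s) {i' : X ⟶ A'}
    {s' : A' ⟶ S'} (h' : IsConeSeq i' s') (b : A ⟶ A') (c : S ⟶ S')
    (w₁ : i ≫ b = i') (w₂ : s ≫ c = b ≫ s') : h.σ = (γ C).map c ≫ h'.σ := by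
  have := σ_natural h h' (𝟙 X) b c (by rw [w₁, id_comp]) w₂
  rwa [CategoryTheory.Functor.map_id, CategoryTheory.Functor.map_id, comp_id] at this

lemma σ_cone (X : C) : (isConeSeq_cone X).σ = (suspIso X).hom := by
  obtain ⟨E⟩ := ConeExtension.exists_coneExtension (𝟙 X) (isConeSeq_cone X).coneOf (cone X)
  have hE : E.hoMap = 𝟙 _ := ConeExtension.hoMap_id (A := cone X) E
  have h : (isConeSeq_cone X).isCofiber.quotIso.inv = 𝟙 _ := by
    apply (isConeSeq_cone X).isCofiber.hom_ext
    rw [IsCofiber.comp_quotIso_inv, comp_id]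
  rw [σ_eq _ E, h, CategoryTheory.Functor.map_id, id_comp, hE, id_comp]

end IsConeSeq

/-! ### Connecting morphisms -/

/-- The connecting morphism of a cofibration, for an arbitrary model of the quotient. -/
noncomputable def IsCofiber.δ {X Y Z : C} {f : X ⟶ Y} {p : Y ⟶ Z} (h : IsCofiber f p) :
    (γ C).obj Z ⟶ (suspension C).obj ((γ C).obj X) :=
  (γ C).map h.quotIso.inv ≫ @connecting C _ _ _ _ X Y f h.cofibration

namespace IsCofiber

lemma δ_quotπ {X Y : C} (f : X ⟶ Y) [Cofibration f] : (isCofiber_quotπ f).δ = connecting f := by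
  have h : (isCofiber_quotπ f).quotIso.inv = 𝟙 _ := by
    apply (isCofiber_quotπ f).hom_ext
    rw [IsCofiber.comp_quotIso_inv, comp_id]
  rw [δ, h, CategoryTheory.Functor.map_id, id_comp]

/-- The comparison of two cones in the characterization of the connecting morphism. -/
lemma δ_eq_iff {X Y Z : C} {f : X ⟶ Y} {p : Y ⟶ Z} (h : IsCofiber f p)
    {A S D A' S' D' : C} {i : X ⟶ A} {s : A ⟶ S} (hA : IsConeSeq i s) {u : A ⟶ D} {v : Y ⟶ D}
    (sq : IsPushout i f u v) {c : D ⟶ Z} {d : D ⟶ S} (uc : u ≫ c = 0) (vc : v ≫ c = p)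
    (ud : u ≫ d = s) (vd : v ≫ d = 0)
    {i' : X ⟶ A'} {s' : A' ⟶ S'} (hA' : IsConeSeq i' s') {u' : A' ⟶ D'} {v' : Y ⟶ D'}
    (sq' : IsPushout i' f u' v') {c' : D' ⟶ Z} {d' : D' ⟶ S'} (uc' : u' ≫ c' = 0)
    (vc' : v' ≫ c' = p) (ud' : u' ≫ d' = s') (vd' : v' ≫ d' = 0) (b : A ⟶ A') (hb : i ≫ b = i') :
    (γ C).map c ≫ h.δ = (γ C).map d ≫ hA.σ ↔ (γ C).map c' ≫ h.δ = (γ C).map d' ≫ hA'.σ := by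
  obtain ⟨t, ht⟩ := hA.isCofiber.exists_desc (b ≫ s') (by
    rw [reassoc_of% hb, hA'.isCofiber.w])
  let e : D ⟶ D' := sq.desc (b ≫ u') v' (by rw [reassoc_of% hb, sq'.w])
  have ec : e ≫ c' = c := sq.hom_ext (by rw [sq.inl_desc_assoc, assoc, uc', uc, comp_zero])
    (by rw [sq.inr_desc_assoc, vc', vc])
  have ed : e ≫ d' = d ≫ t := sq.hom_ext
    (by rw [sq.inl_desc_assoc, assoc, ud', reassoc_of% ud, ht])
    (by rw [sq.inr_desc_assoc, vd', reassoc_of% vd, zero_comp])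
  have wc : WeakEquivalence c :=
    (h.of_isPushout sq.flip vc uc).weakEquivalence hA.contractible
  have wc' : WeakEquivalence c' :=
    (h.of_isPushout sq'.flip vc' uc').weakEquivalence hA'.contractible
  have we : WeakEquivalence e := we_of_postcomp e c' wc' (by rwa [ec])
  rw [hA.σ_natural_id hA' b t hb ht, ← assoc, ← Functor.map_comp, ← ed, ← ec, Functor.map_comp,
    Functor.map_comp, assoc, assoc, cancel_epi]

/-- The connecting morphism can be computed by any cone. -/
lemma δ_eq {X Y Z : C} {f : X ⟶ Y} {p : Y ⟶ Z} (h : IsCofiber f p)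
    {A S D : C} {i : X ⟶ A} {s : A ⟶ S} (hA : IsConeSeq i s) {u : A ⟶ D} {v : Y ⟶ D}
    (sq : IsPushout i f u v) {c : D ⟶ Z} {d : D ⟶ S} (uc : u ≫ c = 0) (vc : v ≫ c = p)
    (ud : u ≫ d = s) (vd : v ≫ d = 0) :
    (γ C).map c ≫ h.δ = (γ C).map d ≫ hA.σ := by
  have := h.cofibration
  have := hA.isCofiber.cofibration
  -- a cone `K` containing both `A` and the chosen cone
  obtain ⟨K, S', a, k, s', hk, ck, hK, hs'⟩ :=
    IsConeSeq.exists_extension (cone X).ι (𝟙 X) i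
  rw [id_comp] at hk
  have hK' := hs' inferInstance
  let c' : pushout (i ≫ k) f ⟶ Z := pushout.desc 0 p (by rw [h.w, comp_zero])
  let d' : pushout (i ≫ k) f ⟶ S' := pushout.desc s' 0 (by rw [hK'.isCofiber.w, comp_zero])
  rw [h.δ_eq_iff hA sq uc vc ud vd hK' (IsPushout.of_hasPushout _ _) (c' := c') (d' := d')
    (pushout.inl_desc _ _ _) (pushout.inr_desc _ _ _) (pushout.inl_desc _ _ _)
    (pushout.inr_desc _ _ _) k rfl, ← h.δ_eq_iff (isConeSeq_cone X)
    (IsPushout.of_hasPushout _ _) (c := collapseCone f ≫ h.quotIso.hom) (d := collapseBase f) ?_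
    ?_ ?_ ?_ hK' (IsPushout.of_hasPushout _ _)
    (pushout.inl_desc _ _ _) (pushout.inr_desc _ _ _) (pushout.inl_desc _ _ _)
    (pushout.inr_desc _ _ _) a hk, IsConeSeq.σ_cone]
  · rw [δ, connecting_eq, Functor.map_comp, assoc, Iso.map_hom_inv_id_assoc,
      IsIso.hom_inv_id_assoc]
  · rw [collapseCone, pushout.inl_desc_assoc, toZero_comp_fromZero, zero_comp]
  · rw [collapseCone, pushout.inr_desc_assoc, h.quotπ_quotIso_hom]
  · rw [collapseBase, pushout.inl_desc]
  · rw [collapseBase, pushout.inr_desc, toZero_comp_fromZero]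

/-- Connecting morphisms are natural with respect to commutative squares in `C`. -/
lemma δ_natural {X Y Z X' Y' Z' : C} {f : X ⟶ Y} {p : Y ⟶ Z} (h : IsCofiber f p) {f' : X' ⟶ Y'}
    {p' : Y' ⟶ Z'} (h' : IsCofiber f' p') (a : X ⟶ X') (b : Y ⟶ Y') (c : Z ⟶ Z')
    (w₁ : f ≫ b = a ≫ f') (w₂ : p ≫ c = b ≫ p') :
    h.δ ≫ (suspension C).map ((γ C).map a) = (γ C).map c ≫ h'.δ := by
  have := h.cofibration
  have := h'.cofibration
  obtain ⟨K, S, m, k, s, hk, ck, hK, hs⟩ :=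
    IsConeSeq.exists_extension (cone X).ι a (cone X').ι
  have hA' := hs inferInstance
  obtain ⟨S₀, i, t, hA, hk⟩ : ∃ (S₀ : C) (i : X ⟶ (cone X).pt) (t : _ ⟶ S₀),
    IsConeSeq i t ∧ i ≫ m = a ≫ (cone X').ι ≫ k := ⟨_, _, _, isConeSeq_cone X, hk⟩
  obtain ⟨j, hj⟩ : ∃ j, (cone X').ι ≫ k = j := ⟨_, rfl⟩
  rw [hj] at hk hA'
  have := hA.isCofiber.cofibration
  have := hA'.isCofiber.cofibration
  obtain ⟨r, hr⟩ := hA.isCofiber.exists_desc (m ≫ s) (by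
    rw [reassoc_of% hk, hA'.isCofiber.w, comp_zero])
  have sq := IsPushout.of_hasPushout i f
  have sq' := IsPushout.of_hasPushout j f'
  let e : pushout i f ⟶ pushout j f' := sq.desc (m ≫ pushout.inl _ _) (b ≫ pushout.inr _ _) (by
    rw [reassoc_of% hk, sq'.w, reassoc_of% w₁])
  have z : i ≫ (0 : _ ⟶ Z) = f ≫ p := by rw [h.w, comp_zero]
  have z' : j ≫ (0 : _ ⟶ Z') = f' ≫ p' := by rw [h'.w, comp_zero]
  have y : i ≫ t = f ≫ 0 := by rw [hA.isCofiber.w, comp_zero]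
  have y' : j ≫ s = f' ≫ 0 := by rw [hA'.isCofiber.w, comp_zero]
  have ec : sq.desc _ _ z ≫ c = e ≫ sq'.desc _ _ z' := by
    apply sq.hom_ext
    · rw [sq.inl_desc_assoc, sq.inl_desc_assoc, assoc, sq'.inl_desc, zero_comp, comp_zero]
    · rw [sq.inr_desc_assoc, sq.inr_desc_assoc, assoc, sq'.inr_desc, w₂]
  have ed : sq.desc _ _ y ≫ r = e ≫ sq'.desc _ _ y' := by
    apply sq.hom_ext
    · rw [sq.inl_desc_assoc, sq.inl_desc_assoc, assoc, sq'.inl_desc, hr]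
    · rw [sq.inr_desc_assoc, sq.inr_desc_assoc, assoc, sq'.inr_desc, zero_comp, comp_zero]
  have e₁ := h.δ_eq hA sq (sq.inl_desc _ _ z) (sq.inr_desc _ _ z) (sq.inl_desc _ _ y)
    (sq.inr_desc _ _ y)
  have e₂ := h'.δ_eq hA' sq' (sq'.inl_desc _ _ z') (sq'.inr_desc _ _ z') (sq'.inl_desc _ _ y')
    (sq'.inr_desc _ _ y')
  have wc : WeakEquivalence (sq.desc _ _ z) :=
    (h.of_isPushout sq.flip (sq.inr_desc _ _ z) (sq.inl_desc _ _ z)).weakEquivalence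
      hA.contractible
  rw [← cancel_epi ((γ C).map (sq.desc _ _ z)), ← assoc, e₁, assoc, hA.σ_natural hA' a m r hk hr,
    ← assoc, ← assoc, ← Functor.map_comp, ← Functor.map_comp, ed, ec, Functor.map_comp,
    Functor.map_comp, assoc, assoc, e₂]

lemma δ_natural_id {X Y Z Y' Z' : C} {f : X ⟶ Y} {p : Y ⟶ Z} (h : IsCofiber f p) {f' : X ⟶ Y'}
    {p' : Y' ⟶ Z'} (h' : IsCofiber f' p') (b : Y ⟶ Y') (c : Z ⟶ Z')
    (w₁ : f ≫ b = f') (w₂ : p ≫ c = b ≫ p') : h.δ = (γ C).map c ≫ h'.δ := by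
  have := δ_natural h h' (𝟙 X) b c (by rw [w₁, id_comp]) w₂
  rwa [CategoryTheory.Functor.map_id, CategoryTheory.Functor.map_id, comp_id] at this

end IsCofiber

end

end Cone

end CofibrationCategory

/-! ### Additive structures from natural subtractions -/

section Subtraction

/-- An abelian group can be defined by a subtraction which satisfies the interchange law. -/
abbrev addCommGroupOfSub {G : Type*} (s : G → G → G) (z : G) (h₀ : ∀ a, s a z = a)
    (h₁ : ∀ a, s a a = z) (h₂ : ∀ a b c d, s (s a b) (s c d) = s (s a c) (s b d)) :
    AddCommGroup G :=
  have hz (a : G) : s z (s z a) = a :=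
    calc s z (s z a) = s (s a a) (s z a) := by rw [h₁]
      _ = s (s a z) (s a a) := h₂ _ _ _ _
      _ = a := by rw [h₁, h₀, h₀]
  have hs (a b : G) : s z (s a b) = s b a :=
    calc s z (s a b) = s (s b b) (s a b) := by rw [h₁]
      _ = s (s b a) (s b b) := h₂ _ _ _ _
      _ = s b a := by rw [h₁, h₀]
  letI : Zero G := ⟨z⟩
  letI : Add G := ⟨fun a b => s a (s z b)⟩
  letI : Neg G := ⟨fun a => s z a⟩
  { sub := s
    nsmul := nsmulRec
    zsmul := zsmulRec
    add_zero a := by change s a (s z z) = a; rw [h₀, h₀]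
    zero_add a := hz a
    neg_add_cancel a := by change s (s z a) (s z a) = z; rw [h₁]
    sub_eq_add_neg a b := by change s a b = s a (s z (s z b)); rw [hz]
    add_comm a b :=
      calc s a (s z b) = s z (s (s z b) a) := (hs _ _).symm
        _ = s z (s (s z b) (s a z)) := by rw [h₀ a]
        _ = s z (s (s z a) (s b z)) := by rw [h₂]
        _ = s b (s z a) := by rw [h₀ b, hs]
    add_assoc a b c :=
      calc s (s a (s z b)) (s z c) = s a (s (s z b) (s c z)) := by rw [h₂, h₀, h₀]
        _ = s a (s (s z c) (s b z)) := by rw [h₂ z b]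
        _ = s a (s z (s b (s z c))) := by rw [h₀ b, hs] }

open CategoryTheory

/-- A category in which every object has a copower by two is preadditive if its sets of morphisms
have subtractions which are preserved by composition on both sides. -/
abbrev preadditiveOfSub {T : Type*} [Category T] [HasZeroMorphisms T]
    (s : ∀ {X Y : T}, (X ⟶ Y) → (X ⟶ Y) → (X ⟶ Y)) (h₀ : ∀ {X Y : T} (a : X ⟶ Y), s a 0 = a)
    (h₁ : ∀ {X Y : T} (a : X ⟶ Y), s a a = 0)
    (hl : ∀ {X Y Z : T} (a b : X ⟶ Y) (c : Y ⟶ Z), s a b ≫ c = s (a ≫ c) (b ≫ c))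
    (hr : ∀ {X Y Z : T} (c : X ⟶ Y) (a b : Y ⟶ Z), c ≫ s a b = s (c ≫ a) (c ≫ b))
    (hV : ∀ X : T, ∃ (V : T) (i j : X ⟶ V), (∀ {Z : T} (a b : V ⟶ Z), i ≫ a = i ≫ b →
      j ≫ a = j ≫ b → a = b) ∧ ∀ {Z : T} (a b : X ⟶ Z), ∃ c : V ⟶ Z, i ≫ c = a ∧ j ≫ c = b) :
    Preadditive T :=
  have h₂ {X Y : T} (a b c d : X ⟶ Y) : s (s a b) (s c d) = s (s a c) (s b d) := by
    obtain ⟨V, i, j, hext, hdesc⟩ := hV X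
    obtain ⟨x, hx, hx'⟩ := hdesc a c
    obtain ⟨y, hy, hy'⟩ := hdesc b d
    rw [← hx, ← hx', ← hy, ← hy', ← hr, ← hr, ← hl, ← hl, ← hl, hr]
  { homGroup X Y := addCommGroupOfSub s 0 h₀ h₁ h₂
    add_comp X Y Z a b c := by
      change s a (s 0 b) ≫ c = s (a ≫ c) (s 0 (b ≫ c))
      rw [hl, hl, zero_comp]
    comp_add X Y Z c a b := by
      change c ≫ s a (s 0 b) = s (c ≫ a) (s 0 (c ≫ b))
      rw [hr, hr, comp_zero] }

end Subtraction

namespace CofibrationCategory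

set_option linter.unusedSectionVars false

/-! ### The additive structure of the homotopy category -/

section Additive

variable {C : Type u} [Category.{v} C] [CofibrationCategory C] [HasZeroObject C]

section

variable [HasZeroMorphisms (Ho C)]

lemma γ_map_comp_eq_zero {X A Y : C} (hA : WeaklyContractible A) (f : X ⟶ A) (g : A ⟶ Y) :
    (γ C).map (f ≫ g) = 0 := by
  rw [Functor.map_comp, (isZero_γ_of_contractible hA).eq_of_tgt ((γ C).map f) 0, zero_comp]

lemma γ_map_zero {X Y : C} : (γ C).map (0 : X ⟶ Y) = 0 := by
  rw [← toZero_comp_fromZero, γ_map_comp_eq_zero contractible_zero]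

variable [ChosenCones C]

/-- The pinch map of a cone `A` of `X`: the object `D` is `A ∪_X A`, the object `V` is the
coproduct of `S = A/X` with itself, the morphism `d : D ⟶ S` collapses the second copy of `A` and
the morphism `φ : D ⟶ V` collapses `X`. -/
structure Pinch {X A S : C} (i : X ⟶ A) (s : A ⟶ S) where
  D : C
  u : A ⟶ D
  v : A ⟶ D
  isPushout : IsPushout i i u v
  V : C
  x : S ⟶ V
  y : S ⟶ V
  isCoprod : IsPushout (fromZero S) (fromZero S) x y
  d : D ⟶ S
  φ : D ⟶ V
  ud : u ≫ d = s
  vd : v ≫ d = 0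
  uφ : u ≫ φ = s ≫ x
  vφ : v ≫ φ = s ≫ y

lemma IsConeSeq.exists_pinch {X A S : C} {i : X ⟶ A} {s : A ⟶ S} (h : IsConeSeq i s) :
    Nonempty (Pinch i s) := by
  have := h.isCofiber.cofibration
  have w₁ : i ≫ s = i ≫ 0 := by rw [h.isCofiber.w, comp_zero]
  have w₂ : i ≫ s ≫ pushout.inl (fromZero S) (fromZero S) = i ≫ s ≫ pushout.inr _ _ := by
    rw [← assoc, h.isCofiber.w, zero_comp, ← assoc, h.isCofiber.w, zero_comp]
  exact ⟨{
    D := pushout i i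
    u := pushout.inl i i
    v := pushout.inr i i
    isPushout := IsPushout.of_hasPushout _ _
    V := pushout (fromZero S) (fromZero S)
    x := pushout.inl _ _
    y := pushout.inr _ _
    isCoprod := IsPushout.of_hasPushout _ _
    d := pushout.desc s 0 w₁
    φ := pushout.desc (s ≫ pushout.inl _ _) (s ≫ pushout.inr _ _) w₂
    ud := pushout.inl_desc _ _ _
    vd := pushout.inr_desc _ _ _
    uφ := pushout.inl_desc _ _ _
    vφ := pushout.inr_desc _ _ _ }⟩

lemma Pinch.weakEquivalence_d {X A S : C} {i : X ⟶ A} {s : A ⟶ S} (P : Pinch i s)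
    (h : IsConeSeq i s) : WeakEquivalence P.d :=
  (h.isCofiber.of_isPushout P.isPushout P.ud P.vd).weakEquivalence h.contractible

/-- `c` is the difference of the morphisms `a` and `b` out of a suspension: it is the restriction
of the morphism `(a, b)` on `V = S ∨ S` along the pinch map `S ⟵ A ∪_X A ⟶ S ∨ S`. The two halves
of `A ∪_X A` have opposite orientations, which is why this is a difference and not a sum. -/
def IsSub {X A S : C} {i : X ⟶ A} {s : A ⟶ S} (h : IsConeSeq i s) (P : Pinch i s) {Z : Ho C}
    (a b c : (suspension C).obj ((γ C).obj X) ⟶ Z) : Prop :=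
  ∃ χ : (γ C).obj P.V ⟶ Z, (γ C).map P.x ≫ χ = h.σ ≫ a ∧ (γ C).map P.y ≫ χ = h.σ ≫ b ∧
    (γ C).map P.d ≫ h.σ ≫ c = (γ C).map P.φ ≫ χ

namespace IsSub

variable {X A S : C} {i : X ⟶ A} {s : A ⟶ S} (h : IsConeSeq i s) (P : Pinch i s) {Z : Ho C}

lemma exists_isSub (a b : (suspension C).obj ((γ C).obj X) ⟶ Z) : ∃ c, IsSub h P a b c := by
  obtain ⟨χ, h₁, h₂⟩ := exists_γ_coprod_desc P.isCoprod (h.σ ≫ a) (h.σ ≫ b)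
  have := P.weakEquivalence_d h
  exact ⟨inv h.σ ≫ inv ((γ C).map P.d) ≫ (γ C).map P.φ ≫ χ, χ, h₁, h₂, by simp⟩

variable {h P}

lemma unique {a b c c' : (suspension C).obj ((γ C).obj X) ⟶ Z} (hc : IsSub h P a b c)
    (hc' : IsSub h P a b c') : c = c' := by
  obtain ⟨χ, h₁, h₂, h₃⟩ := hc
  obtain ⟨χ', h₁', h₂', h₃'⟩ := hc'
  have e : χ = χ' := γ_coprod_hom_ext P.isCoprod (h₁.trans h₁'.symm) (h₂.trans h₂'.symm)
  have := P.weakEquivalence_d h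
  rw [← cancel_epi h.σ, ← cancel_epi ((γ C).map P.d), h₃, h₃', e]

lemma postcomp {a b c : (suspension C).obj ((γ C).obj X) ⟶ Z} (hc : IsSub h P a b c) {Z' : Ho C}
    (f : Z ⟶ Z') : IsSub h P (a ≫ f) (b ≫ f) (c ≫ f) := by
  obtain ⟨χ, h₁, h₂, h₃⟩ := hc
  exact ⟨χ ≫ f, by rw [reassoc_of% h₁], by rw [reassoc_of% h₂], by rw [reassoc_of% h₃]⟩

lemma precomp {X' A' S' : C} {i' : X' ⟶ A'} {s' : A' ⟶ S'} (h' : IsConeSeq i' s')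
    (P' : Pinch i' s') (f : X' ⟶ X) (g : A' ⟶ A) (w : i' ≫ g = f ≫ i)
    {a b c : (suspension C).obj ((γ C).obj X) ⟶ Z} (hc : IsSub h P a b c) :
    IsSub h' P' ((suspension C).map ((γ C).map f) ≫ a) ((suspension C).map ((γ C).map f) ≫ b)
      ((suspension C).map ((γ C).map f) ≫ c) := by
  obtain ⟨χ, h₁, h₂, h₃⟩ := hc
  obtain ⟨t, ht⟩ := h'.isCofiber.exists_desc (g ≫ s) (by
    rw [reassoc_of% w, h.isCofiber.w, comp_zero])
  have e₁ := h'.σ_natural h f g t w ht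
  let m : P'.D ⟶ P.D := P'.isPushout.desc (g ≫ P.u) (g ≫ P.v) (by
    rw [reassoc_of% w, reassoc_of% w, P.isPushout.w])
  let n : P'.V ⟶ P.V := P'.isCoprod.desc (t ≫ P.x) (t ≫ P.y) (fromZero_ext _ _)
  have e₂ : m ≫ P.d = P'.d ≫ t := P'.isPushout.hom_ext
    (by rw [P'.isPushout.inl_desc_assoc, assoc, P.ud, reassoc_of% P'.ud, ht])
    (by rw [P'.isPushout.inr_desc_assoc, assoc, P.vd, reassoc_of% P'.vd, comp_zero, zero_comp])
  have e₃ : m ≫ P.φ = P'.φ ≫ n := P'.isPushout.hom_ext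
    (by rw [P'.isPushout.inl_desc_assoc, assoc, P.uφ, reassoc_of% P'.uφ, P'.isCoprod.inl_desc,
      reassoc_of% ht])
    (by rw [P'.isPushout.inr_desc_assoc, assoc, P.vφ, reassoc_of% P'.vφ, P'.isCoprod.inr_desc,
      reassoc_of% ht])
  refine ⟨(γ C).map n ≫ χ, ?_, ?_, ?_⟩
  · rw [← Functor.map_comp_assoc, P'.isCoprod.inl_desc, Functor.map_comp, assoc, h₁,
      reassoc_of% e₁]
  · rw [← Functor.map_comp_assoc, P'.isCoprod.inr_desc, Functor.map_comp, assoc, h₂,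
      reassoc_of% e₁]
  · rw [reassoc_of% e₁, ← Functor.map_comp_assoc, ← Functor.map_comp_assoc, ← e₂, ← e₃,
      Functor.map_comp, Functor.map_comp, assoc, assoc, h₃]

variable (h P)

lemma zero_right (a : (suspension C).obj ((γ C).obj X) ⟶ Z) : IsSub h P a 0 a := by
  refine ⟨(γ C).map (P.isCoprod.desc (𝟙 S) 0 (fromZero_ext _ _)) ≫ h.σ ≫ a, ?_, ?_, ?_⟩
  · rw [← Functor.map_comp_assoc, P.isCoprod.inl_desc, CategoryTheory.Functor.map_id, id_comp]
  · rw [← Functor.map_comp_assoc, P.isCoprod.inr_desc, γ_map_zero, zero_comp, comp_zero]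
  · rw [← Functor.map_comp_assoc]
    congr 2
    apply P.isPushout.hom_ext
    · rw [P.ud, reassoc_of% P.uφ, P.isCoprod.inl_desc, comp_id]
    · rw [P.vd, reassoc_of% P.vφ, P.isCoprod.inr_desc, comp_zero]

lemma self (a : (suspension C).obj ((γ C).obj X) ⟶ Z) : IsSub h P a a 0 := by
  refine ⟨(γ C).map (P.isCoprod.desc (𝟙 S) (𝟙 S) (fromZero_ext _ _)) ≫ h.σ ≫ a, ?_, ?_, ?_⟩
  · rw [← Functor.map_comp_assoc, P.isCoprod.inl_desc, CategoryTheory.Functor.map_id, id_comp]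
  · rw [← Functor.map_comp_assoc, P.isCoprod.inr_desc, CategoryTheory.Functor.map_id, id_comp]
  · have e : P.φ ≫ P.isCoprod.desc (𝟙 S) (𝟙 S) (fromZero_ext _ _) =
        P.isPushout.desc (𝟙 A) (𝟙 A) rfl ≫ s := by
      apply P.isPushout.hom_ext
      · rw [reassoc_of% P.uφ, P.isCoprod.inl_desc, P.isPushout.inl_desc_assoc, id_comp, comp_id]
      · rw [reassoc_of% P.vφ, P.isCoprod.inr_desc, P.isPushout.inr_desc_assoc, id_comp, comp_id]
    rw [← Functor.map_comp_assoc, e, γ_map_comp_eq_zero h.contractible, zero_comp, comp_zero,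
      comp_zero]

end IsSub

/-- The difference of two morphisms out of a suspension. -/
noncomputable def suspSub {X : C} {Z : Ho C} (a b : (suspension C).obj ((γ C).obj X) ⟶ Z) :
    (suspension C).obj ((γ C).obj X) ⟶ Z :=
  (IsSub.exists_isSub (isConeSeq_cone X) (isConeSeq_cone X).exists_pinch.some a b).choose

lemma isSub_suspSub {X A S : C} {i : X ⟶ A} {s : A ⟶ S} (h : IsConeSeq i s) (P : Pinch i s)
    {Z : Ho C} (a b : (suspension C).obj ((γ C).obj X) ⟶ Z) : IsSub h P a b (suspSub a b) := by
  have := h.isCofiber.cofibration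
  -- comparison of both cones with a third one
  obtain ⟨K, S', f, k, s', hk, ck, hK, hs'⟩ :=
    IsConeSeq.exists_extension (cone X).ι (𝟙 X) i
  rw [id_comp] at hk
  have hK' := hs' inferInstance
  obtain ⟨Q⟩ := hK'.exists_pinch
  obtain ⟨c, hc⟩ := IsSub.exists_isSub hK' Q a b
  have h₁ := IsSub.precomp (isConeSeq_cone X) (isConeSeq_cone X).exists_pinch.some (𝟙 X) f
    (by rw [hk, id_comp]) hc
  have h₂ := IsSub.precomp h P (𝟙 X) k (by rw [id_comp]) hc
  rw [CategoryTheory.Functor.map_id, CategoryTheory.Functor.map_id, id_comp, id_comp, id_comp]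
    at h₁ h₂
  rwa [suspSub, IsSub.unique (IsSub.exists_isSub _ _ a b).choose_spec h₁]

lemma suspSub_postcomp {X : C} {Z Z' : Ho C} (a b : (suspension C).obj ((γ C).obj X) ⟶ Z)
    (f : Z ⟶ Z') : suspSub a b ≫ f = suspSub (a ≫ f) (b ≫ f) :=
  have h := isConeSeq_cone X
  have P := h.exists_pinch.some
  IsSub.unique ((isSub_suspSub h P a b).postcomp f) (isSub_suspSub _ _ _ _)

lemma suspSub_precomp_γ {X Y : C} (f : X ⟶ Y) {Z : Ho C}
    (a b : (suspension C).obj ((γ C).obj Y) ⟶ Z) :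
    (suspension C).map ((γ C).map f) ≫ suspSub a b =
      suspSub ((suspension C).map ((γ C).map f) ≫ a) ((suspension C).map ((γ C).map f) ≫ b) := by
  obtain ⟨K, S', m, k, s', hk, ck, hK, hs'⟩ :=
    IsConeSeq.exists_extension (cone X).ι f (cone Y).ι
  have hK' := hs' inferInstance
  obtain ⟨P⟩ := (isConeSeq_cone X).exists_pinch
  obtain ⟨Q⟩ := hK'.exists_pinch
  exact IsSub.unique (IsSub.precomp (isConeSeq_cone X) P f m hk (isSub_suspSub hK' Q a b))
    (isSub_suspSub _ _ _ _)

lemma suspSub_precomp {X Y : C} (ψ : (γ C).obj X ⟶ (γ C).obj Y) {Z : Ho C}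
    (a b : (suspension C).obj ((γ C).obj Y) ⟶ Z) :
    (suspension C).map ψ ≫ suspSub a b =
      suspSub ((suspension C).map ψ ≫ a) ((suspension C).map ψ ≫ b) := by
  obtain ⟨T, f, s, hs, hs', rfl⟩ := exists_fraction ψ
  have e : suspSub a b = (suspension C).map ((γ C).map s) ≫
      suspSub ((suspension C).map (inv ((γ C).map s)) ≫ a)
        ((suspension C).map (inv ((γ C).map s)) ≫ b) := by
    rw [suspSub_precomp_γ, ← assoc, ← assoc, ← Functor.map_comp, IsIso.hom_inv_id,
      CategoryTheory.Functor.map_id, id_comp, id_comp]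
  rw [e, ← Functor.map_comp_assoc, assoc, IsIso.inv_hom_id, comp_id, suspSub_precomp_γ,
    ← Functor.map_comp_assoc, ← Functor.map_comp_assoc]

variable [IsStable C]

instance : (suspension C).IsEquivalence := IsStable.isEquivalence

lemma exists_iso_suspension (A : Ho C) :
    ∃ X : C, Nonempty (A ≅ (suspension C).obj ((γ C).obj X)) := by
  obtain ⟨X, hX⟩ := exists_eq_γ_obj ((suspension C).objPreimage A)
  exact ⟨X, ⟨((suspension C).objObjPreimageIso A).symm ≪≫ (suspension C).mapIso (eqToIso hX)⟩⟩

/-- An isomorphism with a suspension. -/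
noncomputable def desuspIso (A : Ho C) :
    A ≅ (suspension C).obj ((γ C).obj (exists_iso_suspension A).choose) :=
  (exists_iso_suspension A).choose_spec.some

lemma suspSub_precomp' {X Y : C}
    (ψ : (suspension C).obj ((γ C).obj X) ⟶ (suspension C).obj ((γ C).obj Y)) {Z : Ho C}
    (a b : (suspension C).obj ((γ C).obj Y) ⟶ Z) :
    ψ ≫ suspSub a b = suspSub (ψ ≫ a) (ψ ≫ b) := by
  obtain ⟨ψ, rfl⟩ := (suspension C).map_surjective ψ
  exact suspSub_precomp ψ a b

lemma suspSub_zero {X : C} {Z : Ho C} (a : (suspension C).obj ((γ C).obj X) ⟶ Z) :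
    suspSub a 0 = a :=
  have h := isConeSeq_cone X
  have P := h.exists_pinch.some
  IsSub.unique (isSub_suspSub h P _ _) (IsSub.zero_right _ _ _)

lemma suspSub_self {X : C} {Z : Ho C} (a : (suspension C).obj ((γ C).obj X) ⟶ Z) :
    suspSub a a = 0 :=
  have h := isConeSeq_cone X
  have P := h.exists_pinch.some
  IsSub.unique (isSub_suspSub h P _ _) (IsSub.self _ _ _)

variable (C) in
/-- The additive structure of the homotopy category of a stable cofibration category. -/
noncomputable abbrev preadditiveHo : Preadditive (Ho C) :=
  preadditiveOfSub (fun {A _} a b => (desuspIso A).hom ≫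
      suspSub ((desuspIso A).inv ≫ a) ((desuspIso A).inv ≫ b))
    (fun a => by rw [comp_zero, suspSub_zero, Iso.hom_inv_id_assoc])
    (fun a => by rw [suspSub_self, comp_zero])
    (fun a b c => by rw [assoc, suspSub_postcomp, assoc, assoc])
    (fun {A B _} c a b => by
      rw [← cancel_epi (desuspIso A).inv, Iso.inv_hom_id_assoc]
      have := suspSub_precomp' ((desuspIso A).inv ≫ c ≫ (desuspIso B).hom)
        ((desuspIso B).inv ≫ a) ((desuspIso B).inv ≫ b)
      simp only [assoc, Iso.hom_inv_id_assoc] at this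
      exact this)
    (fun A => by
      obtain ⟨X, rfl⟩ := exists_eq_γ_obj A
      have sq := isPushout_coprod X X
      exact ⟨_, _, _, fun _ _ => γ_coprod_hom_ext sq, exists_γ_coprod_desc sq⟩)

end

/-- The canonical morphisms from the union `A ∪_X B` of two cones to `ΣX` that collapse one of the
cones add up to zero, since `A ∪_X B ⟶ S ∨ S' ⟶ K/X` extends over a cone `K`. -/
lemma γ_collapse_add_eq_zero [Preadditive (Ho C)] [ChosenCones C] {X A S B S' D : C} {i : X ⟶ A}
    {s : A ⟶ S} (h : IsConeSeq i s) {i' : X ⟶ B} {s' : B ⟶ S'} (h' : IsConeSeq i' s') {u : A ⟶ D}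
    {v : B ⟶ D} (sq : IsPushout i i' u v) {d : D ⟶ S} {d' : D ⟶ S'} (ud : u ≫ d = s)
    (vd : v ≫ d = 0) (ud' : u ≫ d' = 0) (vd' : v ≫ d' = s') :
    (γ C).map d ≫ h.σ + (γ C).map d' ≫ h'.σ = 0 := by
  have := h.isCofiber.cofibration
  have := h'.isCofiber.cofibration
  obtain ⟨K, k, ck, hK⟩ := exists_cone D
  have cv : Cofibration v := cofibration_of_isPushout sq
  obtain ⟨R, r, hj⟩ : ∃ (R : C) (r : K ⟶ R), IsConeSeq (i' ≫ v ≫ k) r :=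
    ⟨_, _, .of_cofibration _ hK⟩
  obtain ⟨t, ht⟩ := h.isCofiber.exists_desc (u ≫ k ≫ r) (by
    rw [reassoc_of% sq.w]
    simpa using hj.isCofiber.w)
  obtain ⟨t', ht'⟩ := h'.isCofiber.exists_desc (v ≫ k ≫ r) (by simpa using hj.isCofiber.w)
  rw [h.σ_natural_id hj (u ≫ k) t (by rw [reassoc_of% sq.w]) (by rw [ht, assoc]),
    h'.σ_natural_id hj (v ≫ k) t' rfl (by rw [ht', assoc]),
    ← Functor.map_comp_assoc, ← Functor.map_comp_assoc, ← Preadditive.add_comp]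
  have sqV := isPushout_coprod S S'
  set x := pushout.inl (fromZero S) (fromZero S')
  set y := pushout.inr (fromZero S) (fromZero S')
  let φ : D ⟶ pushout (fromZero S) (fromZero S') := sq.desc (s ≫ x) (s' ≫ y) (by
    rw [← assoc, h.isCofiber.w, zero_comp, ← assoc, h'.isCofiber.w, zero_comp])
  let ρ := sqV.desc (𝟙 S) 0 (fromZero_ext _ _)
  let ρ' := sqV.desc 0 (𝟙 S') (fromZero_ext _ _)
  have xρ : x ≫ ρ = 𝟙 S := sqV.inl_desc _ _ _
  have yρ : y ≫ ρ = 0 := sqV.inr_desc _ _ _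
  have xρ' : x ≫ ρ' = 0 := sqV.inl_desc _ _ _
  have yρ' : y ≫ ρ' = 𝟙 S' := sqV.inr_desc _ _ _
  have e₁ : (γ C).map (ρ ≫ t) + (γ C).map (ρ' ≫ t') =
      (γ C).map (sqV.desc t t' (fromZero_ext _ _)) := by
    apply γ_coprod_hom_ext sqV
    · rw [Preadditive.comp_add, ← Functor.map_comp, ← Functor.map_comp, ← Functor.map_comp,
        reassoc_of% xρ, reassoc_of% xρ', zero_comp, γ_map_zero, add_zero, sqV.inl_desc]
    · rw [Preadditive.comp_add, ← Functor.map_comp, ← Functor.map_comp, ← Functor.map_comp,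
        reassoc_of% yρ, reassoc_of% yρ', zero_comp, γ_map_zero, zero_add, sqV.inr_desc]
  have e₂ : d = φ ≫ ρ := sq.hom_ext
    (by rw [ud, sq.inl_desc_assoc, assoc, xρ, comp_id])
    (by rw [vd, sq.inr_desc_assoc, assoc, yρ, comp_zero])
  have e₃ : d' = φ ≫ ρ' := sq.hom_ext
    (by rw [ud', sq.inl_desc_assoc, assoc, xρ', comp_zero])
    (by rw [vd', sq.inr_desc_assoc, assoc, yρ', comp_id])
  have e₄ : φ ≫ sqV.desc t t' (fromZero_ext _ _) = k ≫ r := sq.hom_ext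
    (by rw [sq.inl_desc_assoc, assoc, sqV.inl_desc, ht])
    (by rw [sq.inr_desc_assoc, assoc, sqV.inr_desc, ht'])
  rw [e₂, e₃, assoc, assoc, (γ C).map_comp φ, (γ C).map_comp φ, ← Preadditive.comp_add, e₁,
    ← Functor.map_comp, e₄, γ_map_comp_eq_zero hK, zero_comp]

end Additive

end CofibrationCategory

/-! ### Shifts generated by an autoequivalence -/

namespace ShiftOfEquivalence

variable {T : Type u} [Category.{v} T]

/-- A sequence of objects `X n` for `n : ℤ` with isomorphisms `S (X n) ≅ X (n + 1)`. If `S` is an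
equivalence, such a sequence is determined by `X 0`, and shifting the sequences defines an action
of `ℤ` which is strictly associative up to equalities of indices. -/
structure SeqObj (S : T ⥤ T) where
  X : ℤ → T
  σ (n m : ℤ) (h : n + 1 = m) : S.obj (X n) ≅ X m

variable {S : T ⥤ T}

namespace SeqObj

/-- Morphisms of sequences. -/
@[ext]
structure Hom (A B : SeqObj S) where
  φ (n : ℤ) : A.X n ⟶ B.X n
  comm (n m : ℤ) (h : n + 1 = m) : S.map (φ n) ≫ (B.σ n m h).hom = (A.σ n m h).hom ≫ φ m

instance : Category (SeqObj S) where
  Hom := Hom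
  id A := { φ n := 𝟙 _, comm n m h := by simp }
  comp f g :=
    { φ n := f.φ n ≫ g.φ n
      comm n m h := by
        rw [Functor.map_comp, assoc, g.comm, ← assoc, f.comm, assoc] }

@[ext]
lemma hom_ext {A B : SeqObj S} {f g : A ⟶ B} (h : ∀ n, f.φ n = g.φ n) : f = g :=
  Hom.ext (funext h)

@[simp]
lemma id_φ (A : SeqObj S) (n : ℤ) : Hom.φ (𝟙 A) n = 𝟙 _ := rfl

@[simp]
lemma comp_φ {A B D : SeqObj S} (f : A ⟶ B) (g : B ⟶ D) (n : ℤ) :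
    (f ≫ g).φ n = f.φ n ≫ g.φ n := rfl

lemma eqToHom_φ {A B : SeqObj S} (h : A = B) (n : ℤ) :
    (eqToHom h).φ n = eqToHom (by rw [h]) := by
  subst h
  rfl

lemma σ_eqToHom (A : SeqObj S) {n m n' m' : ℤ} (h : n + 1 = m) (hn : n = n') (hm : m = m') :
    S.map (eqToHom (congrArg A.X hn)) ≫ (A.σ n' m' (by rw [← hn, h, hm])).hom =
      (A.σ n m h).hom ≫ eqToHom (congrArg A.X hm) := by
  subst hn hm
  simp

lemma φ_eqToHom {A B : SeqObj S} (f : A ⟶ B) {n n' : ℤ} (hn : n = n') :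
    f.φ n ≫ eqToHom (congrArg B.X hn) = eqToHom (congrArg A.X hn) ≫ f.φ n' := by
  subst hn
  simp

variable (S) in
/-- The shift of sequences. -/
@[simps]
def shift (a : ℤ) : SeqObj S ⥤ SeqObj S where
  obj A :=
    { X n := A.X (n + a)
      σ n m h := A.σ (n + a) (m + a) (by omega) }
  map f :=
    { φ n := f.φ (n + a)
      comm n m h := f.comm _ _ _ }

/-- Two sequences whose objects and structure isomorphisms agree up to equalities of objects are
isomorphic. -/
@[simps]
def isoOfEq (A B : SeqObj S) (e : ∀ n, A.X n = B.X n)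
    (he : ∀ (n m : ℤ) (h : n + 1 = m),
      S.map (eqToHom (e n)) ≫ (B.σ n m h).hom = (A.σ n m h).hom ≫ eqToHom (e m)) : A ≅ B where
  hom := { φ n := eqToHom (e n), comm := he }
  inv :=
    { φ n := eqToHom (e n).symm
      comm n m h := by
        rw [← cancel_mono (eqToHom (e m)), assoc, ← he, ← Functor.map_comp_assoc]
        simp }
  hom_inv_id := by
    apply hom_ext
    intro n
    exact eqToHom_trans (e n) (e n).symm
  inv_hom_id := by
    apply hom_ext
    intro n
    exact eqToHom_trans (e n).symm (e n)

lemma add_add_swap (n a b : ℤ) : n + (a + b) = n + b + a := by omega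

/-- Shifting by `0` does nothing. -/
noncomputable def shiftZero : shift S 0 ≅ 𝟭 _ :=
  NatIso.ofComponents (fun A => isoOfEq ((shift S 0).obj A) A (fun n => congrArg A.X (add_zero n))
    (fun _ _ h => A.σ_eqToHom (by rw [← h]; omega) (add_zero _) (add_zero _))) (fun f => by
      apply hom_ext
      intro n
      exact φ_eqToHom f (add_zero n))

/-- Shifts compose additively. -/
noncomputable def shiftAdd (a b : ℤ) : shift S (a + b) ≅ shift S a ⋙ shift S b :=
  NatIso.ofComponents (fun A => isoOfEq ((shift S (a + b)).obj A) ((shift S b).obj ((shift S a).obj A))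
    (fun n => congrArg A.X (add_add_swap n a b))
    (fun _ _ h => A.σ_eqToHom (by rw [← h]; omega) (add_add_swap _ a b) (add_add_swap _ a b)))
    (fun f => by
      apply hom_ext
      intro n
      exact φ_eqToHom f (add_add_swap n a b))

lemma shiftZero_inv_app_φ (A : SeqObj S) (n : ℤ) :
    Hom.φ (shiftZero.inv.app A) n = eqToHom (congrArg A.X (add_zero n).symm) := by
  simp only [shiftZero, NatIso.ofComponents_inv_app]
  exact isoOfEq_inv_φ _ _ _ _ _

lemma shiftAdd_hom_app_φ (a b : ℤ) (A : SeqObj S) (n : ℤ) :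
    Hom.φ ((shiftAdd a b).hom.app A) n = eqToHom (congrArg A.X (add_add_swap n a b)) := by
  simp only [shiftAdd, NatIso.ofComponents_hom_app]
  exact isoOfEq_hom_φ _ _ _ _ _

lemma eqToHom_trans₃ {X Y Y' Z W : T} (h₁ : X = Y) (h₂ : Y = W) (h₃ : X = Y') (h₄ : Y' = Z)
    (h₅ : Z = W) : eqToHom h₁ ≫ eqToHom h₂ = eqToHom h₃ ≫ eqToHom h₄ ≫ eqToHom h₅ := by
  subst h₁ h₂ h₃ h₄
  simp

/-- The action of `ℤ` on sequences. -/
noncomputable instance : HasShift (SeqObj S) ℤ := hasShiftMk _ _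
  { F := shift S
    zero := shiftZero
    add := shiftAdd
    assoc_hom_app a b c A := by
      apply hom_ext
      intro n
      simp only [comp_φ, eqToHom_φ, shiftAdd_hom_app_φ, shift_map_φ]
      exact eqToHom_trans₃ _ _ _ _ _
    zero_add_hom_app a A := by
      apply hom_ext
      intro n
      simp only [comp_φ, eqToHom_φ, shiftAdd_hom_app_φ, shiftZero_inv_app_φ, shift_map_φ]
      exact (eqToHom_trans _ _).symm
    add_zero_hom_app a A := by
      apply hom_ext
      intro n
      simp only [comp_φ, eqToHom_φ, shiftAdd_hom_app_φ, shiftZero_inv_app_φ]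
      exact (eqToHom_trans _ _).symm }

variable (S) in
/-- The evaluation of sequences at `0`. -/
@[simps]
def eval : SeqObj S ⥤ T where
  obj A := A.X 0
  map f := f.φ 0

variable [S.IsEquivalence]

instance : (eval S).Faithful where
  map_injective {A B f g} h := by
    ext n
    induction n using Int.induction_on with
    | zero => exact h
    | succ n hn => rw [← cancel_epi (A.σ _ _ rfl).hom, ← f.comm _ _ rfl, ← g.comm _ _ rfl, hn]
    | pred n hn =>
      apply S.map_injective
      rw [← cancel_mono (B.σ _ (-n) (by ring)).hom, f.comm, g.comm, hn]

/-- The extension of a morphism in degree `0` to nonnegative degrees. -/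
def extendNat {A B : SeqObj S} (f : A.X 0 ⟶ B.X 0) : ∀ n : ℕ, A.X (Int.ofNat n) ⟶ B.X (Int.ofNat n)
  | 0 => f
  | n + 1 => (A.σ (Int.ofNat n) (Int.ofNat (n + 1)) rfl).inv ≫ S.map (extendNat f n) ≫
      (B.σ (Int.ofNat n) (Int.ofNat (n + 1)) rfl).hom

/-- The extension of a morphism in degree `0` to negative degrees. -/
noncomputable def extendNeg {A B : SeqObj S} (f : A.X 0 ⟶ B.X 0) :
    ∀ n : ℕ, A.X (Int.negSucc n) ⟶ B.X (Int.negSucc n)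
  | 0 => S.preimage ((A.σ (Int.negSucc 0) 0 rfl).hom ≫ f ≫ (B.σ (Int.negSucc 0) 0 rfl).inv)
  | n + 1 => S.preimage ((A.σ (Int.negSucc (n + 1)) (Int.negSucc n) rfl).hom ≫ extendNeg f n ≫
      (B.σ (Int.negSucc (n + 1)) (Int.negSucc n) rfl).inv)

lemma map_preimage_conj_comp {X Y : T} {X' Y' : T} (e : S.obj X ≅ X') (e' : S.obj Y ≅ Y')
    (f : X' ⟶ Y') : S.map (S.preimage (e.hom ≫ f ≫ e'.inv)) ≫ e'.hom = e.hom ≫ f := by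
  simp

instance : (eval S).Full where
  map_surjective {A B} f := by
    refine ⟨{ φ := Int.rec (extendNat f) (extendNeg f), comm := ?_ }, rfl⟩
    rintro (n | _ | n) m rfl
    · exact (by simp : S.map (extendNat f n) ≫ (B.σ (Int.ofNat n) _ rfl).hom =
        (A.σ (Int.ofNat n) _ rfl).hom ≫ (A.σ (Int.ofNat n) _ rfl).inv ≫ S.map (extendNat f n) ≫
          (B.σ (Int.ofNat n) _ rfl).hom)
    · exact map_preimage_conj_comp (A.σ (Int.negSucc 0) 0 rfl) (B.σ (Int.negSucc 0) 0 rfl) f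
    · exact map_preimage_conj_comp (A.σ (Int.negSucc (n + 1)) (Int.negSucc n) rfl)
        (B.σ (Int.negSucc (n + 1)) (Int.negSucc n) rfl) (extendNeg f n)

/-- The positive part of the sequence generated by an object. -/
def natSeq (S : T ⥤ T) (A : T) : ℕ → T
  | 0 => A
  | n + 1 => S.obj (natSeq S A n)

/-- The negative part of the sequence generated by an object. -/
noncomputable def negSeq (S : T ⥤ T) [S.IsEquivalence] (A : T) : ℕ → T
  | 0 => S.objPreimage A
  | n + 1 => S.objPreimage (negSeq S A n)

/-- The sequence generated by an object. -/
noncomputable def seq (S : T ⥤ T) [S.IsEquivalence] (A : T) : ℤ → T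
  | Int.ofNat n => natSeq S A n
  | Int.negSucc n => negSeq S A n

/-- The structure isomorphisms of the sequence generated by an object. -/
noncomputable def seqIso (S : T ⥤ T) [S.IsEquivalence] (A : T) :
    ∀ n : ℤ, S.obj (seq S A n) ≅ seq S A (n + 1)
  | Int.ofNat n => Iso.refl (S.obj (natSeq S A n))
  | Int.negSucc 0 => S.objObjPreimageIso A
  | Int.negSucc (n + 1) => S.objObjPreimageIso (negSeq S A n)

instance : (eval S).EssSurj where
  mem_essImage A := ⟨⟨seq S A, fun n _ h => seqIso S A n ≪≫ eqToIso (congrArg _ h)⟩,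
    ⟨Iso.refl A⟩⟩

instance : (eval S).IsEquivalence where

end SeqObj

open SeqObj

variable (S) [S.IsEquivalence]

/-- The shift functors defined by an autoequivalence. -/
noncomputable def shiftFun (a : ℤ) : T ⥤ T := (eval S).inv ⋙ shiftFunctor (SeqObj S) a ⋙ eval S

/-- The evaluation commutes with shifts. -/
noncomputable def evalShiftIso (a : ℤ) :
    eval S ⋙ shiftFun S a ≅ shiftFunctor (SeqObj S) a ⋙ eval S :=
  (Functor.associator _ _ _).symm ≪≫ Functor.isoWhiskerRight (eval S).asEquivalence.unitIso.symm
    (shiftFunctor (SeqObj S) a ⋙ eval S) ≪≫ Functor.leftUnitor _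

/-- The action of `ℤ` on a category by the powers of an autoequivalence. -/
@[reducible]
noncomputable def hasShift : HasShift T ℤ :=
  HasShift.induced (eval S) ℤ (shiftFun S) (evalShiftIso S)

/-- On sequences, the shift by `1` is the given autoequivalence. -/
noncomputable def evalShiftOneIso : shift S 1 ⋙ eval S ≅ eval S ⋙ S :=
  NatIso.ofComponents (fun A => (A.σ 0 (0 + 1) rfl).symm : ∀ A : SeqObj S, A.X (0 + 1) ≅ S.obj (A.X 0))
    (fun {A B} f => by
      change f.φ (0 + 1) ≫ (B.σ 0 (0 + 1) rfl).inv = (A.σ 0 (0 + 1) rfl).inv ≫ S.map (f.φ 0)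
      rw [Iso.eq_inv_comp, ← assoc, ← f.comm, assoc, Iso.hom_inv_id, comp_id])

/-- The shift by `1` is the given autoequivalence. -/
noncomputable def shiftOneIso : letI := hasShift S; shiftFunctor T (1 : ℤ) ≅ S :=
  Functor.isoWhiskerLeft (eval S).inv (evalShiftOneIso S) ≪≫ (Functor.associator _ _ _).symm ≪≫
    Functor.isoWhiskerRight (eval S).asEquivalence.counitIso S ≪≫ S.leftUnitor

end ShiftOfEquivalence

/-! ### Morphisms between elementary triangles -/

namespace CofibrationCategory

variable {C : Type u} [Category.{v} C] [CofibrationCategory C] [HasZeroObject C]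

/-- The mapping cylinder of `f : X ⟶ Y` is obtained from a cylinder `I` of `X` by a pushout along
`f ⊔ 𝟙 : X ⊔ X ⟶ Y ⊔ X`. -/
lemma isPushout_mappingCylinder {X Y I V : C} (k : pushout (fromZero X) (fromZero X) ⟶ I)
    (f : X ⟶ Y) {x : Y ⟶ V} {y : X ⟶ V} (sqV : IsPushout (fromZero Y) (fromZero X) x y) {N : C}
    {m : I ⟶ N} {n : Y ⟶ N}
    (sqN : IsPushout (pushout.inl (fromZero X) (fromZero X) ≫ k) f m n) :
    IsPushout (pushout.desc (f := fromZero X) (g := fromZero X) (f ≫ x) y (fromZero_ext _ _)) k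
      (sqV.desc n (pushout.inr _ _ ≫ k ≫ m) (fromZero_ext _ _)) m := by
  have φ₀ := pushout.inl_desc (f := fromZero X) (g := fromZero X) (f ≫ x) y (fromZero_ext _ _)
  have φ₁ := pushout.inr_desc (f := fromZero X) (g := fromZero X) (f ≫ x) y (fromZero_ext _ _)
  set φ := pushout.desc (f := fromZero X) (g := fromZero X) (f ≫ x) y (fromZero_ext _ _)
  have sq₀ : IsPushout f (pushout.inl (fromZero X) (fromZero X)) x φ := by
    refine (IsPushout.of_top (h₁₁ := fromZero X) (v₁₁ := fromZero X) (v₁₂ := pushout.inr _ _) ?_ φ₀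
      (IsPushout.of_hasPushout _ _).flip).flip
    rw [φ₁, fromZero_ext (fromZero X ≫ f) (fromZero Y)]
    exact sqV.flip
  refine IsPushout.of_top (h₁₁ := f) (v₁₁ := pushout.inl (fromZero X) (fromZero X)) (v₁₂ := x)
    (by rw [sqV.inl_desc]; exact sqN.flip) ?_ sq₀
  apply pushout.hom_ext
  · rw [reassoc_of% φ₀, sqV.inl_desc]
    exact sqN.w.symm.trans (assoc _ _ _)
  · rw [reassoc_of% φ₁, sqV.inr_desc]

namespace IsCofiber

lemma weakEquivalence_of_under {X Y Z Y' Z' : C} {f : X ⟶ Y} {p : Y ⟶ Z} (h : IsCofiber f p)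
    {f' : X ⟶ Y'} {p' : Y' ⟶ Z'} (h' : IsCofiber f' p') (b : Y ⟶ Y') [WeakEquivalence b]
    (c : Z ⟶ Z') (w₁ : f ≫ b = f') (w₂ : p ≫ c = b ≫ p') : WeakEquivalence c := by
  have := h.cofibration
  have := h'.cofibration
  exact weakEquivalence_of_isPushout_of_isPushout h.isPushout h'.isPushout b w₁ c w₂
    (fromZero_ext _ _)

variable [ChosenCones C]

/-- The morphisms `a` and `b` extend to a morphism between the elementary triangles of two
cofibrations. -/
def Extends {X Y Z X' Y' Z' : C} {f : X ⟶ Y} {p : Y ⟶ Z} (h : IsCofiber f p) {f' : X' ⟶ Y'}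
    {p' : Y' ⟶ Z'} (h' : IsCofiber f' p') (a : (γ C).obj X ⟶ (γ C).obj X')
    (b : (γ C).obj Y ⟶ (γ C).obj Y') : Prop :=
  ∃ c : (γ C).obj Z ⟶ (γ C).obj Z',
    (γ C).map p ≫ c = b ≫ (γ C).map p' ∧ h.δ ≫ (suspension C).map a = c ≫ h'.δ

section

variable {X Y Z X' Y' Z' : C} {f : X ⟶ Y} {p : Y ⟶ Z} (h : IsCofiber f p) {f' : X' ⟶ Y'}
  {p' : Y' ⟶ Z'} (h' : IsCofiber f' p')

lemma extends_map (a : X ⟶ X') (b : Y ⟶ Y') (w : f ≫ b = a ≫ f') :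
    h.Extends h' ((γ C).map a) ((γ C).map b) := by
  obtain ⟨c, hc⟩ := h.exists_desc (b ≫ p') (by rw [reassoc_of% w, h'.w, comp_zero])
  exact ⟨(γ C).map c, by rw [← Functor.map_comp, hc, Functor.map_comp],
    h.δ_natural h' a b c w hc⟩

lemma extends_inv_map (a : X ⟶ X') (b : Y ⟶ Y') (c : Z ⟶ Z') [WeakEquivalence a]
    [WeakEquivalence b] [WeakEquivalence c] (w₁ : f ≫ b = a ≫ f') (w₂ : p ≫ c = b ≫ p') :
    h'.Extends h (inv ((γ C).map a)) (inv ((γ C).map b)) := by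
  refine ⟨inv ((γ C).map c), ?_, ?_⟩
  · rw [IsIso.comp_inv_eq, assoc, IsIso.eq_inv_comp, ← Functor.map_comp, ← Functor.map_comp, w₂]
  · rw [Functor.map_inv, IsIso.comp_inv_eq, assoc, IsIso.eq_inv_comp, h.δ_natural h' a b c w₁ w₂]

lemma extends_inv_map_id {Y₁ Z₁ : C} {f₁ : X ⟶ Y₁} {p₁ : Y₁ ⟶ Z₁} (h₁ : IsCofiber f₁ p₁)
    (b : Y ⟶ Y₁) (c : Z ⟶ Z₁) [WeakEquivalence b] [WeakEquivalence c] (w₁ : f ≫ b = f₁)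
    (w₂ : p ≫ c = b ≫ p₁) : h₁.Extends h (𝟙 _) (inv ((γ C).map b)) := by
  have := h.extends_inv_map h₁ (𝟙 X) b c (by rw [w₁, id_comp]) w₂
  have e : inv ((γ C).map (𝟙 X)) = 𝟙 _ := by
    rw [← cancel_mono ((γ C).map (𝟙 X)), IsIso.inv_hom_id, CategoryTheory.Functor.map_id, id_comp]
  rwa [e] at this

variable {h h'} in
lemma Extends.comp {X'' Y'' Z'' : C} {f'' : X'' ⟶ Y''} {p'' : Y'' ⟶ Z''} {h'' : IsCofiber f'' p''}
    {a : (γ C).obj X ⟶ (γ C).obj X'} {b : (γ C).obj Y ⟶ (γ C).obj Y'}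
    {a' : (γ C).obj X' ⟶ (γ C).obj X''} {b' : (γ C).obj Y' ⟶ (γ C).obj Y''}
    (H : h.Extends h' a b) (H' : h'.Extends h'' a' b') : h.Extends h'' (a ≫ a') (b ≫ b') := by
  obtain ⟨c, h₁, h₂⟩ := H
  obtain ⟨c', h₁', h₂'⟩ := H'
  exact ⟨c ≫ c', by rw [reassoc_of% h₁, h₁', assoc], by
    rw [Functor.map_comp, reassoc_of% h₂, h₂', assoc]⟩

/-- A square of morphisms of `C` which commutes up to homotopy can be made strictly commutative
with the help of a mapping cylinder of `f`. -/
lemma extends_of_homotopic (a : X ⟶ X') (b : Y ⟶ Y') (w : Homotopic (f ≫ b) (a ≫ f')) :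
    h.Extends h' ((γ C).map a) ((γ C).map b) := by
  have cf := h.cofibration
  have cf' := h'.cofibration
  obtain ⟨I, k, q, T, s, H, ck, c₀, c₁, w₀, w₁, wq, cs, ws, q₀, q₁, H₀, H₁⟩ := w.exists_cylinder
  have cl := cofibration_inl (fromZero X) (fromZero X)
  set j₀ := pushout.inl (fromZero X) (fromZero X)
  set j₁ := pushout.inr (fromZero X) (fromZero X)
  -- the mapping cylinder `N` of `f`
  have sqN := IsPushout.of_hasPushout (j₀ ≫ k) f
  set n : Y ⟶ pushout (j₀ ≫ k) f := pushout.inr _ _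
  set m : I ⟶ pushout (j₀ ≫ k) f := pushout.inl _ _
  have wn : WeakEquivalence n := inferInstance
  let r : pushout (j₀ ≫ k) f ⟶ Y := pushout.desc (q ≫ f) (𝟙 Y) (by
    rw [← assoc, q₀, id_comp, comp_id])
  have hr : n ≫ r = 𝟙 Y := pushout.inr_desc _ _ _
  have hr' : m ≫ r = q ≫ f := pushout.inl_desc _ _ _
  have wr : WeakEquivalence r := we_of_precomp n r wn (by rw [hr]; infer_instance)
  let H' : pushout (j₀ ≫ k) f ⟶ T := pushout.desc H (b ≫ s) (by rw [H₀, assoc])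
  have hH' : n ≫ H' = b ≫ s := pushout.inr_desc _ _ _
  -- the other end of the cylinder is a cofibration to `N`
  have cm : Cofibration (j₁ ≫ k ≫ m) := by
    have sqV := IsPushout.of_hasPushout (fromZero Y) (fromZero X)
    have ce := cofibration_of_isPushout (isPushout_mappingCylinder k f sqV sqN).flip
    rw [← sqV.inr_desc n (j₁ ≫ k ≫ m) (fromZero_ext _ _)]
    infer_instance
  have e₁ : (j₁ ≫ k ≫ m) ≫ H' = a ≫ f' ≫ s := by
    rw [assoc, assoc, pushout.inl_desc, ← assoc, H₁, assoc]
  have e₂ : (j₁ ≫ k ≫ m) ≫ r = f := by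
    rw [assoc, assoc, hr', ← assoc, ← assoc, q₁, id_comp]
  have hN := isCofiber_quotπ (j₁ ≫ k ≫ m)
  have hT := isCofiber_quotπ (f' ≫ s)
  obtain ⟨c, hc⟩ := hN.exists_desc (r ≫ p) (by rw [← assoc, e₂, h.w])
  have wc := hN.weakEquivalence_of_under h r c e₂ hc
  obtain ⟨c', hc'⟩ := h'.exists_desc (s ≫ quotπ (f' ≫ s)) (by rw [← assoc, hT.w])
  have wc' := h'.weakEquivalence_of_under hT s c' rfl hc'
  have h₁ := hN.extends_inv_map_id h r c e₂ hc
  have h₂ := hN.extends_map hT a H' e₁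
  have h₃ := h'.extends_inv_map_id hT s c' rfl hc'
  have := (h₁.comp h₂).comp h₃
  have e₃ : inv ((γ C).map r) = (γ C).map n := by
    rw [← cancel_mono ((γ C).map r), IsIso.inv_hom_id, ← Functor.map_comp, hr,
      CategoryTheory.Functor.map_id]
  rw [e₃, ← Functor.map_comp, hH', Functor.map_comp, id_comp, comp_id, assoc,
    IsIso.hom_inv_id, comp_id] at this
  exact this

/-- Any morphism between the first morphisms of elementary triangles extends to a morphism of
triangles. -/
lemma extends_of_comm (a : (γ C).obj X ⟶ (γ C).obj X') (b : (γ C).obj Y ⟶ (γ C).obj Y')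
    (w : (γ C).map f ≫ b = a ≫ (γ C).map f') : h.Extends h' a b := by
  have cf := h.cofibration
  have cf' := h'.cofibration
  obtain ⟨X'', a₀, s, cs, ws, rfl⟩ := exists_fraction a
  -- replacement of `f'` by its cobase change along `s`
  let f'' : X'' ⟶ pushout f' s := pushout.inr f' s
  let t : Y' ⟶ pushout f' s := pushout.inl f' s
  have wt : WeakEquivalence t := weakEquivalence_inl f' s
  have sq : IsPushout f' s t f'' := IsPushout.of_hasPushout _ _
  let q : pushout f' s ⟶ Z' := sq.desc p' 0 (by rw [h'.w, comp_zero])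
  have hq : t ≫ q = p' := sq.inl_desc _ _ _
  have h'' : IsCofiber f'' q := h'.of_isPushout sq hq (sq.inr_desc _ _ _)
  have E := h'.extends_inv_map h'' s t (𝟙 Z') sq.w (by rw [hq, comp_id])
  obtain ⟨Y'', b₀, r, cr, wr, hb⟩ := exists_fraction (b ≫ (γ C).map t)
  have hr := isCofiber_quotπ (f'' ≫ r)
  obtain ⟨c, hc⟩ := h''.exists_desc (r ≫ quotπ (f'' ≫ r)) (by rw [← assoc, hr.w])
  have wc := h''.weakEquivalence_of_under hr r c rfl hc
  have E' := h''.extends_inv_map_id hr r c rfl hc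
  have w' : (γ C).map (f ≫ b₀) = (γ C).map (a₀ ≫ f'' ≫ r) := by
    have e : (γ C).map b₀ = b ≫ (γ C).map t ≫ (γ C).map r := by
      rw [← assoc, hb, assoc, IsIso.inv_hom_id, comp_id]
    rw [Functor.map_comp, e, reassoc_of% w, ← Functor.map_comp_assoc, sq.w,
      Functor.map_comp_assoc, IsIso.inv_hom_id_assoc, Functor.map_comp, Functor.map_comp]
  have := ((h.extends_of_homotopic hr a₀ b₀ (homotopic_of_γ_map_eq w')).comp E').comp E
  rwa [← hb, assoc b, IsIso.hom_inv_id, comp_id, comp_id] at this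

end

end IsCofiber

end CofibrationCategory

/-! ### The axioms of triangulated categories -/

namespace CofibrationCategory

variable {C : Type u} [Category.{v} C] [CofibrationCategory C] [HasZeroObject C]
  [ChosenCones C]

/-- The connecting morphism of a cone sequence is, up to sign, the identification with the
suspension. -/
lemma IsConeSeq.δ_eq_neg_σ [Preadditive (Ho C)] {X A S : C} {i : X ⟶ A} {s : A ⟶ S}
    (h : IsConeSeq i s) : h.isCofiber.δ = -h.σ := by
  have := h.isCofiber.cofibration
  have sq := IsPushout.of_hasPushout i i
  let c : pushout i i ⟶ S := sq.desc 0 s (by rw [h.isCofiber.w, comp_zero])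
  let d : pushout i i ⟶ S := sq.desc s 0 (by rw [h.isCofiber.w, comp_zero])
  have uc : pushout.inl i i ≫ c = 0 := sq.inl_desc _ _ _
  have vc : pushout.inr i i ≫ c = s := sq.inr_desc _ _ _
  have ud : pushout.inl i i ≫ d = s := sq.inl_desc _ _ _
  have vd : pushout.inr i i ≫ d = 0 := sq.inr_desc _ _ _
  have wc : WeakEquivalence c :=
    (h.isCofiber.of_isPushout sq.flip vc uc).weakEquivalence h.contractible
  have e := γ_collapse_add_eq_zero h h sq ud vd uc vc
  rw [← cancel_epi ((γ C).map c), h.isCofiber.δ_eq h sq uc vc ud vd, Preadditive.comp_neg,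
    eq_neg_iff_add_eq_zero, e]

lemma IsConeSeq.isIso_δ [Preadditive (Ho C)] {X A S : C} {i : X ⟶ A} {s : A ⟶ S}
    (h : IsConeSeq i s) : IsIso h.isCofiber.δ := by
  rw [h.δ_eq_neg_σ]
  exact ⟨-inv h.σ, by simp, by simp⟩

/-- A sequence `A ⟶ B ⟶ D ⟶ ΣA` in the homotopy category is exact if it is isomorphic to the
elementary exact triangle of a cofibration. -/
def IsExact {A B D : Ho C} (f : A ⟶ B) (g : B ⟶ D) (h : D ⟶ (suspension C).obj A) : Prop :=
  ∃ (X Y Z : C) (i : X ⟶ Y) (p : Y ⟶ Z) (H : IsCofiber i p) (a : A ≅ (γ C).obj X)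
    (b : B ≅ (γ C).obj Y) (c : D ≅ (γ C).obj Z), f ≫ b.hom = a.hom ≫ (γ C).map i ∧
      g ≫ c.hom = b.hom ≫ (γ C).map p ∧ h ≫ (suspension C).map a.hom = c.hom ≫ H.δ

lemma IsCofiber.isExact {X Y Z : C} {f : X ⟶ Y} {p : Y ⟶ Z} (h : IsCofiber f p) :
    IsExact ((γ C).map f) ((γ C).map p) h.δ :=
  ⟨X, Y, Z, f, p, h, Iso.refl _, Iso.refl _, Iso.refl _, by simp, by simp, by simp⟩

namespace IsExact

section

variable {A B D A' B' D' : Ho C} {f : A ⟶ B} {g : B ⟶ D} {h : D ⟶ (suspension C).obj A}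
  {f' : A' ⟶ B'} {g' : B' ⟶ D'} {h' : D' ⟶ (suspension C).obj A'}

lemma of_iso (H : IsExact f' g' h') (a : A ≅ A') (b : B ≅ B') (c : D ≅ D')
    (h₁ : f ≫ b.hom = a.hom ≫ f') (h₂ : g ≫ c.hom = b.hom ≫ g')
    (h₃ : h ≫ (suspension C).map a.hom = c.hom ≫ h') : IsExact f g h := by
  obtain ⟨X, Y, Z, i, p, H, a', b', c', h₁', h₂', h₃'⟩ := H
  exact ⟨X, Y, Z, i, p, H, a ≪≫ a', b ≪≫ b', c ≪≫ c',
    by rw [Iso.trans_hom, reassoc_of% h₁, h₁', Iso.trans_hom, assoc],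
    by rw [Iso.trans_hom, reassoc_of% h₂, h₂', Iso.trans_hom, assoc],
    by rw [Iso.trans_hom, Functor.map_comp, reassoc_of% h₃, h₃', Iso.trans_hom, assoc]⟩

lemma exists_hom (H : IsExact f g h) (H' : IsExact f' g' h') (α : A ⟶ A') (β : B ⟶ B')
    (w : f ≫ β = α ≫ f') :
    ∃ χ : D ⟶ D', g ≫ χ = β ≫ g' ∧ h ≫ (suspension C).map α = χ ≫ h' := by
  obtain ⟨X, Y, Z, i, p, H, a, b, c, h₁, h₂, h₃⟩ := H
  obtain ⟨X', Y', Z', i', p', H', a', b', c', h₁', h₂', h₃'⟩ := H'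
  obtain ⟨χ, e₁, e₂⟩ := H.extends_of_comm H' (a.inv ≫ α ≫ a'.hom) (b.inv ≫ β ≫ b'.hom) (by
    rw [assoc, assoc, ← h₁', ← reassoc_of% w, Iso.eq_inv_comp, ← reassoc_of% h₁,
      Iso.hom_inv_id_assoc])
  refine ⟨c.hom ≫ χ ≫ c'.inv, ?_, ?_⟩
  · rw [reassoc_of% h₂, reassoc_of% e₁, Iso.hom_inv_id_assoc, ← reassoc_of% h₂', Iso.hom_inv_id,
      comp_id]
  · rw [assoc, assoc, ← cancel_mono ((suspension C).map a'.hom), assoc, assoc, assoc, assoc, h₃',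
      Iso.inv_hom_id_assoc, ← e₂, ← reassoc_of% h₃, ← Functor.map_comp, ← Functor.map_comp,
      Iso.hom_inv_id_assoc]

end

lemma id_zero (A : Ho C) [HasZeroMorphisms (Ho C)] {D : Ho C} (hD : IsZero D) :
    IsExact (𝟙 A) (0 : A ⟶ D) 0 := by
  obtain ⟨X, rfl⟩ := exists_eq_γ_obj A
  have h : IsCofiber (𝟙 X) (toZero X) := ⟨inferInstance, by
    rw [fromZero_ext (fromZero (0 : C)) (𝟙 0)]
    exact IsPushout.of_horiz_isIso ⟨by rw [id_comp, comp_id]⟩⟩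
  exact h.isExact.of_iso (Iso.refl _) (Iso.refl _) (hD.iso isZero_γ_zero) (by simp)
    (isZero_γ_zero.eq_of_tgt _ _) (hD.eq_of_src _ _)

lemma exists_of_hom {A B : Ho C} (φ : A ⟶ B) :
    ∃ (D : Ho C) (g : B ⟶ D) (h : D ⟶ (suspension C).obj A), IsExact φ g h := by
  obtain ⟨X, rfl⟩ := exists_eq_γ_obj A
  obtain ⟨Y, rfl⟩ := exists_eq_γ_obj B
  obtain ⟨Y', f, s, cs, ws, rfl⟩ := exists_fraction φ
  obtain ⟨M, j, w, cj, hw, rfl⟩ := exists_factorization f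
  have h := isCofiber_quotπ j
  exact ⟨_, ((γ C).map s ≫ inv ((γ C).map w)) ≫ (γ C).map (quotπ j), h.δ,
    h.isExact.of_iso (Iso.refl _) (asIso ((γ C).map s ≫ inv ((γ C).map w))) (Iso.refl _)
      (by simp) (by simp) (by simp)⟩

section

variable [Preadditive (Ho C)] {A B D A' B' D' : Ho C} {f : A ⟶ B} {g : B ⟶ D}
  {h : D ⟶ (suspension C).obj A} {f' : A' ⟶ B'} {g' : B' ⟶ D'} {h' : D' ⟶ (suspension C).obj A'}

lemma rotate (H : IsExact f g h) : IsExact g h (-(suspension C).map f) := by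
  obtain ⟨X, Y, Z, i, p, H, a, b, c, h₁, h₂, h₃⟩ := H
  have ci := H.cofibration
  have hA := isConeSeq_cone X
  have sq := IsPushout.of_hasPushout (cone X).ι i
  set j := (cone X).ι
  let r : pushout j i ⟶ Z := sq.desc 0 p (by rw [H.w, comp_zero])
  let d : pushout j i ⟶ quot j := sq.desc (quotπ j) 0 (by rw [hA.isCofiber.w, comp_zero])
  have ur : pushout.inl j i ≫ r = 0 := sq.inl_desc _ _ _
  have vr : pushout.inr j i ≫ r = p := sq.inr_desc _ _ _
  have ud : pushout.inl j i ≫ d = quotπ j := sq.inl_desc _ _ _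
  have vd : pushout.inr j i ≫ d = 0 := sq.inr_desc _ _ _
  have wr : WeakEquivalence r :=
    (H.of_isPushout sq.flip vr ur).weakEquivalence hA.contractible
  have hD : IsCofiber (pushout.inr j i) d := hA.isCofiber.of_isPushout sq ud vd
  have e₁ := H.δ_eq hA sq ur vr ud vd
  have e₂ := hA.isCofiber.δ_natural hD i (pushout.inl j i) (𝟙 _) sq.w (by rw [comp_id, ud])
  rw [CategoryTheory.Functor.map_id, id_comp, hA.δ_eq_neg_σ] at e₂
  refine hD.isExact.of_iso b (c ≪≫ (asIso ((γ C).map r)).symm)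
    ((suspension C).mapIso a ≪≫ (asIso hA.σ).symm) ?_ ?_ ?_
  · rw [Iso.trans_hom, reassoc_of% h₂, Iso.symm_hom, asIso_inv]
    congr 1
    rw [IsIso.comp_inv_eq, ← vr, Functor.map_comp]
  · simp only [Iso.trans_hom, Functor.mapIso_hom, Iso.symm_hom, asIso_inv, assoc]
    rw [reassoc_of% h₃]
    congr 1
    rw [IsIso.comp_inv_eq, assoc, IsIso.eq_inv_comp, e₁]
  · simp only [Iso.trans_hom, Functor.mapIso_hom, Iso.symm_hom, asIso_inv, assoc]
    rw [← e₂, Preadditive.neg_comp, Preadditive.neg_comp, Preadditive.comp_neg,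
      IsIso.inv_hom_id_assoc, Preadditive.comp_neg, ← Functor.map_comp, ← Functor.map_comp, h₁]

/-- Morphisms out of the second object of an exact sequence which vanish on the first one factor
through the third one. -/
lemma exists_desc (H : IsExact f g h) {E : Ho C} (φ : B ⟶ E) (hφ : f ≫ φ = 0) :
    ∃ ψ : D ⟶ E, φ = g ≫ ψ := by
  obtain ⟨X, rfl⟩ := exists_eq_γ_obj E
  have h₀ : IsCofiber (fromZero X) (𝟙 X) := ⟨inferInstance, by
    rw [(isZero_zero C).eq_of_tgt (toZero 0) (𝟙 0)]
    exact IsPushout.of_vert_isIso ⟨by rw [id_comp, comp_id]⟩⟩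
  obtain ⟨c, hc, -⟩ := H.exists_hom h₀.isExact 0 φ (by rw [hφ, zero_comp])
  exact ⟨c, by rw [hc, CategoryTheory.Functor.map_id, comp_id]⟩

lemma comp_eq_zero (H : IsExact f g h) : f ≫ g = 0 := by
  obtain ⟨X, Y, Z, i, p, H, a, b, c, h₁, h₂, h₃⟩ := H
  rw [← cancel_mono c.hom, assoc, h₂, reassoc_of% h₁, ← Functor.map_comp, H.w, γ_map_zero,
    comp_zero, zero_comp]

/-- The five lemma for exact sequences. -/
lemma isIso_of_isIso (H : IsExact f g h) (H' : IsExact f' g' h') (α : A ⟶ A') (β : B ⟶ B')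
    (χ : D ⟶ D') (w₁ : f ≫ β = α ≫ f') (w₂ : g ≫ χ = β ≫ g')
    (w₃ : h ≫ (suspension C).map α = χ ≫ h') [IsIso α] [IsIso β] : IsIso χ := by
  have inj : ∀ {E : Ho C} (ψ : D' ⟶ E), χ ≫ ψ = 0 → ψ = 0 := by
    intro E ψ hψ
    obtain ⟨ω, rfl⟩ := H'.rotate.exists_desc ψ (by
      rw [← cancel_epi β, ← reassoc_of% w₂, hψ, comp_zero, comp_zero])
    obtain ⟨ξ, hξ⟩ := H.rotate.rotate.exists_desc ((suspension C).map α ≫ ω) (by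
      rw [reassoc_of% w₃, hψ])
    have h₁ : ω = (-(suspension C).map f') ≫ inv ((suspension C).map β) ≫ ξ := by
      rw [← cancel_epi ((suspension C).map α), hξ, Preadditive.neg_comp, Preadditive.neg_comp,
        Preadditive.comp_neg, ← Functor.map_comp_assoc, ← w₁, Functor.map_comp_assoc,
        IsIso.hom_inv_id_assoc]
    rw [h₁, ← assoc, H'.rotate.rotate.comp_eq_zero, zero_comp]
  have surj : ∀ {E : Ho C} (ψ : D ⟶ E), ∃ ψ' : D' ⟶ E, χ ≫ ψ' = ψ := by
    intro E ψ
    obtain ⟨ψ₁, h₁⟩ := H'.exists_desc (inv β ≫ g ≫ ψ) (by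
      rw [← cancel_epi α, ← reassoc_of% w₁, IsIso.hom_inv_id_assoc, ← assoc,
        H.comp_eq_zero, zero_comp, comp_zero])
    rw [IsIso.inv_comp_eq] at h₁
    obtain ⟨ω, hω⟩ := H.rotate.exists_desc (ψ - χ ≫ ψ₁) (by
      rw [Preadditive.comp_sub, h₁, reassoc_of% w₂, sub_self])
    refine ⟨ψ₁ + h' ≫ inv ((suspension C).map α) ≫ ω, ?_⟩
    rw [Preadditive.comp_add, ← reassoc_of% w₃, IsIso.hom_inv_id_assoc, ← hω, add_sub_cancel]
  obtain ⟨ψ, hψ⟩ := surj (𝟙 _)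
  refine ⟨ψ, hψ, ?_⟩
  rw [← sub_eq_zero]
  apply inj
  rw [Preadditive.comp_sub, reassoc_of% hψ, comp_id, sub_self]

/-- A triangle on `f` exists. Three rotations of it and two further rotations of the given rotated
triangle are isomorphic by an isomorphism of the form `Σ c`, and `Σ` is fully faithful. -/
lemma of_rotate [IsStable C] [(suspension C).Additive] (H : IsExact g h (-(suspension C).map f)) :
    IsExact f g h := by
  obtain ⟨D', g', h', H'⟩ := exists_of_hom f
  obtain ⟨c, hc, hc'⟩ := H'.rotate.rotate.rotate.exists_hom H.rotate.rotate (𝟙 _) (𝟙 _)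
    (by rw [id_comp, comp_id])
  have ic := H'.rotate.rotate.rotate.isIso_of_isIso H.rotate.rotate (𝟙 _) (𝟙 _) c
    (by rw [id_comp, comp_id]) hc hc'
  obtain ⟨c, rfl⟩ := (suspension C).map_surjective c
  have ic₀ : IsIso c := isIso_of_reflects_iso c (suspension C)
  rw [id_comp, Preadditive.neg_comp, neg_inj, ← Functor.map_comp] at hc
  rw [CategoryTheory.Functor.map_id, comp_id, Preadditive.comp_neg, neg_inj,
    ← Functor.map_comp] at hc'
  replace hc := (suspension C).map_injective hc
  replace hc' := (suspension C).map_injective hc'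
  refine H'.of_iso (Iso.refl _) (Iso.refl _) (asIso c).symm (by simp) ?_ ?_
  · rw [Iso.symm_hom, asIso_inv, IsIso.comp_inv_eq, Iso.refl_hom, id_comp, hc]
  · rw [Iso.refl_hom, CategoryTheory.Functor.map_id, comp_id, Iso.symm_hom, asIso_inv,
      IsIso.eq_inv_comp, hc']

end

end IsExact

end CofibrationCategory

/-! ### The triangulation of the homotopy category -/

namespace CofibrationCategory

lemma additive_of_isEquivalence {T : Type u} [Category.{v} T] [Preadditive T]
    [HasBinaryBiproducts T] (G : T ⥤ T) [G.IsEquivalence] : G.Additive := by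
  have := preservesBinaryBiproducts_of_preservesBinaryCoproducts G
  exact Functor.additive_of_preservesBinaryBiproducts G

variable {C : Type u} [Category.{v} C] [CofibrationCategory C] [HasZeroObject C]

variable (C) in
lemma hasZeroObject_ho : HasZeroObject (Ho C) := ⟨_, isZero_γ_zero⟩

/-- The coproduct of `X` and `Y` in `C` is a biproduct in the homotopy category. -/
lemma exists_binaryCofan (A B : Ho C) :
    ∃ c : BinaryCofan A B, Nonempty (IsColimit c) := by
  obtain ⟨X, rfl⟩ := exists_eq_γ_obj A
  obtain ⟨Y, rfl⟩ := exists_eq_γ_obj B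
  have sq := isPushout_coprod X Y
  refine ⟨BinaryCofan.mk ((γ C).map (pushout.inl (fromZero X) (fromZero Y)))
    ((γ C).map (pushout.inr (fromZero X) (fromZero Y))), ⟨BinaryCofan.isColimitMk
      (fun s => (exists_γ_coprod_desc sq s.inl s.inr).choose)
      (fun s => (exists_γ_coprod_desc sq s.inl s.inr).choose_spec.1)
      (fun s => (exists_γ_coprod_desc sq s.inl s.inr).choose_spec.2) fun s m h₁ h₂ => ?_⟩⟩
  apply γ_coprod_hom_ext sq
  · rw [h₁, (exists_γ_coprod_desc sq s.inl s.inr).choose_spec.1]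
  · rw [h₂, (exists_γ_coprod_desc sq s.inl s.inr).choose_spec.2]

lemma hasBinaryBiproducts_ho [Preadditive (Ho C)] : HasBinaryBiproducts (Ho C) := by
  have : HasBinaryCoproducts (Ho C) := by
    have (A B : Ho C) : HasColimit (pair A B) := by
      obtain ⟨c, ⟨hc⟩⟩ := exists_binaryCofan A B
      exact ⟨⟨c, hc⟩⟩
    exact hasBinaryCoproducts_of_hasColimit_pair _
  exact HasBinaryBiproducts.of_hasBinaryCoproducts

variable [ChosenCones C]

lemma suspension_additive [IsStable C] [Preadditive (Ho C)] : (suspension C).Additive :=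
  have : HasBinaryBiproducts (Ho C) := hasBinaryBiproducts_ho
  additive_of_isEquivalence _

section

variable [HasShift (Ho C) ℤ] (e : shiftFunctor (Ho C) (1 : ℤ) ≅ suspension C)

/-- A triangle is exact if the corresponding sequence ending in the suspension is exact. -/
def IsExactTriangle (T : Triangle (Ho C)) : Prop :=
  IsExact T.mor₁ T.mor₂ (T.mor₃ ≫ e.hom.app T.obj₁)

variable {e}

lemma IsExact.isExactTriangle {A B D : Ho C} {f : A ⟶ B} {g : B ⟶ D}
    {h : D ⟶ (suspension C).obj A} (H : IsExact f g h) :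
    IsExactTriangle e (Triangle.mk f g (h ≫ e.inv.app A)) := by
  change IsExact f g ((h ≫ e.inv.app A) ≫ e.hom.app A)
  rwa [assoc, Iso.inv_hom_id_app, comp_id]

lemma IsExactTriangle.of_iso {T T' : Triangle (Ho C)} (H : IsExactTriangle e T) (E : T' ≅ T) :
    IsExactTriangle e T' := by
  refine IsExact.of_iso H (Triangle.π₁.mapIso E) (Triangle.π₂.mapIso E) (Triangle.π₃.mapIso E)
    E.hom.comm₁ E.hom.comm₂ ?_
  change (T'.mor₃ ≫ e.hom.app T'.obj₁) ≫ (suspension C).map E.hom.hom₁ =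
    E.hom.hom₃ ≫ T.mor₃ ≫ e.hom.app T.obj₁
  rw [assoc, ← NatTrans.naturality, E.hom.comm₃_assoc]

lemma isExactTriangle_iff (T : Triangle (Ho C)) : IsExactTriangle e T ↔
    ∃ (X Y : C) (f : X ⟶ Y) (_ : Cofibration f),
      Nonempty (T ≅ Triangle.mk ((γ C).map f) ((γ C).map (quotπ f))
        (connecting f ≫ e.inv.app ((γ C).obj X))) := by
  constructor
  · rintro ⟨X, Y, Z, i, p, H, a, b, c, h₁, h₂, h₃⟩
    have ci := H.cofibration
    refine ⟨X, Y, i, ci, ⟨Triangle.isoMk _ _ a b (c ≪≫ (γ C).mapIso H.quotIso.symm) h₁ ?_ ?_⟩⟩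
    · change T.mor₂ ≫ c.hom ≫ (γ C).map H.quotIso.inv = b.hom ≫ (γ C).map (quotπ i)
      rw [reassoc_of% h₂, ← Functor.map_comp, H.comp_quotIso_inv]
    · change T.mor₃ ≫ a.hom⟦(1 : ℤ)⟧' =
        (c.hom ≫ (γ C).map H.quotIso.inv) ≫ connecting i ≫ e.inv.app ((γ C).obj X)
      rw [assoc, ← NatTrans.naturality, IsCofiber.δ, ← assoc c.hom] at h₃
      rw [← cancel_mono (e.hom.app _), assoc, h₃]
      simp
  · rintro ⟨X, Y, f, hf, ⟨E⟩⟩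
    have H := (isCofiber_quotπ f).isExact.isExactTriangle (e := e)
    rw [IsCofiber.δ_quotπ] at H
    exact H.of_iso E

variable [Preadditive (Ho C)]

lemma isExactTriangle_rotate_iff [IsStable C] (T : Triangle (Ho C)) :
    IsExactTriangle e T ↔ IsExactTriangle e T.rotate := by
  have := suspension_additive (C := C)
  have h : (e.app T.obj₁).hom ≫ (-(suspension C).map T.mor₁) =
      (-T.mor₁⟦(1 : ℤ)⟧') ≫ e.hom.app T.obj₂ := by
    rw [Preadditive.comp_neg, Preadditive.neg_comp, NatTrans.naturality]
    rfl
  constructor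
  · intro H
    change IsExact T.mor₂ T.mor₃ ((-T.mor₁⟦(1 : ℤ)⟧') ≫ e.hom.app T.obj₂)
    exact IsExact.rotate (f := T.mor₁) (g := T.mor₂) (h := T.mor₃ ≫ e.hom.app T.obj₁) H |>.of_iso
      (Iso.refl _) (Iso.refl _) (e.app T.obj₁) (by simp) (by simp) (by simp)
  · intro H
    replace H : IsExact T.mor₂ T.mor₃ ((-T.mor₁⟦(1 : ℤ)⟧') ≫ e.hom.app T.obj₂) := H
    apply IsExact.of_rotate
    exact H.of_iso (Iso.refl _) (Iso.refl _) (e.app T.obj₁).symm (by simp) (by simp) (by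
      rw [Iso.symm_hom, Iso.eq_inv_comp, ← h]; simp)

variable [HasZeroObject (Ho C)]

lemma isExactTriangle_contractible (A : Ho C) : IsExactTriangle e (contractibleTriangle A) := by
  have := IsExact.id_zero A (isZero_zero (Ho C))
  change IsExact (𝟙 A) (0 : A ⟶ (0 : Ho C)) ((0 : (0 : Ho C) ⟶ A⟦(1 : ℤ)⟧) ≫ e.hom.app A)
  rwa [zero_comp]

variable [∀ n : ℤ, (shiftFunctor (Ho C) n).Additive]

variable (e) in
/-- The pretriangulated structure on the homotopy category. -/
@[reducible]
def pretriangulatedHo [IsStable C] : Pretriangulated (Ho C) where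
  distinguishedTriangles := {T | IsExactTriangle e T}
  isomorphic_distinguished _ h _ E := h.of_iso E
  contractible_distinguished := isExactTriangle_contractible
  distinguished_cocone_triangle φ := by
    obtain ⟨D, g, h, H⟩ := IsExact.exists_of_hom φ
    exact ⟨D, g, _, H.isExactTriangle⟩
  rotate_distinguished_triangle := isExactTriangle_rotate_iff
  complete_distinguished_triangle_morphism T T' H H' a b w := by
    obtain ⟨c, h₁, h₂⟩ := IsExact.exists_hom H H' a b w
    refine ⟨c, h₁, ?_⟩
    rw [assoc, ← NatTrans.naturality, ← assoc, ← assoc] at h₂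
    exact (cancel_mono _).1 h₂

variable (e) in
lemma isTriangulatedHo [IsStable C] : let _ := pretriangulatedHo e; IsTriangulated (Ho C) := by
  let _ := pretriangulatedHo e
  refine IsTriangulated.mk' fun A B D φ ψ => ?_
  obtain ⟨X, rfl⟩ := exists_eq_γ_obj A
  obtain ⟨Y, rfl⟩ := exists_eq_γ_obj B
  obtain ⟨Z, rfl⟩ := exists_eq_γ_obj D
  -- replacement of the two morphisms by cofibrations
  obtain ⟨Y', f, s, cs, ws, rfl⟩ := exists_fraction φ
  obtain ⟨M, j, w, cj, hw, rfl⟩ := exists_factorization f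
  obtain ⟨Z', g, t, ct, wt, hg⟩ := exists_fraction ((γ C).map w ≫ inv ((γ C).map s) ≫ ψ)
  obtain ⟨N, k, w', ck, hw', rfl⟩ := exists_factorization g
  have h₁ := isCofiber_quotπ j
  have h₂ := isCofiber_quotπ k
  have h₃ := isCofiber_quotπ (j ≫ k)
  obtain ⟨m, hm⟩ := h₁.exists_desc (k ≫ quotπ (j ≫ k)) (by rw [← assoc, h₃.w])
  obtain ⟨n, hn⟩ := h₃.exists_desc (quotπ k) (by rw [assoc, h₂.w, comp_zero])
  have h₄ : IsCofiber m n := h₁.of_comp h₃ h₂ hm hn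
  have H₃ := h₃.isExact
  rw [Functor.map_comp] at H₃
  refine ⟨_, _, _, _, _, _, (γ C).map j, (γ C).map k, Iso.refl _,
    asIso ((γ C).map s ≫ inv ((γ C).map w)), asIso ((γ C).map t ≫ inv ((γ C).map w')), ?_, ?_,
    _, _, h₁.isExact.isExactTriangle, _, _, h₂.isExact.isExactTriangle, _, _, H₃.isExactTriangle,
    ⟨{ m₁ := (γ C).map m, m₃ := (γ C).map n, comm₁ := ?_, comm₂ := ?_, comm₃ := ?_, comm₄ := ?_,
       mem := ?_ }⟩⟩
  · simp
  · have e₁ : ψ = ((γ C).map s ≫ inv ((γ C).map w)) ≫ (γ C).map w ≫ inv ((γ C).map s) ≫ ψ := by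
      simp
    rw [e₁, hg]
    simp
  · rw [← Functor.map_comp, hm, Functor.map_comp]
  · rw [← assoc, ← h₁.δ_natural_id h₃ k m rfl hm]
  · rw [← Functor.map_comp, hn]
  · have e₁ := h₃.δ_natural h₂ j (𝟙 _) n (by rw [comp_id]) (by rw [hn, id_comp])
    rw [assoc, ← assoc ((γ C).map n), ← e₁, assoc, NatTrans.naturality]
  · have e₁ := h₂.δ_natural h₄ (quotπ j) (quotπ (j ≫ k)) (𝟙 _) hm.symm (by rw [hn, comp_id])
    rw [CategoryTheory.Functor.map_id, id_comp] at e₁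
    have H := h₄.isExact.isExactTriangle (e := e)
    have e₂ : h₄.δ ≫ e.inv.app ((γ C).obj (quot j)) =
        (h₂.δ ≫ e.inv.app ((γ C).obj M)) ≫ ((γ C).map (quotπ j))⟦(1 : ℤ)⟧' := by
      rw [← e₁, assoc, assoc, NatTrans.naturality]
    rw [e₂] at H
    exact H

end

variable (C) in
/-- The homotopy category of a stable cofibration category is triangulated. -/
lemma nonempty_hoTriangulation [IsStable C] : Nonempty (HoTriangulation C) := by
  let hzo := hasZeroObject_ho C
  let hz : HasZeroMorphisms (Ho C) := IsZero.hasZeroMorphisms isZero_γ_zero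
  let pre : Preadditive (Ho C) := preadditiveHo C
  let sh : HasShift (Ho C) ℤ := ShiftOfEquivalence.hasShift (suspension C)
  have hb : HasBinaryBiproducts (Ho C) := hasBinaryBiproducts_ho
  have add (n : ℤ) : (shiftFunctor (Ho C) n).Additive := additive_of_isEquivalence _
  let e : shiftFunctor (Ho C) (1 : ℤ) ≅ suspension C := ShiftOfEquivalence.shiftOneIso _
  exact ⟨{
    preadditive := pre
    hasZeroObject := hzo
    hasShift := sh
    additive := add
    pretriangulated := pretriangulatedHo e
    isTriangulated := isTriangulatedHo e
    shiftIso := e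
    mem_distTriang_iff := isExactTriangle_iff }⟩

end CofibrationCategory

/-! ### Homotopy cartesian squares -/

namespace CofibrationCategory

variable {C : Type u} [Category.{v} C] [CofibrationCategory C] [HasZeroObject C]

section

variable [Preadditive (Ho C)] [HasBinaryBiproducts (Ho C)]

lemma isIso_biprod_desc {X Y V : C} {x : X ⟶ V} {y : Y ⟶ V}
    (sq : IsPushout (fromZero X) (fromZero Y) x y) :
    IsIso (biprod.desc ((γ C).map x) ((γ C).map y)) := by
  obtain ⟨φ, h₁, h₂⟩ := exists_γ_coprod_desc sq (biprod.inl : (γ C).obj X ⟶ _ ⊞ (γ C).obj Y)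
    biprod.inr
  refine ⟨φ, ?_, ?_⟩
  · apply biprod.hom_ext'
    · rw [biprod.inl_desc_assoc, h₁, comp_id]
    · rw [biprod.inr_desc_assoc, h₂, comp_id]
  · apply γ_coprod_hom_ext sq
    · rw [reassoc_of% h₁, biprod.inl_desc, comp_id]
    · rw [reassoc_of% h₂, biprod.inr_desc, comp_id]

/-- The biproduct in the homotopy category is represented by the coproduct. -/
noncomputable def biprodIso {X Y V : C} {x : X ⟶ V} {y : Y ⟶ V}
    (sq : IsPushout (fromZero X) (fromZero Y) x y) :
    (γ C).obj X ⊞ (γ C).obj Y ≅ (γ C).obj V :=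
  have := isIso_biprod_desc sq
  asIso (biprod.desc ((γ C).map x) ((γ C).map y))

lemma biprodIso_hom {X Y V : C} {x : X ⟶ V} {y : Y ⟶ V}
    (sq : IsPushout (fromZero X) (fromZero Y) x y) :
    (biprodIso sq).hom = biprod.desc ((γ C).map x) ((γ C).map y) := rfl

end

section

variable [ChosenCones C] [Preadditive (Ho C)]

/-- Exactness is not affected by changing two of the signs. -/
lemma IsExact.neg_neg₁₂ {A B D : Ho C} {f : A ⟶ B} {g : B ⟶ D} {h : D ⟶ (suspension C).obj A}
    (H : IsExact f g h) : IsExact (-f) (-g) h :=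
  H.of_iso (Iso.refl _) ⟨-𝟙 _, -𝟙 _, by simp, by simp⟩ (Iso.refl _) (by simp) (by simp) (by simp)

/-- A split exact sequence. -/
lemma isExact_coprod {X Y V : C} {x : X ⟶ V} {y : Y ⟶ V}
    (sq : IsPushout (fromZero X) (fromZero Y) x y) :
    IsExact ((γ C).map x) ((γ C).map (sq.desc 0 (𝟙 Y) (fromZero_ext _ _))) 0 := by
  have h₀ : IsCofiber (fromZero Y) (𝟙 Y) := ⟨inferInstance, by
    rw [(isZero_zero C).eq_of_tgt (toZero 0) (𝟙 0)]
    exact IsPushout.of_vert_isIso ⟨by rw [id_comp, comp_id]⟩⟩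
  have h := h₀.of_isPushout sq.flip (sq.inr_desc 0 (𝟙 Y) (fromZero_ext _ _)) (sq.inl_desc _ _ _)
  have e := h₀.δ_natural h (fromZero X) y (𝟙 Y) sq.w.symm (by rw [sq.inr_desc, comp_id])
  rw [CategoryTheory.Functor.map_id, id_comp] at e
  have h₁ := IsConeSeq.of_cofibration (𝟙 (0 : C)) contractible_zero
  have hS : WeaklyContractible (quot (𝟙 (0 : C))) := by
    have := h₁.isCofiber.weakEquivalence contractible_zero
    exact we_of_precomp _ _ this (by rw [comp_toZero]; exact contractible_zero)
  have hz : IsZero ((suspension C).obj ((γ C).obj (0 : C))) :=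
    (isZero_γ_of_contractible hS).of_iso (asIso h₁.σ).symm
  rw [hz.eq_of_tgt h₀.δ 0, zero_comp] at e
  rw [e]
  exact h.isExact

/-- For a cylinder `I` of `A`, the difference of the two inclusions of `A` into `A ⊔ A` is the
kernel of `A ⊔ A ⟶ I`. -/
lemma isExact_cylinder {A I : C} (k : pushout (fromZero A) (fromZero A) ⟶ I) (p : I ⟶ A)
    [WeakEquivalence p] (h₀ : (pushout.inl _ _ ≫ k) ≫ p = 𝟙 A)
    (h₁ : (pushout.inr _ _ ≫ k) ≫ p = 𝟙 A) :
    IsExact ((γ C).map (pushout.inl (fromZero A) (fromZero A)) - (γ C).map (pushout.inr _ _))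
      ((γ C).map k) 0 := by
  have sq := isPushout_coprod A A
  have H := isExact_coprod sq
  have r₀ : pushout.inl (fromZero A) (fromZero A) ≫ sq.desc 0 (𝟙 A) (fromZero_ext _ _) = 0 :=
    sq.inl_desc _ _ _
  have r₁ : pushout.inr (fromZero A) (fromZero A) ≫ sq.desc 0 (𝟙 A) (fromZero_ext _ _) = 𝟙 A :=
    sq.inr_desc _ _ _
  set r := sq.desc 0 (𝟙 A) (fromZero_ext _ _)
  set j₀ := pushout.inl (fromZero A) (fromZero A)
  set j₁ := pushout.inr (fromZero A) (fromZero A)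
  obtain ⟨s, s₀, s₁⟩ := exists_γ_coprod_desc sq ((γ C).map j₀ + (γ C).map j₁) ((γ C).map j₁)
  obtain ⟨t, t₀, t₁⟩ := exists_γ_coprod_desc sq ((γ C).map j₀ - (γ C).map j₁) ((γ C).map j₁)
  refine H.of_iso (Iso.refl _) ⟨s, t, γ_coprod_hom_ext sq ?_ ?_, γ_coprod_hom_ext sq ?_ ?_⟩
    (asIso ((γ C).map p)) ?_ (γ_coprod_hom_ext sq ?_ ?_) (by simp)
  · rw [reassoc_of% s₀, Preadditive.add_comp, t₀, t₁, sub_add_cancel, comp_id]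
  · rw [reassoc_of% s₁, t₁, comp_id]
  · rw [reassoc_of% t₀, Preadditive.sub_comp, s₀, s₁, add_sub_cancel_right, comp_id]
  · rw [reassoc_of% t₁, s₁, comp_id]
  · simp only [Preadditive.sub_comp, s₀, s₁, add_sub_cancel_right, Iso.refl_hom, id_comp]
  · simp only [reassoc_of% s₀, Preadditive.add_comp, asIso_hom, ← Functor.map_comp, r₀, r₁]
    rw [← assoc, h₀, γ_map_zero, zero_add]
  · simp only [reassoc_of% s₁, asIso_hom, ← Functor.map_comp, r₁]
    rw [← assoc, h₁]

end

section

variable [ChosenCones C] [Preadditive (Ho C)] [HasBinaryBiproducts (Ho C)]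

/-- The square with top `g : A ⟶ V`, left `f : A ⟶ U`, right `f' : V ⟶ X` and bottom `g' : U ⟶ X`
in the homotopy category is homotopy cartesian with respect to the exact sequences `IsExact`. -/
def IsHoCartesian {A U V X : Ho C} (g : A ⟶ V) (f : A ⟶ U) (f' : V ⟶ X) (g' : U ⟶ X) : Prop :=
  f ≫ g' = g ≫ f' ∧
    ∃ d : X ⟶ (suspension C).obj A, IsExact (biprod.lift f (-g)) (biprod.desc g' f') d

namespace IsHoCartesian

variable {A U V X A' U' V' X' : Ho C} {g : A ⟶ V} {f : A ⟶ U} {f' : V ⟶ X} {g' : U ⟶ X}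

lemma of_iso {k : A' ⟶ V'} {l : A' ⟶ U'} {l' : V' ⟶ X'} {k' : U' ⟶ X'}
    (H : IsHoCartesian g f f' g') (a : A' ≅ A) (u : U' ≅ U) (v : V' ≅ V) (x : X' ≅ X)
    (h₁ : k ≫ v.hom = a.hom ≫ g) (h₂ : l ≫ u.hom = a.hom ≫ f) (h₃ : l' ≫ x.hom = v.hom ≫ f')
    (h₄ : k' ≫ x.hom = u.hom ≫ g') : IsHoCartesian k l l' k' := by
  obtain ⟨w, d, H⟩ := H
  refine ⟨?_, x.hom ≫ d ≫ (suspension C).map a.inv, H.of_iso a (biprod.mapIso u v) x ?_ ?_ ?_⟩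
  · rw [← cancel_mono x.hom, assoc, assoc, h₃, h₄, reassoc_of% h₁, reassoc_of% h₂, w]
  · apply biprod.hom_ext <;> simp [h₁, h₂]
  · apply biprod.hom_ext' <;> simp [h₃, h₄]
  · rw [assoc, assoc, ← Functor.map_comp, Iso.inv_hom_id, CategoryTheory.Functor.map_id, comp_id]

lemma symm (H : IsHoCartesian g f f' g') : IsHoCartesian f g g' f' := by
  obtain ⟨w, d, H⟩ := H
  refine ⟨w.symm, -d, H.of_iso (Iso.refl _)
    ⟨-(biprod.braiding _ _).hom, -(biprod.braiding _ _).inv, by simp, by simp⟩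
    ⟨-𝟙 _, -𝟙 _, by simp, by simp⟩ ?_ ?_ (by simp)⟩
  · apply biprod.hom_ext <;> simp
  · apply biprod.hom_ext' <;> simp

end IsHoCartesian

variable [IsStable C] [(suspension C).Additive]

/-- A pushout square along a cofibration is homotopy cartesian. The double mapping cylinder `T` of
`k` and `g` is weakly equivalent to the pushout, and it is the pushout of a cylinder of `A` along
`k ⊔ g`. -/
lemma isHoCartesian_of_isPushout {A N V P : C} {k : A ⟶ N} {g : A ⟶ V} {a : N ⟶ P} {b : V ⟶ P}
    [Cofibration k] (sq : IsPushout k g a b) :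
    IsHoCartesian ((γ C).map g) ((γ C).map k) ((γ C).map b) ((γ C).map a) := by
  refine ⟨by rw [← Functor.map_comp, ← Functor.map_comp, sq.w], ?_⟩
  obtain ⟨I, l, p, -, -, -, cl, c₀, c₁, w₀, w₁, wp, -, -, p₀, p₁, -, -⟩ :=
    (Homotopic.refl (𝟙 A)).exists_cylinder
  have E₁ := (isExact_cylinder l p p₀ p₁).rotate
  set j₀ := pushout.inl (fromZero A) (fromZero A)
  set j₁ := pushout.inr (fromZero A) (fromZero A)
  -- the mapping cylinder of `k`
  have sqN := IsPushout.of_hasPushout (j₀ ≫ l) k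
  set m := pushout.inl (j₀ ≫ l) k
  set n := pushout.inr (j₀ ≫ l) k
  let r : pushout (j₀ ≫ l) k ⟶ N := sqN.desc (p ≫ k) (𝟙 N) (by
    rw [← assoc, p₀, id_comp, comp_id])
  have hm : m ≫ r = p ≫ k := sqN.inl_desc _ _ _
  have hn : n ≫ r = 𝟙 N := sqN.inr_desc _ _ _
  have wn : WeakEquivalence n := inferInstance
  have wr : WeakEquivalence r := we_of_precomp n r wn (by rw [hn]; infer_instance)
  have sqW := IsPushout.of_hasPushout (fromZero N) (fromZero A)
  have sq₁ := isPushout_mappingCylinder l k sqW sqN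
  have x_e : pushout.inl (fromZero N) (fromZero A) ≫ sqW.desc n (j₁ ≫ l ≫ m) (fromZero_ext _ _) =
    n := sqW.inl_desc _ _ _
  have y_e : pushout.inr (fromZero N) (fromZero A) ≫ sqW.desc n (j₁ ≫ l ≫ m) (fromZero_ext _ _) =
    j₁ ≫ l ≫ m := sqW.inr_desc _ _ _
  have ce := cofibration_of_isPushout sq₁.flip
  set e := sqW.desc n (j₁ ≫ l ≫ m) (fromZero_ext _ _)
  set x := pushout.inl (fromZero N) (fromZero A)
  set y := pushout.inr (fromZero N) (fromZero A)
  have cy : Cofibration (y ≫ e) := inferInstance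
  -- the double mapping cylinder `T`
  have sqT := IsPushout.of_hasPushout (y ≫ e) g
  set t := pushout.inl (y ≫ e) g
  set b' := pushout.inr (y ≫ e) g
  have hr : (y ≫ e) ≫ r = k := by
    rw [y_e, assoc, assoc, hm, ← assoc, ← assoc, p₁, id_comp]
  let w : pushout (y ≫ e) g ⟶ P := sqT.desc (r ≫ a) b (by rw [← assoc, hr, sq.w])
  have tw : t ≫ w = r ≫ a := sqT.inl_desc _ _ _
  have bw : b' ≫ w = b := sqT.inr_desc _ _ _
  have ww : WeakEquivalence w :=
    weakEquivalence_of_isPushout_of_isPushout sqT sq r hr w tw bw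
  have sqM := IsPushout.of_hasPushout (fromZero N) (fromZero V)
  set x' := pushout.inl (fromZero N) (fromZero V)
  set y' := pushout.inr (fromZero N) (fromZero V)
  let ψ : pushout (fromZero N) (fromZero A) ⟶ pushout (fromZero N) (fromZero V) :=
    sqW.desc x' (g ≫ y') (fromZero_ext _ _)
  have xψ : x ≫ ψ = x' := sqW.inl_desc _ _ _
  have yψ : y ≫ ψ = g ≫ y' := sqW.inr_desc _ _ _
  let e' : pushout (fromZero N) (fromZero V) ⟶ pushout (y ≫ e) g :=
    sqM.desc (n ≫ t) b' (fromZero_ext _ _)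
  have x'e : x' ≫ e' = n ≫ t := sqM.inl_desc _ _ _
  have y'e : y' ≫ e' = b' := sqM.inr_desc _ _ _
  have sq₂ : IsPushout y g ψ y' := by
    refine IsPushout.of_top (h₁₁ := fromZero N) (v₁₁ := fromZero A) (v₁₂ := x) ?_ yψ sqW
    rwa [xψ, fromZero_ext (fromZero A ≫ g) (fromZero V)]
  have sq₃ : IsPushout ψ e e' t := by
    refine IsPushout.of_top (h₁₁ := g) (v₁₁ := y) (v₁₂ := y') ?_ ?_ sq₂.flip
    · rw [y'e]
      exact sqT.flip
    · apply sqW.hom_ext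
      · rw [reassoc_of% xψ, x'e, reassoc_of% x_e]
      · rw [reassoc_of% yψ, y'e, ← sqT.w, assoc]
  have sq₄ := sq₁.paste_horiz sq₃
  have hI := isCofiber_quotπ l
  obtain ⟨q, hq₁, hq₂⟩ : ∃ q, (m ≫ t) ≫ q = quotπ l ∧ e' ≫ q = 0 :=
    ⟨sq₄.flip.desc (quotπ l) 0 (by rw [hI.w, comp_zero]), sq₄.flip.inl_desc _ _ _,
      sq₄.flip.inr_desc _ _ _⟩
  have hT := hI.of_isPushout sq₄.flip hq₁ hq₂
  have e₁ := hI.δ_natural hT _ (m ≫ t) (𝟙 _) sq₄.w.symm (by rw [hq₁, comp_id])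
  rw [CategoryTheory.Functor.map_id, id_comp] at e₁
  obtain ⟨χ, h₁, h₂⟩ := E₁.exists_hom hI.isExact (𝟙 _) (𝟙 _) (by rw [id_comp, comp_id])
  have iχ : IsIso χ := E₁.isIso_of_isIso hI.isExact (𝟙 _) (𝟙 _) χ (by rw [id_comp, comp_id]) h₁ h₂
  have e₂ : ((γ C).map j₀ - (γ C).map j₁) ≫ (γ C).map (pushout.desc (f := fromZero A)
      (g := fromZero A) (k ≫ x) y (fromZero_ext _ _) ≫ ψ) =
        (γ C).map k ≫ (γ C).map x' - (γ C).map g ≫ (γ C).map y' := by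
    rw [Preadditive.sub_comp]
    simp only [← Functor.map_comp]
    rw [pushout.inl_desc_assoc, pushout.inr_desc_assoc, assoc, xψ, yψ]
  have E₂ : IsExact ((γ C).map k ≫ (γ C).map x' - (γ C).map g ≫ (γ C).map y') ((γ C).map e')
      ((γ C).map q ≫ inv χ) := by
    apply IsExact.of_rotate
    refine hT.isExact.of_iso (Iso.refl _) (Iso.refl _) (asIso χ) (by simp) (by simp) ?_
    rw [Iso.refl_hom, CategoryTheory.Functor.map_id, comp_id, asIso_hom, ← e₁, ← reassoc_of% h₂,
      CategoryTheory.Functor.map_id, id_comp, ← e₂, Functor.map_comp, Preadditive.neg_comp]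
  refine ⟨inv ((γ C).map w) ≫ (γ C).map q ≫ inv χ, E₂.of_iso (Iso.refl _) (biprodIso sqM)
    (asIso ((γ C).map w)).symm ?_ ?_ ?_⟩
  · rw [biprodIso_hom, biprod.lift_desc, Preadditive.neg_comp, Iso.refl_hom, id_comp,
      sub_eq_add_neg]
  · rw [biprodIso_hom, Iso.symm_hom, asIso_inv, IsIso.comp_inv_eq]
    apply biprod.hom_ext'
    · rw [biprod.inl_desc, assoc, biprod.inl_desc_assoc, ← Functor.map_comp, ← Functor.map_comp,
        reassoc_of% x'e, tw, reassoc_of% hn]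
    · rw [biprod.inr_desc, assoc, biprod.inr_desc_assoc, ← Functor.map_comp, ← Functor.map_comp,
        reassoc_of% y'e, bw]
  · rw [Iso.refl_hom, CategoryTheory.Functor.map_id, comp_id, Iso.symm_hom, asIso_inv]

end

end CofibrationCategory

namespace CofibrationCategory

set_option linter.unusedSectionVars false

section

variable {C : Type u} [Category.{v} C] [CofibrationCategory C] [HasZeroObject C]

/-- The union `W` of two cofibrations `f` and `f'` out of `A`, with the morphisms from `W` to the
quotients of `f` and `f'` that collapse the other part. -/
structure IsUnion {A U U' W Z Z' : C} (f : A ⟶ U) (p : U ⟶ Z) (f' : A ⟶ U') (p' : U' ⟶ Z')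
    (i : U ⟶ W) (i' : U' ⟶ W) (q : W ⟶ Z) (q' : W ⟶ Z') : Prop where
  isCofiber : IsCofiber f p
  isCofiber' : IsCofiber f' p'
  isPushout : IsPushout f f' i i'
  iq : i ≫ q = p
  i'q : i' ≫ q = 0
  iq' : i ≫ q' = 0
  i'q' : i' ≫ q' = p'

namespace IsUnion

variable {A U U' W Z Z' : C} {f : A ⟶ U} {p : U ⟶ Z} {f' : A ⟶ U'} {p' : U' ⟶ Z'} {i : U ⟶ W}
  {i' : U' ⟶ W} {q : W ⟶ Z} {q' : W ⟶ Z'}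

lemma symm (h : IsUnion f p f' p' i i' q q') : IsUnion f' p' f p i' i q' q :=
  ⟨h.isCofiber', h.isCofiber, h.isPushout.flip, h.i'q', h.iq', h.i'q, h.iq⟩

lemma isCofiber_inr (h : IsUnion f p f' p' i i' q q') : IsCofiber i' q :=
  h.isCofiber.of_isPushout h.isPushout h.iq h.i'q

end IsUnion

end

variable {C : Type u} [Category.{v} C] [CofibrationCategory C] [HasZeroObject C] [ChosenCones C]
  [Preadditive (Ho C)]

lemma IsExact.suspension {A B D : Ho C} {f : A ⟶ B} {g : B ⟶ D} {h : D ⟶ (suspension C).obj A}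
    (H : IsExact f g h) : IsExact ((suspension C).map f) ((suspension C).map g)
      (-(suspension C).map h) := by
  have := H.rotate.rotate.rotate.neg_neg₁₂
  rwa [neg_neg, neg_neg] at this

section

variable [HasBinaryBiproducts (Ho C)] [IsStable C] [(suspension C).Additive]

/-- For composable cofibrations `A ⟶ W ⟶ B`, the square with vertices `B/A`, `ΣA`, `B/W` and `ΣW` is
homotopy cartesian: up to weak equivalence it is the pushout square of `K ∪_A B ⟶ L ∪_W B` and
`K ∪_A B ⟶ K/A` for suitable cones `K` of `A` and `L` of `W`. -/
lemma isHoCartesian_of_comp {A W B R S : C} {f : A ⟶ W} {g : W ⟶ B} {r : B ⟶ R} {s : B ⟶ S}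
    [Cofibration f] (hfg : IsCofiber (f ≫ g) r) (hg : IsCofiber g s) (t : R ⟶ S)
    (ht : r ≫ t = s) :
    IsHoCartesian hfg.δ ((γ C).map t) ((suspension C).map ((γ C).map f)) hg.δ := by
  have cg := hg.cofibration
  have hA := isConeSeq_cone A
  set iA := (cone A).ι
  have sqP := IsPushout.of_hasPushout iA f
  obtain ⟨L, κ, cκ, hL⟩ := exists_cone (pushout iA f)
  have hW := IsConeSeq.of_cofibration (pushout.inr iA f ≫ κ) hL
  set iW := pushout.inr iA f ≫ κ
  have w₁ : iA ≫ pushout.inl iA f ≫ κ = f ≫ iW := by rw [← assoc, sqP.w, assoc]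
  obtain ⟨c, hc⟩ := hA.isCofiber.exists_desc ((pushout.inl iA f ≫ κ) ≫ quotπ iW) (by
    rw [← assoc, w₁, assoc, hW.isCofiber.w, comp_zero])
  have σnat := hA.σ_natural hW f (pushout.inl iA f ≫ κ) c w₁ hc
  -- the two unions of cones with `B`
  have sqA := IsPushout.of_hasPushout iA (f ≫ g)
  have sqW := IsPushout.of_hasPushout iW g
  set u := pushout.inl iA (f ≫ g)
  set v := pushout.inr iA (f ≫ g)
  set u' := pushout.inl iW g
  set v' := pushout.inr iW g
  let d : pushout iA (f ≫ g) ⟶ pushout iW g := sqA.desc ((pushout.inl iA f ≫ κ) ≫ u') v' (by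
    rw [← assoc, w₁, assoc, sqW.w, assoc])
  have ud : u ≫ d = (pushout.inl iA f ≫ κ) ≫ u' := sqA.inl_desc _ _ _
  have vd : v ≫ d = v' := sqA.inr_desc _ _ _
  have cd : Cofibration d := by
    let n : pushout iA f ⟶ pushout iA (f ≫ g) := sqP.desc u (g ≫ v) (by rw [sqA.w, assoc])
    have n₁ : pushout.inl iA f ≫ n = u := sqP.inl_desc _ _ _
    have n₂ : pushout.inr iA f ≫ n = g ≫ v := sqP.inr_desc _ _ _
    have sq₁ : IsPushout (pushout.inr iA f) g n v := by
      refine (IsPushout.of_top (h₁₁ := iA) (v₁₁ := f) (v₁₂ := pushout.inl iA f) ?_ n₂ sqP)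
      rwa [n₁]
    have sq₂ : IsPushout κ n u' d := by
      refine (IsPushout.of_left (h₁₁ := pushout.inr iA f) (v₁₁ := g) (h₂₁ := v) ?_ ?_ sq₁)
      · rwa [vd]
      · apply sqP.hom_ext
        · rw [reassoc_of% n₁, ud, assoc]
        · rw [reassoc_of% n₂, vd, ← sqW.w, assoc]
    exact cofibration_of_isPushout sq₂
  obtain ⟨rA, uA, vA⟩ : ∃ rA, u ≫ rA = 0 ∧ v ≫ rA = r :=
    ⟨sqA.desc 0 r (by rw [hfg.w, comp_zero]), sqA.inl_desc _ _ _, sqA.inr_desc _ _ _⟩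
  obtain ⟨rW, uW, vW⟩ : ∃ rW, u' ≫ rW = 0 ∧ v' ≫ rW = s :=
    ⟨sqW.desc 0 s (by rw [hg.w, comp_zero]), sqW.inl_desc _ _ _, sqW.inr_desc _ _ _⟩
  obtain ⟨eA, uA', vA'⟩ : ∃ eA, u ≫ eA = quotπ iA ∧ v ≫ eA = 0 :=
    ⟨sqA.desc (quotπ iA) 0 (by rw [hA.isCofiber.w, comp_zero]), sqA.inl_desc _ _ _,
      sqA.inr_desc _ _ _⟩
  obtain ⟨eW, uW', vW'⟩ : ∃ eW, u' ≫ eW = quotπ iW ∧ v' ≫ eW = 0 :=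
    ⟨sqW.desc (quotπ iW) 0 (by rw [hW.isCofiber.w, comp_zero]), sqW.inl_desc _ _ _,
      sqW.inr_desc _ _ _⟩
  have wA : WeakEquivalence rA := (hfg.of_isPushout sqA.flip vA uA).weakEquivalence hA.contractible
  have wW : WeakEquivalence rW := (hg.of_isPushout sqW.flip vW uW).weakEquivalence hW.contractible
  have kA := hA.isCofiber.of_isPushout sqA uA' vA'
  have kW := hW.isCofiber.of_isPushout sqW uW' vW'
  rw [← vd] at kW
  have hec : eA ≫ c = d ≫ eW := sqA.hom_ext (by rw [reassoc_of% uA', hc, reassoc_of% ud, uW', assoc])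
    (by rw [reassoc_of% vA', zero_comp, reassoc_of% vd, vW'])
  have hrt : rA ≫ t = d ≫ rW := sqA.hom_ext
    (by rw [reassoc_of% uA, zero_comp, reassoc_of% ud, uW, comp_zero, comp_zero])
    (by rw [reassoc_of% vA, ht, reassoc_of% vd, vW])
  refine (isHoCartesian_of_isPushout (kA.isPushout_of_comp kW hec)).of_iso
    (asIso ((γ C).map rA)).symm (asIso ((γ C).map rW)).symm (asIso hA.σ).symm (asIso hW.σ).symm
    ?_ ?_ ?_ ?_
  · rw [Iso.symm_hom, Iso.symm_hom, asIso_inv, asIso_inv, IsIso.comp_inv_eq, assoc,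
      IsIso.eq_inv_comp, hfg.δ_eq hA sqA uA vA uA' vA']
  · rw [Iso.symm_hom, Iso.symm_hom, asIso_inv, asIso_inv, IsIso.comp_inv_eq, assoc,
      IsIso.eq_inv_comp, ← Functor.map_comp, ← Functor.map_comp, hrt]
  · rw [Iso.symm_hom, Iso.symm_hom, asIso_inv, asIso_inv, IsIso.comp_inv_eq, assoc,
      IsIso.eq_inv_comp, σnat]
  · rw [Iso.symm_hom, Iso.symm_hom, asIso_inv, asIso_inv, IsIso.comp_inv_eq, assoc,
      IsIso.eq_inv_comp, hg.δ_eq hW sqW uW vW uW' vW']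

namespace IsUnion

variable {A U U' W Z Z' : C} {f : A ⟶ U} {p : U ⟶ Z} {f' : A ⟶ U'} {p' : U' ⟶ Z'} {i : U ⟶ W}
  {i' : U' ⟶ W} {q : W ⟶ Z} {q' : W ⟶ Z'} (h : IsUnion f p f' p' i i' q q')

/-- The exact sequence `W ⟶ U/A ⊞ U'/A ⟶ ΣA` for the union `W` of `U` and `U'` along `A`. -/
lemma exists_isExact : ∃ d, IsExact (biprod.lift ((γ C).map q) ((γ C).map q'))
    (biprod.desc h.isCofiber.δ h.isCofiber'.δ) d := by
  have cf := h.isCofiber.cofibration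
  have ci := h.symm.isCofiber_inr.cofibration
  have sqV := isPushout_coprod Z Z'
  set x := pushout.inl (fromZero Z) (fromZero Z')
  set y := pushout.inr (fromZero Z) (fromZero Z')
  obtain ⟨w, iw, i'w⟩ : ∃ w, i ≫ w = p ≫ x ∧ i' ≫ w = p' ≫ y :=
    ⟨h.isPushout.desc (p ≫ x) (p' ≫ y) (by
      rw [← assoc, h.isCofiber.w, zero_comp, ← assoc, h.isCofiber'.w, zero_comp]),
      h.isPushout.inl_desc _ _ _, h.isPushout.inr_desc _ _ _⟩
  -- the quotient of the union is the coproduct of the quotients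
  have sq₁ : IsPushout i p w x := by
    refine IsPushout.of_top (h₁₁ := f') (v₁₁ := f) (v₁₂ := i') ?_ iw h.isPushout.flip
    rw [i'w, h.isCofiber.w, ← toZero_comp_fromZero]
    exact h.isCofiber'.isPushout.paste_vert sqV.flip
  have hw : IsCofiber (f ≫ i) w := by
    refine ⟨inferInstance, ?_⟩
    have := h.isCofiber.isPushout.paste_horiz sq₁
    rwa [fromZero_ext (fromZero Z ≫ x) (fromZero _)] at this
  have e₁ := h.isCofiber.δ_natural_id hw i x rfl iw.symm
  have e₂ := h.isCofiber'.δ_natural_id hw i' y h.isPushout.w.symm i'w.symm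
  refine ⟨-(suspension C).map ((γ C).map (f ≫ i)),
    hw.isExact.rotate.of_iso (Iso.refl _) (biprodIso sqV) (Iso.refl _) ?_ ?_ (by simp)⟩
  · obtain ⟨r, xr, yr⟩ : ∃ r, x ≫ r = 𝟙 Z ∧ y ≫ r = 0 :=
      ⟨sqV.desc (𝟙 Z) 0 (fromZero_ext _ _), sqV.inl_desc _ _ _, sqV.inr_desc _ _ _⟩
    obtain ⟨r', xr', yr'⟩ : ∃ r', x ≫ r' = 0 ∧ y ≫ r' = 𝟙 Z' :=
      ⟨sqV.desc 0 (𝟙 Z') (fromZero_ext _ _), sqV.inl_desc _ _ _, sqV.inr_desc _ _ _⟩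
    have wr : w ≫ r = q := h.isPushout.hom_ext (by rw [reassoc_of% iw, xr, comp_id, h.iq])
      (by rw [reassoc_of% i'w, yr, comp_zero, h.i'q])
    have wr' : w ≫ r' = q' := h.isPushout.hom_ext (by rw [reassoc_of% iw, xr', comp_zero, h.iq'])
      (by rw [reassoc_of% i'w, yr', comp_id, h.i'q'])
    have e₃ : (γ C).map r = (biprodIso sqV).inv ≫ biprod.fst := by
      rw [Iso.eq_inv_comp, biprodIso_hom]
      apply biprod.hom_ext'
      · rw [biprod.inl_desc_assoc, ← Functor.map_comp, xr, CategoryTheory.Functor.map_id,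
          biprod.inl_fst]
      · rw [biprod.inr_desc_assoc, ← Functor.map_comp, yr, γ_map_zero, biprod.inr_fst]
    have e₄ : (γ C).map r' = (biprodIso sqV).inv ≫ biprod.snd := by
      rw [Iso.eq_inv_comp, biprodIso_hom]
      apply biprod.hom_ext'
      · rw [biprod.inl_desc_assoc, ← Functor.map_comp, xr', γ_map_zero, biprod.inl_snd]
      · rw [biprod.inr_desc_assoc, ← Functor.map_comp, yr', CategoryTheory.Functor.map_id,
          biprod.inr_snd]
    rw [Iso.refl_hom, id_comp, ← Iso.eq_comp_inv]
    apply biprod.hom_ext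
    · rw [biprod.lift_fst, assoc, ← e₃, ← Functor.map_comp, wr]
    · rw [biprod.lift_snd, assoc, ← e₄, ← Functor.map_comp, wr']
  · rw [Iso.refl_hom, comp_id, biprodIso_hom]
    apply biprod.hom_ext'
    · rw [biprod.inl_desc, biprod.inl_desc_assoc, e₁]
    · rw [biprod.inr_desc, biprod.inr_desc_assoc, e₂]

lemma map_comp_δ_eq_neg :
    (γ C).map q' ≫ h.isCofiber'.δ = -((γ C).map q ≫ h.isCofiber.δ) := by
  obtain ⟨d, H⟩ := h.exists_isExact
  have := H.comp_eq_zero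
  rw [biprod.lift_desc] at this
  rw [eq_neg_iff_add_eq_zero, add_comm, this]

lemma isHoCartesian_suspension :
    IsHoCartesian ((suspension C).map ((γ C).map q')) ((suspension C).map ((γ C).map q))
      ((suspension C).map h.isCofiber'.δ) (-(suspension C).map h.isCofiber.δ) := by
  have := preservesBinaryBiproducts_of_preservesBiproducts (suspension C)
  obtain ⟨d, H⟩ := h.exists_isExact
  refine ⟨?_, (suspension C).map d, H.suspension.of_iso (Iso.refl _)
    (biprod.mapIso (Iso.refl _) ⟨-𝟙 _, -𝟙 _, by simp, by simp⟩ ≪≫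
      ((suspension C).mapBiprod _ _).symm) ⟨-𝟙 _, -𝟙 _, by simp, by simp⟩ ?_ ?_ (by simp)⟩
  · rw [← Functor.map_comp, h.map_comp_δ_eq_neg, Functor.map_neg, Functor.map_comp,
      Preadditive.comp_neg]
  · rw [Iso.refl_hom, id_comp, Iso.trans_hom, Iso.symm_hom, ← assoc, Iso.comp_inv_eq,
      biprod.map_lift_mapBiprod]
    apply biprod.hom_ext <;> simp
  · rw [Iso.trans_hom, Iso.symm_hom, assoc, biprod.mapBiprod_inv_map_desc]
    apply biprod.hom_ext' <;> simp

end IsUnion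

end

end CofibrationCategory

namespace CofibrationCategory

set_option linter.unusedSectionVars false

/-! ### Grids of cofiber sequences -/

section Grid

variable {C : Type u} [Category.{v} C] [CofibrationCategory C] [HasZeroObject C]

/-- A commutative three by three diagram with objects `X_ab` for `a, b = 0, 1, 2`. The columns
`u_b : X_0b ⟶ X_1b`, `v_b : X_1b ⟶ X_2b` and the rows `u'_a : X_a0 ⟶ X_a1`, `v'_a : X_a1 ⟶ X_a2`
are cofiber sequences, `W` is the union of `X₁₀` and `X₀₁` along `X₀₀`, and the induced morphism
`i : W ⟶ X₁₁` is a cofibration. -/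
structure IsCofiberGrid {X₀₀ X₀₁ X₀₂ X₁₀ X₁₁ X₁₂ X₂₀ X₂₁ X₂₂ W : C}
    (u₀ : X₀₀ ⟶ X₁₀) (v₀ : X₁₀ ⟶ X₂₀) (u₁ : X₀₁ ⟶ X₁₁) (v₁ : X₁₁ ⟶ X₂₁)
    (u₂ : X₀₂ ⟶ X₁₂) (v₂ : X₁₂ ⟶ X₂₂) (u'₀ : X₀₀ ⟶ X₀₁) (v'₀ : X₀₁ ⟶ X₀₂)
    (u'₁ : X₁₀ ⟶ X₁₁) (v'₁ : X₁₁ ⟶ X₁₂) (u'₂ : X₂₀ ⟶ X₂₁) (v'₂ : X₂₁ ⟶ X₂₂)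
    (j : X₀₁ ⟶ W) (j' : X₁₀ ⟶ W) (i : W ⟶ X₁₁) (q : W ⟶ X₂₀) (q' : W ⟶ X₀₂) : Prop where
  isUnion : IsUnion u₀ v₀ u'₀ v'₀ j' j q q'
  cofibration : Cofibration i
  ji : j ≫ i = u₁
  j'i : j' ≫ i = u'₁
  col₁ : IsCofiber u₁ v₁
  col₂ : IsCofiber u₂ v₂
  row₁ : IsCofiber u'₁ v'₁
  row₂ : IsCofiber u'₂ v'₂
  w₀₁ : u₁ ≫ v'₁ = v'₀ ≫ u₂
  w₁₀ : u'₁ ≫ v₁ = v₀ ≫ u'₂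
  w₁₁ : v₁ ≫ v'₂ = v'₁ ≫ v₂

namespace IsCofiberGrid

variable {X₀₀ X₀₁ X₀₂ X₁₀ X₁₁ X₁₂ X₂₀ X₂₁ X₂₂ W : C}
    {u₀ : X₀₀ ⟶ X₁₀} {v₀ : X₁₀ ⟶ X₂₀} {u₁ : X₀₁ ⟶ X₁₁} {v₁ : X₁₁ ⟶ X₂₁}
    {u₂ : X₀₂ ⟶ X₁₂} {v₂ : X₁₂ ⟶ X₂₂} {u'₀ : X₀₀ ⟶ X₀₁} {v'₀ : X₀₁ ⟶ X₀₂}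
    {u'₁ : X₁₀ ⟶ X₁₁} {v'₁ : X₁₁ ⟶ X₁₂} {u'₂ : X₂₀ ⟶ X₂₁} {v'₂ : X₂₁ ⟶ X₂₂}
    {j : X₀₁ ⟶ W} {j' : X₁₀ ⟶ W} {i : W ⟶ X₁₁} {q : W ⟶ X₂₀} {q' : W ⟶ X₀₂}
    (G : IsCofiberGrid u₀ v₀ u₁ v₁ u₂ v₂ u'₀ v'₀ u'₁ v'₁ u'₂ v'₂ j j' i q q')

lemma symm (G : IsCofiberGrid u₀ v₀ u₁ v₁ u₂ v₂ u'₀ v'₀ u'₁ v'₁ u'₂ v'₂ j j' i q q') :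
    IsCofiberGrid u'₀ v'₀ u'₁ v'₁ u'₂ v'₂ u₀ v₀ u₁ v₁ u₂ v₂ j' j i q' q :=
  ⟨G.isUnion.symm, G.cofibration, G.j'i, G.ji, G.row₁, G.row₂, G.col₁, G.col₂, G.w₁₀, G.w₀₁,
    G.w₁₁.symm⟩

lemma isCofiber_j (G : IsCofiberGrid u₀ v₀ u₁ v₁ u₂ v₂ u'₀ v'₀ u'₁ v'₁ u'₂ v'₂ j j' i q q') :
    IsCofiber j q := G.isUnion.isCofiber_inr

lemma isPushout (G : IsCofiberGrid u₀ v₀ u₁ v₁ u₂ v₂ u'₀ v'₀ u'₁ v'₁ u'₂ v'₂ j j' i q q') :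
    IsPushout i q v₁ u'₂ := by
  refine G.isCofiber_j.isPushout_of_comp (by rw [G.ji]; exact G.col₁) ?_
  apply G.isUnion.isPushout.hom_ext
  · rw [← assoc, G.isUnion.iq, ← G.w₁₀, ← assoc, G.j'i]
  · rw [← assoc, G.isUnion.i'q, zero_comp, ← assoc, G.ji, G.col₁.w]

lemma isCofiber_i (G : IsCofiberGrid u₀ v₀ u₁ v₁ u₂ v₂ u'₀ v'₀ u'₁ v'₁ u'₂ v'₂ j j' i q q') :
    IsCofiber i (v₁ ≫ v'₂) :=
  have := G.isPushout.paste_vert G.row₂.isPushout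
  ⟨G.cofibration, by rwa [comp_toZero] at this⟩

variable [ChosenCones C]

lemma δ_j : G.isCofiber_j.δ = (γ C).map u'₂ ≫ G.col₁.δ :=
  G.isCofiber_j.δ_natural_id G.col₁ i u'₂ G.ji G.isPushout.w.symm

lemma δ_i_comp_q : G.isCofiber_i.δ ≫ (suspension C).map ((γ C).map q) = G.row₂.δ := by
  rw [G.isCofiber_i.δ_natural G.row₂ q v₁ (𝟙 _) G.isPushout.w (by rw [comp_id]),
    CategoryTheory.Functor.map_id, id_comp]

lemma δ_symm_i : G.symm.isCofiber_i.δ = G.isCofiber_i.δ := by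
  rw [G.symm.isCofiber_i.δ_natural_id G.isCofiber_i (𝟙 _) (𝟙 _) (comp_id _)
    (by rw [comp_id, id_comp, G.w₁₁]), CategoryTheory.Functor.map_id, id_comp]

lemma δ_i_comp_q' : G.isCofiber_i.δ ≫ (suspension C).map ((γ C).map q') = G.col₂.δ := by
  rw [← G.δ_symm_i, G.symm.δ_i_comp_q]

variable [Preadditive (Ho C)] [HasBinaryBiproducts (Ho C)] [IsStable C] [(suspension C).Additive]

/-- The two ways to get from `X₂₂` to `Σ²X₀₀` in a grid anticommute. -/
lemma δ_comp_δ : G.row₂.δ ≫ (suspension C).map G.isUnion.isCofiber.δ =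
    -(G.col₂.δ ≫ (suspension C).map G.isUnion.isCofiber'.δ) := by
  rw [← G.δ_i_comp_q, ← G.δ_i_comp_q', assoc, assoc, ← Functor.map_comp, ← Functor.map_comp,
    G.isUnion.map_comp_δ_eq_neg, Functor.map_neg, Preadditive.comp_neg, neg_neg]

lemma isHoCartesian₁
    (G : IsCofiberGrid u₀ v₀ u₁ v₁ u₂ v₂ u'₀ v'₀ u'₁ v'₁ u'₂ v'₂ j j' i q q') :
    IsHoCartesian ((γ C).map u₀) ((γ C).map u'₀) ((γ C).map j') ((γ C).map j) :=
  have := G.isUnion.isCofiber'.cofibration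
  isHoCartesian_of_isPushout G.isUnion.isPushout.flip

lemma isHoCartesian₂
    (G : IsCofiberGrid u₀ v₀ u₁ v₁ u₂ v₂ u'₀ v'₀ u'₁ v'₁ u'₂ v'₂ j j' i q q') :
    IsHoCartesian ((γ C).map q) ((γ C).map i) ((γ C).map u'₂) ((γ C).map v₁) :=
  have := G.cofibration
  isHoCartesian_of_isPushout G.isPushout

lemma isHoCartesian₄ : IsHoCartesian G.col₁.δ ((γ C).map v'₂) ((suspension C).map ((γ C).map j))
    G.isCofiber_i.δ := by
  obtain rfl := G.ji
  have := G.isCofiber_j.cofibration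
  exact isHoCartesian_of_comp G.col₁ G.isCofiber_i v'₂ rfl

end IsCofiberGrid

end Grid

section Bifunctor

lemma bifunctor_comm {C : Type u₁} [Category.{v₁} C] {D : Type u₂} [Category.{v₂} D] {E : Type u₃}
    [Category.{v₃} E] (F : C × D ⥤ E) {X Y : C} {X' Y' : D} (f : X ⟶ Y) (f' : X' ⟶ Y') :
    F.map (f ×ₘ 𝟙 X') ≫ F.map (𝟙 Y ×ₘ f') = F.map (𝟙 X ×ₘ f') ≫ F.map (f ×ₘ 𝟙 Y') := by
  rw [← Functor.map_comp, ← Functor.map_comp]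
  simp

variable {C : Type u₁} [Category.{v₁} C] [CofibrationCategory C] [HasZeroObject C]
  {D : Type u₂} [Category.{v₂} D] [CofibrationCategory D] [HasZeroObject D]

lemma IsExactFunctor.isCofiber {G : C ⥤ D} (hG : IsExactFunctor G) {X Y Z : C} {f : X ⟶ Y}
    {g : Y ⟶ Z} (h : IsCofiber f g) : IsCofiber (G.map f) (G.map g) where
  cofibration := hG.cofibration f h.cofibration
  isPushout := (hG.isPushout h.cofibration h.isPushout).of_iso (Iso.refl _) (Iso.refl _)
    (hG.isZero.iso (isZero_zero D)) (Iso.refl _) (by simp)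
    ((isZero_zero D).eq_of_tgt _ _) (by simp) (hG.isZero.eq_of_src _ _)

lemma IsExactFunctor.isConeSeq {G : C ⥤ D} (hG : IsExactFunctor G) {X A S : C} {i : X ⟶ A}
    {s : A ⟶ S} (h : IsConeSeq i s) : IsConeSeq (G.map i) (G.map s) where
  isCofiber := hG.isCofiber h.isCofiber
  contractible := (hG.mapCone h.coneOf).contractible

variable {E : Type u₃} [Category.{v₃} E] [CofibrationCategory E] [HasZeroObject E]

namespace IsBiexactFunctor

variable {F : C × D ⥤ E}

lemma isCofiber_left (hF : IsBiexactFunctor F) {X Y Z : C} {f : X ⟶ Y} {g : Y ⟶ Z}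
    (h : IsCofiber f g) (X' : D) : IsCofiber (F.map (f ×ₘ 𝟙 X')) (F.map (g ×ₘ 𝟙 X')) :=
  (hF.exact_left X').isCofiber h

lemma isCofiber_right (hF : IsBiexactFunctor F) (X : C) {X' Y' Z' : D} {f : X' ⟶ Y'} {g : Y' ⟶ Z'}
    (h : IsCofiber f g) : IsCofiber (F.map (𝟙 X ×ₘ f)) (F.map (𝟙 X ×ₘ g)) :=
  (hF.exact_right X).isCofiber h

/-- A biexact functor sends two cofiber sequences to a grid. -/
lemma exists_isCofiberGrid (hF : IsBiexactFunctor F) {X Y Z : C} {f : X ⟶ Y} {g : Y ⟶ Z}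
    (h : IsCofiber f g) {X' Y' Z' : D} {f' : X' ⟶ Y'} {g' : Y' ⟶ Z'} (h' : IsCofiber f' g') :
    ∃ (W : E) (j : F.obj (X, Y') ⟶ W) (j' : F.obj (Y, X') ⟶ W) (i : W ⟶ F.obj (Y, Y'))
      (q : W ⟶ F.obj (Z, X')) (q' : W ⟶ F.obj (X, Z')),
      IsCofiberGrid (F.map (f ×ₘ 𝟙 X')) (F.map (g ×ₘ 𝟙 X')) (F.map (f ×ₘ 𝟙 Y'))
        (F.map (g ×ₘ 𝟙 Y')) (F.map (f ×ₘ 𝟙 Z')) (F.map (g ×ₘ 𝟙 Z')) (F.map (𝟙 X ×ₘ f'))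
        (F.map (𝟙 X ×ₘ g')) (F.map (𝟙 Y ×ₘ f')) (F.map (𝟙 Y ×ₘ g')) (F.map (𝟙 Z ×ₘ f'))
        (F.map (𝟙 Z ×ₘ g')) j j' i q q' := by
  have col := hF.isCofiber_left h
  have row := fun T => hF.isCofiber_right T h'
  have cu := (col X').cofibration
  have sq := IsPushout.of_hasPushout (F.map (f ×ₘ 𝟙 X')) (F.map (𝟙 X ×ₘ f'))
  obtain ⟨i, i₁, i₂⟩ : ∃ i, pushout.inl _ _ ≫ i = F.map (𝟙 Y ×ₘ f') ∧
      pushout.inr _ _ ≫ i = F.map (f ×ₘ 𝟙 Y') :=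
    ⟨sq.desc _ _ (bifunctor_comm F f f'), sq.inl_desc _ _ _, sq.inr_desc _ _ _⟩
  obtain ⟨q, q₁, q₂⟩ : ∃ q, pushout.inl _ _ ≫ q = F.map (g ×ₘ 𝟙 X') ∧ pushout.inr _ _ ≫ q = 0 :=
    ⟨sq.desc _ 0 (by rw [(col X').w, comp_zero]), sq.inl_desc _ _ _, sq.inr_desc _ _ _⟩
  obtain ⟨q', q'₁, q'₂⟩ : ∃ q', pushout.inl _ _ ≫ q' = 0 ∧
      pushout.inr _ _ ≫ q' = F.map (𝟙 X ×ₘ g') :=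
    ⟨sq.desc 0 _ (by rw [(row X).w, comp_zero]), sq.inl_desc _ _ _, sq.inr_desc _ _ _⟩
  exact ⟨_, _, _, i, q, q', ⟨col X', row X, sq, q₁, q₂, q'₁, q'₂⟩,
    hF.cofibration f f' h.cofibration h'.cofibration _ _ sq.flip i i₂ i₁, i₂, i₁, col Y', col Z',
    row Y, row Z, bifunctor_comm F f g', (bifunctor_comm F g f').symm,
    bifunctor_comm F g g'⟩

end IsBiexactFunctor

end Bifunctor

end CofibrationCategory

namespace CofibrationCategory

set_option linter.unusedSectionVars false

/-! ### Functors induced by exact functors -/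

section ExactFunctor

variable {C : Type u₁} [Category.{v₁} C] [CofibrationCategory C] [HasZeroObject C]
  {D : Type u₂} [Category.{v₂} D] [CofibrationCategory D] [HasZeroObject D] {G : C ⥤ D}

lemma IsExactFunctor.map_zero (hG : IsExactFunctor G) (X Y : C) : G.map (0 : X ⟶ Y) = 0 := by
  rw [← toZero_comp_fromZero, Functor.map_comp, hG.isZero.eq_of_tgt (G.map (toZero X)) 0, zero_comp]

/-- A functor between the homotopy categories which is induced by `G`, up to isomorphism. -/
structure HoLift (G : C ⥤ D) where
  functor : Ho C ⥤ Ho D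
  iso (X : C) : functor.obj ((γ C).obj X) ≅ (γ D).obj (G.obj X)
  w {X Y : C} (f : X ⟶ Y) :
    functor.map ((γ C).map f) ≫ (iso Y).hom = (iso X).hom ≫ (γ D).map (G.map f)

namespace HoLift

variable [ChosenCones C] [ChosenCones D] (L : HoLift G) (hG : IsExactFunctor G)

/-- The canonical comparison of the suspensions, for the functor induced by an exact functor. -/
noncomputable def θ (X : C) : L.functor.obj ((suspension C).obj ((γ C).obj X)) ⟶
    (suspension D).obj (L.functor.obj ((γ C).obj X)) :=
  L.functor.map (suspIso X).inv ≫ (L.iso (susp X)).hom ≫ (hG.isConeSeq (isConeSeq_cone X)).σ ≫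
    (suspension D).map (L.iso X).inv

instance isIso_θ (X : C) : IsIso (L.θ hG X) := by
  dsimp only [θ]
  infer_instance

/-- Whether `θ` computes `σ` does not change along a morphism of cones that is the identity on
the base. -/
lemma map_σ_iff {X A S A' S' : C} {i : X ⟶ A} {s : A ⟶ S} (h : IsConeSeq i s) {i' : X ⟶ A'}
    {s' : A' ⟶ S'} (h' : IsConeSeq i' s') (b : A ⟶ A') (hb : i ≫ b = i') :
    L.functor.map h.σ ≫ L.θ hG X =
      (L.iso S).hom ≫ (hG.isConeSeq h).σ ≫ (suspension D).map (L.iso X).inv ↔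
    L.functor.map h'.σ ≫ L.θ hG X =
      (L.iso S').hom ≫ (hG.isConeSeq h').σ ≫ (suspension D).map (L.iso X).inv := by
  obtain ⟨c, hc⟩ := h.isCofiber.exists_desc (b ≫ s') (by
    rw [← assoc, hb, h'.isCofiber.w])
  have e := h.σ_natural_id h' b c hb hc
  have e' := (hG.isConeSeq h).σ_natural_id (hG.isConeSeq h') (G.map b) (G.map c)
    (by rw [← Functor.map_comp, hb]) (by rw [← Functor.map_comp, hc, Functor.map_comp])
  have : IsIso ((γ C).map c) := by
    have : IsIso ((γ C).map c ≫ h'.σ) := by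
      rw [← e]
      infer_instance
    exact IsIso.of_isIso_comp_right _ h'.σ
  rw [e', assoc, ← reassoc_of% L.w c, e, Functor.map_comp, assoc, cancel_epi]

/-- The comparison of suspensions can be computed by any cone. -/
lemma map_σ {X A S : C} {i : X ⟶ A} {s : A ⟶ S} (h : IsConeSeq i s) :
    L.functor.map h.σ ≫ L.θ hG X =
      (L.iso S).hom ≫ (hG.isConeSeq h).σ ≫ (suspension D).map (L.iso X).inv := by
  have := h.isCofiber.cofibration
  -- a cone containing both the given and the chosen cone
  obtain ⟨K, S', a, k, s', hk, -, -, hs'⟩ := IsConeSeq.exists_extension (cone X).ι (𝟙 X) i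
  rw [id_comp] at hk
  rw [L.map_σ_iff hG h (hs' inferInstance) k rfl,
    ← L.map_σ_iff hG (isConeSeq_cone X) (hs' inferInstance) a hk, IsConeSeq.σ_cone, θ,
    ← Functor.map_comp_assoc, Iso.hom_inv_id, CategoryTheory.Functor.map_id, id_comp]

/-- The functor induced by an exact functor is compatible with connecting morphisms. -/
lemma map_δ {X Y Z : C} {f : X ⟶ Y} {p : Y ⟶ Z} (h : IsCofiber f p) :
    L.functor.map h.δ ≫ L.θ hG X ≫ (suspension D).map (L.iso X).hom =
      (L.iso Z).hom ≫ (hG.isCofiber h).δ := by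
  have hA := isConeSeq_cone X
  have sq := IsPushout.of_hasPushout (cone X).ι f
  have z : (cone X).ι ≫ (0 : _ ⟶ Z) = f ≫ p := by rw [h.w, comp_zero]
  have y : (cone X).ι ≫ quotπ (cone X).ι = f ≫ 0 := by rw [hA.isCofiber.w, comp_zero]
  have wc : WeakEquivalence (sq.desc _ _ z) :=
    (h.of_isPushout sq.flip (sq.inr_desc _ _ z) (sq.inl_desc _ _ z)).weakEquivalence
      hA.contractible
  have e := h.δ_eq hA sq (sq.inl_desc _ _ z) (sq.inr_desc _ _ z) (sq.inl_desc _ _ y)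
    (sq.inr_desc _ _ y)
  have e' := (hG.isCofiber h).δ_eq (hG.isConeSeq hA) (hG.isPushout inferInstance sq)
    (c := G.map (sq.desc _ _ z)) (d := G.map (sq.desc _ _ y))
    (by rw [← Functor.map_comp, sq.inl_desc, hG.map_zero])
    (by rw [← Functor.map_comp, sq.inr_desc]) (by rw [← Functor.map_comp, sq.inl_desc])
    (by rw [← Functor.map_comp, sq.inr_desc, hG.map_zero])
  rw [← cancel_epi (L.functor.map ((γ C).map (sq.desc _ _ z))), ← Functor.map_comp_assoc, e,
    Functor.map_comp_assoc, ← assoc (L.functor.map hA.σ), L.map_σ hG hA, ← assoc _ (L.iso Z).hom,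
    L.w, assoc, assoc, assoc, e', ← Functor.map_comp, Iso.inv_hom_id,
    CategoryTheory.Functor.map_id, comp_id, reassoc_of% L.w (sq.desc _ _ y)]

lemma θ_natural {X Y : C} (f : X ⟶ Y) :
    L.functor.map ((suspension C).map ((γ C).map f)) ≫ L.θ hG Y =
      L.θ hG X ≫ (suspension D).map (L.functor.map ((γ C).map f)) := by
  have hA := isConeSeq_cone X
  obtain ⟨K, S, a, k, s, hk, -, -, hs⟩ := IsConeSeq.exists_extension (cone X).ι f (cone Y).ι
  have hK := hs inferInstance
  obtain ⟨c, hc⟩ := hA.isCofiber.exists_desc (a ≫ s) (by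
    rw [← assoc, hk, assoc, hK.isCofiber.w, comp_zero])
  have e := hA.σ_natural hK f a c hk hc
  have e' := (hG.isConeSeq hA).σ_natural (hG.isConeSeq hK) (G.map f) (G.map a) (G.map c)
    (by rw [← Functor.map_comp, hk, Functor.map_comp])
    (by rw [← Functor.map_comp, hc, Functor.map_comp])
  have e'' : (L.iso X).inv ≫ L.functor.map ((γ C).map f) =
      (γ D).map (G.map f) ≫ (L.iso Y).inv := by
    rw [Iso.inv_comp_eq, ← assoc, Iso.eq_comp_inv, L.w]
  rw [← cancel_epi (L.functor.map hA.σ), ← Functor.map_comp_assoc, e, Functor.map_comp_assoc,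
    L.map_σ hG hK, reassoc_of% L.map_σ hG hA, reassoc_of% L.w c, ← reassoc_of% e',
    ← Functor.map_comp, ← Functor.map_comp, e'']

/-- The comparison of suspensions is natural in the exact functor. -/
lemma θ_natural_functor {G' : C ⥤ D} (L' : HoLift G') (hG' : IsExactFunctor G') (η : G ⟶ G')
    (τ : L.functor ⟶ L'.functor)
    (hτ : ∀ X, τ.app ((γ C).obj X) ≫ (L'.iso X).hom = (L.iso X).hom ≫ (γ D).map (η.app X)) (X : C) :
    τ.app ((suspension C).obj ((γ C).obj X)) ≫ L'.θ hG' X =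
      L.θ hG X ≫ (suspension D).map (τ.app ((γ C).obj X)) := by
  have e := (hG.isConeSeq (isConeSeq_cone X)).σ_natural (hG'.isConeSeq (isConeSeq_cone X))
    (η.app X) (η.app _) (η.app _) (η.naturality _) (η.naturality _)
  have e' : (L.iso X).inv ≫ τ.app ((γ C).obj X) = (γ D).map (η.app X) ≫ (L'.iso X).inv := by
    rw [Iso.inv_comp_eq, ← assoc, Iso.eq_comp_inv, hτ]
  rw [θ, θ, ← τ.naturality_assoc, reassoc_of% hτ (susp X), assoc, assoc, assoc,
    ← Functor.map_comp, e', Functor.map_comp, reassoc_of% e]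

end HoLift

end ExactFunctor

end CofibrationCategory

namespace CofibrationCategory

set_option linter.unusedSectionVars false

/-! ### The suspension isomorphisms of a biexact functor -/

namespace IsBiexactFunctor

variable {C : Type u₁} [Category.{v₁} C] [CofibrationCategory C]
  {D : Type u₂} [Category.{v₂} D] [CofibrationCategory D]
  {E : Type u₃} [Category.{v₃} E] [CofibrationCategory E] {F : C × D ⥤ E}
  (hF : IsBiexactFunctor F)

/-- The value of the induced functor on the images of objects of `C` and `D`. -/
noncomputable def iso (X : C) (X' : D) :
    hF.ho.obj ((γ C).obj X, (γ D).obj X') ≅ (γ E).obj (F.obj (X, X')) :=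
  Iso.refl ((γ E).obj (F.obj (X, X')))

lemma map_iso {X Y : C} {X' Y' : D} (f : X ⟶ Y) (f' : X' ⟶ Y') :
    hF.ho.map ((γ C).map f ×ₘ (γ D).map f') ≫ (hF.iso Y Y').hom =
      (hF.iso X X').hom ≫ (γ E).map (F.map (f ×ₘ f')) := by
  have e₁ : hF.ho.map ((γ C).map f ×ₘ (γ D).map f') = (γ E).map (F.map (f ×ₘ f')) :=
    eq_of_heq (Functor.hcongr_hom hF.fac (f ×ₘ f'))
  have e₂ : (γ E).map (F.map (f ×ₘ f')) ≫ 𝟙 ((γ E).obj (F.obj (Y, Y'))) =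
      𝟙 ((γ E).obj (F.obj (X, X'))) ≫ (γ E).map (F.map (f ×ₘ f')) := by
    rw [comp_id, id_comp]
  refine Eq.trans ?_ e₂
  exact congrArg (fun φ => φ ≫ 𝟙 ((γ E).obj (F.obj (Y, Y')))) e₁

/-- The functor induced by `F(-, X')`. -/
noncomputable def liftLeft (X' : D) : HoLift (Prod.sectL C X' ⋙ F) where
  functor := Prod.sectL (Ho C) ((γ D).obj X') ⋙ hF.ho
  iso X := hF.iso X X'
  w f := by
    have := hF.map_iso f (𝟙 X')
    rwa [CategoryTheory.Functor.map_id] at this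

/-- The functor induced by `F(X, -)`. -/
noncomputable def liftRight (X : C) : HoLift (Prod.sectR X D ⋙ F) where
  functor := Prod.sectR ((γ C).obj X) (Ho D) ⋙ hF.ho
  iso X' := hF.iso X X'
  w f := by
    have := hF.map_iso (𝟙 X) f
    rwa [CategoryTheory.Functor.map_id] at this

variable [HasZeroObject C] [HasZeroObject D] [HasZeroObject E] [ChosenCones C] [ChosenCones D]
  [ChosenCones E]

/-- The canonical morphism `F(ΣX, X') ⟶ ΣF(X, X')`. -/
noncomputable def θApp (X : C) (X' : D) :
    hF.ho.obj ((suspension C).obj ((γ C).obj X), (γ D).obj X') ⟶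
      (suspension E).obj (hF.ho.obj ((γ C).obj X, (γ D).obj X')) :=
  (hF.liftLeft X').θ (hF.exact_left X') X

/-- The canonical morphism `F(X, ΣX') ⟶ ΣF(X, X')`. -/
noncomputable def ζApp (X : C) (X' : D) :
    hF.ho.obj ((γ C).obj X, (suspension D).obj ((γ D).obj X')) ⟶
      (suspension E).obj (hF.ho.obj ((γ C).obj X, (γ D).obj X')) :=
  (hF.liftRight X).θ (hF.exact_right X) X'

instance (X : C) (X' : D) : IsIso (hF.θApp X X') :=
  (hF.liftLeft X').isIso_θ (hF.exact_left X') X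

instance (X : C) (X' : D) : IsIso (hF.ζApp X X') :=
  (hF.liftRight X).isIso_θ (hF.exact_right X) X'

lemma θApp_natural {X Y : C} {X' Y' : D} (f : X ⟶ Y) (f' : X' ⟶ Y') :
    hF.ho.map ((suspension C).map ((γ C).map f) ×ₘ (γ D).map f') ≫ hF.θApp Y Y' =
      hF.θApp X X' ≫ (suspension E).map (hF.ho.map ((γ C).map f ×ₘ (γ D).map f')) := by
  have e₁ : hF.ho.map ((suspension C).map ((γ C).map f) ×ₘ 𝟙 _) ≫ hF.θApp Y X' =
      hF.θApp X X' ≫ (suspension E).map (hF.ho.map ((γ C).map f ×ₘ 𝟙 _)) :=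
    (hF.liftLeft X').θ_natural (hF.exact_left X') f
  have e₂ : hF.ho.map (𝟙 _ ×ₘ (γ D).map f') ≫ hF.θApp Y Y' =
      hF.θApp Y X' ≫ (suspension E).map (hF.ho.map (𝟙 _ ×ₘ (γ D).map f')) :=
    (hF.liftLeft X').θ_natural_functor (hF.exact_left X') (hF.liftLeft Y') (hF.exact_left Y')
      { app := fun T => F.map (𝟙 T ×ₘ f')
        naturality := fun _ _ a => bifunctor_comm F a f' }
      { app := fun T => hF.ho.map (𝟙 T ×ₘ (γ D).map f')
        naturality := fun _ _ a => bifunctor_comm hF.ho a ((γ D).map f') }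
      (fun T => (hF.liftRight T).w f') Y
  have e₃ : ((suspension C).map ((γ C).map f) ×ₘ (γ D).map f') =
    ((suspension C).map ((γ C).map f) ×ₘ 𝟙 ((γ D).obj X')) ≫ (𝟙 _ ×ₘ (γ D).map f') := by simp
  have e₄ : ((γ C).map f ×ₘ (γ D).map f') =
    ((γ C).map f ×ₘ 𝟙 ((γ D).obj X')) ≫ (𝟙 _ ×ₘ (γ D).map f') := by simp
  rw [e₃, e₄, Functor.map_comp, Functor.map_comp, Functor.map_comp, assoc, e₂, reassoc_of% e₁]

lemma ζApp_natural {X Y : C} {X' Y' : D} (f : X ⟶ Y) (f' : X' ⟶ Y') :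
    hF.ho.map ((γ C).map f ×ₘ (suspension D).map ((γ D).map f')) ≫ hF.ζApp Y Y' =
      hF.ζApp X X' ≫ (suspension E).map (hF.ho.map ((γ C).map f ×ₘ (γ D).map f')) := by
  have e₁ : hF.ho.map (𝟙 _ ×ₘ (suspension D).map ((γ D).map f')) ≫ hF.ζApp X Y' =
      hF.ζApp X X' ≫ (suspension E).map (hF.ho.map (𝟙 _ ×ₘ (γ D).map f')) :=
    (hF.liftRight X).θ_natural (hF.exact_right X) f'
  have e₂ : hF.ho.map ((γ C).map f ×ₘ 𝟙 _) ≫ hF.ζApp Y Y' =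
      hF.ζApp X Y' ≫ (suspension E).map (hF.ho.map ((γ C).map f ×ₘ 𝟙 _)) :=
    (hF.liftRight X).θ_natural_functor (hF.exact_right X) (hF.liftRight Y) (hF.exact_right Y)
      { app := fun T => F.map (f ×ₘ 𝟙 T)
        naturality := fun _ _ a => (bifunctor_comm F f a).symm }
      { app := fun T => hF.ho.map ((γ C).map f ×ₘ 𝟙 T)
        naturality := fun _ _ a => (bifunctor_comm hF.ho ((γ C).map f) a).symm }
      (fun T => (hF.liftLeft T).w f) Y'
  have e₃ : ((γ C).map f ×ₘ (suspension D).map ((γ D).map f')) =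
    (𝟙 ((γ C).obj X) ×ₘ (suspension D).map ((γ D).map f')) ≫ ((γ C).map f ×ₘ 𝟙 _) := by simp
  have e₄ : ((γ C).map f ×ₘ (γ D).map f') =
    (𝟙 ((γ C).obj X) ×ₘ (γ D).map f') ≫ ((γ C).map f ×ₘ 𝟙 _) := by simp
  rw [e₃, e₄, Functor.map_comp, Functor.map_comp, Functor.map_comp, assoc, e₂, reassoc_of% e₁]

/-- A family of isomorphisms indexed by objects of `C` and `D` which is natural with respect to
morphisms of `C` and `D` extends to the homotopy categories. -/
lemma exists_natIso {T : Type*} [Category T] {G H : Ho C × Ho D ⥤ T}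
    (η : ∀ (X : C) (X' : D), G.obj ((γ C).obj X, (γ D).obj X') ⟶ H.obj ((γ C).obj X, (γ D).obj X'))
    [∀ X X', IsIso (η X X')]
    (hη : ∀ {X Y : C} {X' Y' : D} (f : X ⟶ Y) (f' : X' ⟶ Y'),
      G.map ((γ C).map f ×ₘ (γ D).map f') ≫ η Y Y' =
        η X X' ≫ H.map ((γ C).map f ×ₘ (γ D).map f')) :
    ∃ e : G ≅ H, ∀ (X : C) (X' : D), e.hom.app ((γ C).obj X, (γ D).obj X') = η X X' := by
  let τ : (γ C).prod (γ D) ⋙ G ≅ (γ C).prod (γ D) ⋙ H :=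
    NatIso.ofComponents (fun P => asIso (η P.1 P.2)) (fun f => hη f.1 f.2)
  let W := (weakEquivalences C).prod (weakEquivalences D)
  let _ : Localization.Lifting ((γ C).prod (γ D)) W ((γ C).prod (γ D) ⋙ G) G := ⟨Iso.refl _⟩
  let _ : Localization.Lifting ((γ C).prod (γ D)) W ((γ C).prod (γ D) ⋙ H) H := ⟨Iso.refl _⟩
  refine ⟨Localization.liftNatIso ((γ C).prod (γ D)) W _ _ G H τ, fun X X' => ?_⟩
  refine (Localization.liftNatTrans_app ((γ C).prod (γ D)) W _ _ G H τ.hom (X, X')).trans ?_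
  exact (id_comp _).trans (comp_id _)

/-- The canonical isomorphism `F(Σ-, -) ≅ ΣF(-, -)`. -/
noncomputable def θIso : (suspension C).prod (𝟭 (Ho D)) ⋙ hF.ho ≅ hF.ho ⋙ suspension E :=
  (exists_natIso (G := (suspension C).prod (𝟭 (Ho D)) ⋙ hF.ho) (H := hF.ho ⋙ suspension E)
    hF.θApp hF.θApp_natural).choose

lemma θIso_app (X : C) (X' : D) :
    hF.θIso.hom.app ((γ C).obj X, (γ D).obj X') = hF.θApp X X' :=
  (exists_natIso (G := (suspension C).prod (𝟭 (Ho D)) ⋙ hF.ho) (H := hF.ho ⋙ suspension E)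
    hF.θApp hF.θApp_natural).choose_spec X X'

/-- The canonical isomorphism `F(-, Σ-) ≅ ΣF(-, -)`. -/
noncomputable def ζIso : (𝟭 (Ho C)).prod (suspension D) ⋙ hF.ho ≅ hF.ho ⋙ suspension E :=
  (exists_natIso (G := (𝟭 (Ho C)).prod (suspension D) ⋙ hF.ho) (H := hF.ho ⋙ suspension E)
    hF.ζApp hF.ζApp_natural).choose

lemma ζIso_app (X : C) (X' : D) :
    hF.ζIso.hom.app ((γ C).obj X, (γ D).obj X') = hF.ζApp X X' :=
  (exists_natIso (G := (𝟭 (Ho C)).prod (suspension D) ⋙ hF.ho) (H := hF.ho ⋙ suspension E)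
    hF.ζApp hF.ζApp_natural).choose_spec X X'

lemma map_δ_left {X Y Z : C} {f : X ⟶ Y} {p : Y ⟶ Z} (h : IsCofiber f p) (X' : D) :
    hF.ho.map (h.δ ×ₘ 𝟙 ((γ D).obj X')) ≫ hF.θApp X X' ≫ (suspension E).map (hF.iso X X').hom =
      (hF.iso Z X').hom ≫ (hF.isCofiber_left h X').δ :=
  (hF.liftLeft X').map_δ (hF.exact_left X') h

lemma map_δ_right (X : C) {X' Y' Z' : D} {f' : X' ⟶ Y'} {p' : Y' ⟶ Z'} (h : IsCofiber f' p') :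
    hF.ho.map (𝟙 ((γ C).obj X) ×ₘ h.δ) ≫ hF.ζApp X X' ≫ (suspension E).map (hF.iso X X').hom =
      (hF.iso X Z').hom ≫ (hF.isCofiber_right X h).δ :=
  (hF.liftRight X).map_δ (hF.exact_right X) h

end IsBiexactFunctor

end CofibrationCategory

namespace CofibrationCategory

set_option linter.unusedSectionVars false

/-! ### Exact sequences and distinguished triangles -/

section

variable {C : Type u} [Category.{v} C] [CofibrationCategory C] [HasZeroObject C] [ChosenCones C]
  [HoTriangulation C]

lemma mem_distTriang_iff_isExact {A B D : Ho C} (f : A ⟶ B) (g : B ⟶ D) (h : D ⟶ A⟦(1 : ℤ)⟧) :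
    Triangle.mk f g h ∈ distTriang (Ho C) ↔
      IsExact f g (h ≫ HoTriangulation.shiftIso.hom.app A) := by
  rw [HoTriangulation.mem_distTriang_iff]
  exact (isExactTriangle_iff _).symm

lemma IsHoCartesian.isHomotopyCartesian {A U V X : Ho C} {g : A ⟶ V} {f : A ⟶ U} {f' : V ⟶ X}
    {g' : U ⟶ X} (H : IsHoCartesian g f f' g') :
    TriangulatedBifunctor.IsHomotopyCartesian g f f' g' := by
  obtain ⟨w, d, H⟩ := H
  refine ⟨w, d ≫ HoTriangulation.shiftIso.inv.app A, ?_⟩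
  rw [mem_distTriang_iff_isExact, assoc, Iso.inv_hom_id_app, comp_id]
  exact H

/-- The isomorphism `A⟦1⟧ ≅ ΣB` induced by an isomorphism `A ≅ B`. -/
noncomputable def shiftMapIso {A B : Ho C} (a : A ≅ B) : A⟦(1 : ℤ)⟧ ≅ (suspension C).obj B :=
  HoTriangulation.shiftIso.app A ≪≫ (suspension C).mapIso a

lemma shiftMapIso_hom {A B : Ho C} (a : A ≅ B) : (shiftMapIso a).hom =
    HoTriangulation.shiftIso.hom.app A ≫ (suspension C).map a.hom := rfl

lemma shiftMapIso_naturality {A B A' B' : Ho C} {a : A ≅ B} {a' : A' ≅ B'} {φ : A ⟶ A'}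
    {ψ : B ⟶ B'} (h : φ ≫ a'.hom = a.hom ≫ ψ) :
    φ⟦(1 : ℤ)⟧' ≫ (shiftMapIso a').hom = (shiftMapIso a).hom ≫ (suspension C).map ψ := by
  rw [shiftMapIso_hom, shiftMapIso_hom, NatTrans.naturality_assoc, assoc, ← Functor.map_comp,
    ← Functor.map_comp, h]

/-- Any distinguished triangle is isomorphic to the elementary one of some cofibration. -/
lemma exists_isCofiber_of_mem_distTriang (t : Triangle (Ho C)) (ht : t ∈ distTriang (Ho C)) :
    ∃ (X Y Z : C) (f : X ⟶ Y) (p : Y ⟶ Z) (H : IsCofiber f p) (a₁ : t.obj₁ ≅ (γ C).obj X)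
      (a₂ : t.obj₂ ≅ (γ C).obj Y) (a₃ : t.obj₃ ≅ (γ C).obj Z),
      t.mor₁ ≫ a₂.hom = a₁.hom ≫ (γ C).map f ∧ t.mor₂ ≫ a₃.hom = a₂.hom ≫ (γ C).map p ∧
        t.mor₃ ≫ (shiftMapIso a₁).hom = a₃.hom ≫ H.δ := by
  obtain ⟨X, Y, Z, f, p, H, a₁, a₂, a₃, h₁, h₂, h₃⟩ :=
    (mem_distTriang_iff_isExact t.mor₁ t.mor₂ t.mor₃).1 ht
  rw [assoc] at h₃
  exact ⟨X, Y, Z, f, p, H, a₁, a₂, a₃, h₁, h₂, h₃⟩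

end

/-! ### The induced functor is biexact -/

namespace IsBiexactFunctor

variable {C : Type u₁} [Category.{v₁} C] [CofibrationCategory C] [HasZeroObject C] [ChosenCones C]
  {D : Type u₂} [Category.{v₂} D] [CofibrationCategory D] [HasZeroObject D] [ChosenCones D]
  {E : Type u₃} [Category.{v₃} E] [CofibrationCategory E] [HasZeroObject E] [ChosenCones E]
  {F : C × D ⥤ E} (hF : IsBiexactFunctor F)

/-- The isomorphism `F(A, A') ≅ γ(F(X, X'))` induced by isomorphisms `A ≅ γ(X)` and
`A' ≅ γ(X')`. -/
noncomputable def isoOfIso {A : Ho C} {X : C} (a : A ≅ (γ C).obj X) {A' : Ho D} {X' : D}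
    (a' : A' ≅ (γ D).obj X') : hF.ho.obj (A, A') ≅ (γ E).obj (F.obj (X, X')) :=
  hF.ho.mapIso (Iso.prod a a') ≪≫ hF.iso X X'

lemma isoOfIso_hom {A : Ho C} {X : C} (a : A ≅ (γ C).obj X) {A' : Ho D} {X' : D}
    (a' : A' ≅ (γ D).obj X') :
    (hF.isoOfIso a a').hom = hF.ho.map (a.hom ×ₘ a'.hom) ≫ (hF.iso X X').hom := rfl

lemma map_isoOfIso {A B : Ho C} {X Y : C} {a : A ≅ (γ C).obj X} {b : B ≅ (γ C).obj Y}
    {A' B' : Ho D} {X' Y' : D} {a' : A' ≅ (γ D).obj X'} {b' : B' ≅ (γ D).obj Y'} {φ : A ⟶ B}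
    {f : X ⟶ Y} (h : φ ≫ b.hom = a.hom ≫ (γ C).map f) {φ' : A' ⟶ B'} {f' : X' ⟶ Y'}
    (h' : φ' ≫ b'.hom = a'.hom ≫ (γ D).map f') :
    hF.ho.map (φ ×ₘ φ') ≫ (hF.isoOfIso b b').hom =
      (hF.isoOfIso a a').hom ≫ (γ E).map (F.map (f ×ₘ f')) := by
  rw [isoOfIso_hom, isoOfIso_hom, assoc, ← hF.map_iso, ← Functor.map_comp_assoc,
    ← Functor.map_comp_assoc, prod_comp, prod_comp, h, h']

lemma map_isoOfIso_left {A B : Ho C} {X Y : C} {a : A ≅ (γ C).obj X} {b : B ≅ (γ C).obj Y}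
    {A' : Ho D} {X' : D} (a' : A' ≅ (γ D).obj X') {φ : A ⟶ B} {f : X ⟶ Y}
    (h : φ ≫ b.hom = a.hom ≫ (γ C).map f) :
    hF.ho.map (φ ×ₘ 𝟙 A') ≫ (hF.isoOfIso b a').hom =
      (hF.isoOfIso a a').hom ≫ (γ E).map (F.map (f ×ₘ 𝟙 X')) :=
  hF.map_isoOfIso h (by rw [id_comp, CategoryTheory.Functor.map_id, comp_id])

lemma map_isoOfIso_right {A : Ho C} {X : C} (a : A ≅ (γ C).obj X) {A' B' : Ho D} {X' Y' : D}
    {a' : A' ≅ (γ D).obj X'} {b' : B' ≅ (γ D).obj Y'} {φ : A' ⟶ B'} {f : X' ⟶ Y'}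
    (h : φ ≫ b'.hom = a'.hom ≫ (γ D).map f) :
    hF.ho.map (𝟙 A ×ₘ φ) ≫ (hF.isoOfIso a b').hom =
      (hF.isoOfIso a a').hom ≫ (γ E).map (F.map (𝟙 X ×ₘ f)) :=
  hF.map_isoOfIso (by rw [id_comp, CategoryTheory.Functor.map_id, comp_id]) h

variable [HoTriangulation C] [HoTriangulation D] [HoTriangulation E]

/-- The canonical isomorphism `F(-⟦1⟧, -) ≅ F(-, -)⟦1⟧`. -/
noncomputable def θShift : (shiftFunctor (Ho C) (1 : ℤ)).prod (𝟭 (Ho D)) ⋙ hF.ho ≅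
    hF.ho ⋙ shiftFunctor (Ho E) (1 : ℤ) :=
  Functor.isoWhiskerRight (NatIso.prod HoTriangulation.shiftIso (Iso.refl _)) hF.ho ≪≫ hF.θIso ≪≫
    Functor.isoWhiskerLeft hF.ho HoTriangulation.shiftIso.symm

/-- The canonical isomorphism `F(-, -⟦1⟧) ≅ F(-, -)⟦1⟧`. -/
noncomputable def ζShift : (𝟭 (Ho C)).prod (shiftFunctor (Ho D) (1 : ℤ)) ⋙ hF.ho ≅
    hF.ho ⋙ shiftFunctor (Ho E) (1 : ℤ) :=
  Functor.isoWhiskerRight (NatIso.prod (Iso.refl _) HoTriangulation.shiftIso) hF.ho ≪≫ hF.ζIso ≪≫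
    Functor.isoWhiskerLeft hF.ho HoTriangulation.shiftIso.symm

/-- The component of `θShift`, with its source written in normal form. -/
noncomputable abbrev θShiftApp (A : Ho C) (A' : Ho D) :
    hF.ho.obj (A⟦(1 : ℤ)⟧, A') ⟶ (hF.ho.obj (A, A'))⟦(1 : ℤ)⟧ := hF.θShift.hom.app (A, A')

/-- The component of `ζShift`, with its source written in normal form. -/
noncomputable abbrev ζShiftApp (A : Ho C) (A' : Ho D) :
    hF.ho.obj (A, A'⟦(1 : ℤ)⟧) ⟶ (hF.ho.obj (A, A'))⟦(1 : ℤ)⟧ := hF.ζShift.hom.app (A, A')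

lemma θShiftApp_comp_shiftIso (A : Ho C) (A' : Ho D) :
    hF.θShiftApp A A' ≫ HoTriangulation.shiftIso.hom.app (hF.ho.obj (A, A')) =
      hF.ho.map (HoTriangulation.shiftIso.hom.app A ×ₘ 𝟙 A') ≫ hF.θIso.hom.app (A, A') := by
  change (hF.ho.map (HoTriangulation.shiftIso.hom.app A ×ₘ 𝟙 A') ≫ hF.θIso.hom.app (A, A') ≫
    HoTriangulation.shiftIso.inv.app (hF.ho.obj (A, A'))) ≫
    HoTriangulation.shiftIso.hom.app (hF.ho.obj (A, A')) = _
  rw [assoc, assoc, Iso.inv_hom_id_app]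
  congr 1
  exact comp_id _

lemma θShiftApp_comp {A : Ho C} {X : C} (a : A ≅ (γ C).obj X) {A' : Ho D} {X' : D}
    (a' : A' ≅ (γ D).obj X') :
    hF.θShiftApp A A' ≫ (shiftMapIso (hF.isoOfIso a a')).hom =
      hF.ho.map ((shiftMapIso a).hom ×ₘ a'.hom) ≫ hF.θApp X X' ≫
        (suspension E).map (hF.iso X X').hom := by
  have e₂ : hF.θIso.hom.app (A, A') ≫ (suspension E).map (hF.ho.map (a.hom ×ₘ a'.hom)) =
      hF.ho.map ((suspension C).map a.hom ×ₘ a'.hom) ≫ hF.θApp X X' := by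
    rw [← hF.θIso_app]
    exact (hF.θIso.hom.naturality (a.hom ×ₘ a'.hom)).symm
  rw [shiftMapIso_hom, isoOfIso_hom, reassoc_of% hF.θShiftApp_comp_shiftIso A A',
    Functor.map_comp, reassoc_of% e₂,
    ← Functor.map_comp_assoc, prod_comp, id_comp, shiftMapIso_hom]

lemma ζShiftApp_comp_shiftIso (A : Ho C) (A' : Ho D) :
    hF.ζShiftApp A A' ≫ HoTriangulation.shiftIso.hom.app (hF.ho.obj (A, A')) =
      hF.ho.map (𝟙 A ×ₘ HoTriangulation.shiftIso.hom.app A') ≫ hF.ζIso.hom.app (A, A') := by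
  change (hF.ho.map (𝟙 A ×ₘ HoTriangulation.shiftIso.hom.app A') ≫ hF.ζIso.hom.app (A, A') ≫
    HoTriangulation.shiftIso.inv.app (hF.ho.obj (A, A'))) ≫
    HoTriangulation.shiftIso.hom.app (hF.ho.obj (A, A')) = _
  rw [assoc, assoc, Iso.inv_hom_id_app]
  congr 1
  exact comp_id _

lemma ζShiftApp_comp {A : Ho C} {X : C} (a : A ≅ (γ C).obj X) {A' : Ho D} {X' : D}
    (a' : A' ≅ (γ D).obj X') :
    hF.ζShiftApp A A' ≫ (shiftMapIso (hF.isoOfIso a a')).hom =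
      hF.ho.map (a.hom ×ₘ (shiftMapIso a').hom) ≫ hF.ζApp X X' ≫
        (suspension E).map (hF.iso X X').hom := by
  have e₂ : hF.ζIso.hom.app (A, A') ≫ (suspension E).map (hF.ho.map (a.hom ×ₘ a'.hom)) =
      hF.ho.map (a.hom ×ₘ (suspension D).map a'.hom) ≫ hF.ζApp X X' := by
    rw [← hF.ζIso_app]
    exact (hF.ζIso.hom.naturality (a.hom ×ₘ a'.hom)).symm
  rw [shiftMapIso_hom, isoOfIso_hom, reassoc_of% hF.ζShiftApp_comp_shiftIso A A',
    Functor.map_comp, reassoc_of% e₂,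
    ← Functor.map_comp_assoc, prod_comp, id_comp, shiftMapIso_hom]

/-- The morphism `F(A₃, A') ⟶ F(A₁, A')⟦1⟧` induced by `φ : A₃ ⟶ A₁⟦1⟧` is the connecting morphism
of a cofibration if `φ` is. -/
lemma map_comp_θShiftApp {X Y Z : C} {f : X ⟶ Y} {p : Y ⟶ Z} (H : IsCofiber f p) {A₁ A₃ : Ho C}
    {a₁ : A₁ ≅ (γ C).obj X} {a₃ : A₃ ≅ (γ C).obj Z} {φ : A₃ ⟶ A₁⟦(1 : ℤ)⟧}
    (h : φ ≫ (shiftMapIso a₁).hom = a₃.hom ≫ H.δ) {A' : Ho D} {X' : D}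
    (a' : A' ≅ (γ D).obj X') :
    (hF.ho.map (φ ×ₘ 𝟙 A') ≫ hF.θShiftApp A₁ A') ≫ (shiftMapIso (hF.isoOfIso a₁ a')).hom =
      (hF.isoOfIso a₃ a').hom ≫ (hF.isCofiber_left H X').δ := by
  have e : (φ ×ₘ 𝟙 A') ≫ ((shiftMapIso a₁).hom ×ₘ a'.hom) =
      (a₃.hom ×ₘ a'.hom) ≫ (H.δ ×ₘ 𝟙 _) := by
    rw [prod_comp, prod_comp, h, id_comp, comp_id]
  rw [assoc, hF.θShiftApp_comp, ← Functor.map_comp_assoc, e, Functor.map_comp_assoc,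
    hF.map_δ_left, isoOfIso_hom, assoc]

lemma map_comp_ζShiftApp {A : Ho C} {X : C} (a : A ≅ (γ C).obj X) {X' Y' Z' : D} {f' : X' ⟶ Y'}
    {p' : Y' ⟶ Z'} (H : IsCofiber f' p') {A₁ A₃ : Ho D} {a₁ : A₁ ≅ (γ D).obj X'}
    {a₃ : A₃ ≅ (γ D).obj Z'} {φ : A₃ ⟶ A₁⟦(1 : ℤ)⟧}
    (h : φ ≫ (shiftMapIso a₁).hom = a₃.hom ≫ H.δ) :
    (hF.ho.map (𝟙 A ×ₘ φ) ≫ hF.ζShiftApp A A₁) ≫ (shiftMapIso (hF.isoOfIso a a₁)).hom =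
      (hF.isoOfIso a a₃).hom ≫ (hF.isCofiber_right X H).δ := by
  have e : (𝟙 A ×ₘ φ) ≫ (a.hom ×ₘ (shiftMapIso a₁).hom) =
      (a.hom ×ₘ a₃.hom) ≫ (𝟙 _ ×ₘ H.δ) := by
    rw [prod_comp, prod_comp, h, id_comp, comp_id]
  rw [assoc, hF.ζShiftApp_comp, ← Functor.map_comp_assoc, e, Functor.map_comp_assoc,
    hF.map_δ_right, isoOfIso_hom, assoc]

lemma distTriang_left (A' : Ho D) (t : Triangle (Ho C)) (ht : t ∈ distTriang (Ho C)) :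
    Triangle.mk (hF.ho.map (t.mor₁ ×ₘ 𝟙 A')) (hF.ho.map (t.mor₂ ×ₘ 𝟙 A'))
      (hF.ho.map (t.mor₃ ×ₘ 𝟙 A') ≫ hF.θShiftApp t.obj₁ A') ∈ distTriang (Ho E) := by
  obtain ⟨X, Y, Z, f, p, H, a₁, a₂, a₃, h₁, h₂, h₃⟩ := exists_isCofiber_of_mem_distTriang t ht
  obtain ⟨X', rfl⟩ := exists_eq_γ_obj A'
  rw [mem_distTriang_iff_isExact]
  refine (hF.isCofiber_left H X').isExact.of_iso (hF.isoOfIso a₁ (Iso.refl _))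
    (hF.isoOfIso a₂ (Iso.refl _)) (hF.isoOfIso a₃ (Iso.refl _))
    (hF.map_isoOfIso_left _ h₁) (hF.map_isoOfIso_left _ h₂) ?_
  rw [← hF.map_comp_θShiftApp H h₃, shiftMapIso_hom, assoc]

lemma distTriang_right (A : Ho C) (t : Triangle (Ho D)) (ht : t ∈ distTriang (Ho D)) :
    Triangle.mk (hF.ho.map (𝟙 A ×ₘ t.mor₁)) (hF.ho.map (𝟙 A ×ₘ t.mor₂))
      (hF.ho.map (𝟙 A ×ₘ t.mor₃) ≫ hF.ζShiftApp A t.obj₁) ∈ distTriang (Ho E) := by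
  obtain ⟨X', Y', Z', f, p, H, a₁, a₂, a₃, h₁, h₂, h₃⟩ := exists_isCofiber_of_mem_distTriang t ht
  obtain ⟨X, rfl⟩ := exists_eq_γ_obj A
  rw [mem_distTriang_iff_isExact]
  refine (hF.isCofiber_right X H).isExact.of_iso (hF.isoOfIso (Iso.refl _) a₁)
    (hF.isoOfIso (Iso.refl _) a₂) (hF.isoOfIso (Iso.refl _) a₃)
    (hF.map_isoOfIso_right _ h₁) (hF.map_isoOfIso_right _ h₂) ?_
  rw [← hF.map_comp_ζShiftApp _ H h₃, shiftMapIso_hom, assoc]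

end IsBiexactFunctor

end CofibrationCategory

namespace CofibrationCategory

set_option linter.unusedSectionVars false

namespace IsBiexactFunctor

variable {C : Type u₁} [Category.{v₁} C] [CofibrationCategory C] [HasZeroObject C] [ChosenCones C]
  {D : Type u₂} [Category.{v₂} D] [CofibrationCategory D] [HasZeroObject D] [ChosenCones D]
  {E : Type u₃} [Category.{v₃} E] [CofibrationCategory E] [HasZeroObject E] [ChosenCones E]
  {F : C × D ⥤ E} (hF : IsBiexactFunctor F)

/-- The isomorphism `σ` of the image of the chosen cone is the morphism induced by a cone extension
of the identity, up to the identification of the two cofibers. -/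
lemma quotComparison_comp_σ {G : C ⥤ E} (hG : IsExactFunctor G) (X : C)
    (K : ConeExtension (𝟙 (G.obj X)) (hG.mapCone (cone X)) (cone (G.obj X))) :
    (γ E).map (hG.quotComparison (cone X)) ≫ (hG.isConeSeq (isConeSeq_cone X)).σ =
      K.hoMap ≫ (suspIso (G.obj X)).hom := by
  have e : hG.quotComparison (cone X) =
      (hG.isConeSeq (isConeSeq_cone X)).isCofiber.quotIso.hom := by
    apply quot_ext
    exact (quotπ_desc _ _ _).trans
      (hG.isConeSeq (isConeSeq_cone X)).isCofiber.quotπ_quotIso_hom.symm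
  rw [(hG.isConeSeq (isConeSeq_cone X)).σ_eq K, e]
  exact Iso.hom_inv_id_assoc
    ((γ E).mapIso (hG.isConeSeq (isConeSeq_cone X)).isCofiber.quotIso) _

/-- The identifications entering `θApp` become identities once their source and target are
unfolded, so only the comparison of cones remains. -/
lemma θApp_eq_σ (X : C) (X' : D) :
    hF.θApp X X' = ((hF.exact_left X').isConeSeq (isConeSeq_cone X)).σ := by
  have e₁ : hF.ho.map ((suspIso X).inv ×ₘ 𝟙 ((γ D).obj X')) = 𝟙 _ := hF.ho.map_id _
  have e₂ : (suspension E).map (hF.iso X X').inv = 𝟙 _ := (suspension E).map_id _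
  change hF.ho.map ((suspIso X).inv ×ₘ 𝟙 _) ≫ (hF.iso (susp X) X').hom ≫
      ((hF.exact_left X').isConeSeq (isConeSeq_cone X)).σ ≫
        (suspension E).map (hF.iso X X').inv = _
  refine (congrArg (· ≫ _) e₁).trans ((id_comp _).trans ((id_comp _).trans ?_))
  exact (congrArg (_ ≫ ·) e₂).trans (comp_id _)

lemma ζApp_eq_σ (X : C) (X' : D) :
    hF.ζApp X X' = ((hF.exact_right X).isConeSeq (isConeSeq_cone X')).σ := by
  have e₁ : hF.ho.map (𝟙 ((γ C).obj X) ×ₘ (suspIso X').inv) = 𝟙 _ := hF.ho.map_id _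
  have e₂ : (suspension E).map (hF.iso X X').inv = 𝟙 _ := (suspension E).map_id _
  change hF.ho.map (𝟙 _ ×ₘ (suspIso X').inv) ≫ (hF.iso X (susp X')).hom ≫
      ((hF.exact_right X).isConeSeq (isConeSeq_cone X')).σ ≫
        (suspension E).map (hF.iso X X').inv = _
  refine (congrArg (· ≫ _) e₁).trans ((id_comp _).trans ((id_comp _).trans ?_))
  exact (congrArg (_ ≫ ·) e₂).trans (comp_id _)

variable [HoTriangulation C] [HoTriangulation D] [HoTriangulation E]

lemma map_inv_comp_θShiftApp (A : Ho C) (A' : Ho D) :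
    hF.ho.map (HoTriangulation.shiftIso.inv.app A ×ₘ 𝟙 A') ≫ hF.θShiftApp A A' ≫
      HoTriangulation.shiftIso.hom.app (hF.ho.obj (A, A')) = hF.θIso.hom.app (A, A') := by
  have e : hF.ho.map (HoTriangulation.shiftIso.inv.app A ×ₘ 𝟙 A') ≫
      hF.ho.map (HoTriangulation.shiftIso.hom.app A ×ₘ 𝟙 A') = 𝟙 _ := by
    rw [← Functor.map_comp, prod_comp, Iso.inv_hom_id_app, comp_id]
    exact hF.ho.map_id _
  rw [θShiftApp_comp_shiftIso, ← assoc, e]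
  exact id_comp _

lemma isSuspensionComparison_left (X : C) (X' : D) :
    (hF.exact_left X').IsSuspensionComparison X
      (hF.ho.map (HoTriangulation.shiftIso.inv.app ((γ C).obj X) ×ₘ 𝟙 ((γ D).obj X')) ≫
        hF.θShiftApp ((γ C).obj X) ((γ D).obj X') ≫
          HoTriangulation.shiftIso.hom.app ((γ E).obj (F.obj (X, X')))) := by
  intro K
  have e₁ : (γ E).map ((hF.exact_left X').quotComparison (cone X)) ≫ hF.θApp X X' = K.hoMap := by
    rw [hF.θApp_eq_σ]
    exact (quotComparison_comp_σ (hF.exact_left X') X K).trans (comp_id _)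
  rw [← e₁]
  congr 1
  exact (hF.map_inv_comp_θShiftApp ((γ C).obj X) ((γ D).obj X')).trans (hF.θIso_app X X')

lemma map_inv_comp_ζShiftApp (A : Ho C) (A' : Ho D) :
    hF.ho.map (𝟙 A ×ₘ HoTriangulation.shiftIso.inv.app A') ≫ hF.ζShiftApp A A' ≫
      HoTriangulation.shiftIso.hom.app (hF.ho.obj (A, A')) = hF.ζIso.hom.app (A, A') := by
  have e : hF.ho.map (𝟙 A ×ₘ HoTriangulation.shiftIso.inv.app A') ≫
      hF.ho.map (𝟙 A ×ₘ HoTriangulation.shiftIso.hom.app A') = 𝟙 _ := by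
    rw [← Functor.map_comp, prod_comp, Iso.inv_hom_id_app, comp_id]
    exact hF.ho.map_id _
  rw [ζShiftApp_comp_shiftIso, ← assoc, e]
  exact id_comp _

lemma isSuspensionComparison_right (X : C) (X' : D) :
    (hF.exact_right X).IsSuspensionComparison X'
      (hF.ho.map (𝟙 ((γ C).obj X) ×ₘ HoTriangulation.shiftIso.inv.app ((γ D).obj X')) ≫
        hF.ζShiftApp ((γ C).obj X) ((γ D).obj X') ≫
          HoTriangulation.shiftIso.hom.app ((γ E).obj (F.obj (X, X')))) := by
  intro K
  have e₁ : (γ E).map ((hF.exact_right X).quotComparison (cone X')) ≫ hF.ζApp X X' = K.hoMap := by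
    rw [hF.ζApp_eq_σ]
    exact (quotComparison_comp_σ (hF.exact_right X) X' K).trans (comp_id _)
  rw [← e₁]
  congr 1
  exact (hF.map_inv_comp_ζShiftApp ((γ C).obj X) ((γ D).obj X')).trans (hF.ζIso_app X X')

variable [IsStable E]

/-- The sign is that of `IsCofiberGrid.δ_comp_δ`, for the grid of the two chosen cones, whose
connecting morphisms are isomorphisms. -/
lemma anticomm (A : Ho C) (A' : Ho D) :
    hF.θShiftApp A (A'⟦(1 : ℤ)⟧) ≫ (hF.ζShiftApp A A')⟦(1 : ℤ)⟧' =
      -(hF.ζShiftApp (A⟦(1 : ℤ)⟧) A' ≫ (hF.θShiftApp A A')⟦(1 : ℤ)⟧') := by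
  have : (suspension E).Additive := suspension_additive
  obtain ⟨X, rfl⟩ := exists_eq_γ_obj A
  obtain ⟨X', rfl⟩ := exists_eq_γ_obj A'
  have H := (isConeSeq_cone X).isCofiber
  have H' := (isConeSeq_cone X').isCofiber
  have : IsIso H.δ := (isConeSeq_cone X).isIso_δ
  have : IsIso H'.δ := (isConeSeq_cone X').isIso_δ
  obtain ⟨W, j, j', i, q, q', G⟩ := hF.exists_isCofiberGrid H H'
  let a := Iso.refl ((γ C).obj X)
  let a' := Iso.refl ((γ D).obj X')
  let b := shiftMapIso a ≪≫ (asIso H.δ).symm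
  let b' := shiftMapIso a' ≪≫ (asIso H'.δ).symm
  have hb : 𝟙 _ ≫ (shiftMapIso a).hom = b.hom ≫ H.δ := by simp [b]
  have hb' : 𝟙 _ ≫ (shiftMapIso a').hom = b'.hom ≫ H'.δ := by simp [b']
  have e (P : Ho C) (P' : Ho D) : hF.ho.map (𝟙 P ×ₘ 𝟙 P') = 𝟙 _ :=
    hF.ho.map_id (P, P')
  have e₁ := hF.map_comp_θShiftApp H hb b'
  have e₂ := hF.map_comp_ζShiftApp a H' hb'
  have e₃ := hF.map_comp_ζShiftApp b H' hb'
  have e₄ := hF.map_comp_θShiftApp H hb a'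
  rw [e, id_comp] at e₁ e₂ e₃ e₄
  rw [← cancel_mono (shiftMapIso (shiftMapIso (hF.isoOfIso a a'))).hom, assoc,
    shiftMapIso_naturality e₂, reassoc_of% e₁, Preadditive.neg_comp, assoc,
    shiftMapIso_naturality e₄, reassoc_of% e₃, ← Preadditive.comp_neg]
  congr 1
  rw [← neg_eq_iff_eq_neg]
  exact G.δ_comp_δ.symm

/-- The biexact structure on the functor of homotopy categories induced by a biexact functor. -/
noncomputable def biexact : TriangulatedBifunctor.Biexact hF.ho where
  θ := hF.θShift
  ζ := hF.ζShift
  exact_right := hF.distTriang_right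
  exact_left := hF.distTriang_left
  anticomm := hF.anticomm

lemma isCanonical : hF.IsCanonical hF.biexact :=
  ⟨hF.isSuspensionComparison_left, hF.isSuspensionComparison_right⟩

end IsBiexactFunctor

end CofibrationCategory

/-! ### Strong Verdier structures -/

namespace CofibrationCategory

set_option linter.unusedSectionVars false

namespace IsBiexactFunctor

variable {C : Type u₁} [Category.{v₁} C] [CofibrationCategory C] [HasZeroObject C] [ChosenCones C]
  {D : Type u₂} [Category.{v₂} D] [CofibrationCategory D] [HasZeroObject D] [ChosenCones D]
  {E : Type u₃} [Category.{v₃} E] [CofibrationCategory E] [HasZeroObject E] [ChosenCones E]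
  {F : C × D ⥤ E} (hF : IsBiexactFunctor F)
  [HoTriangulation C] [HoTriangulation D] [HoTriangulation E] [IsStable E]

lemma admitsStrongVerdierStructure : hF.biexact.AdmitsStrongVerdierStructure := by
  intro t t' ht ht'
  have : (suspension E).Additive := suspension_additive
  obtain ⟨X, Y, Z, f, g, H, a₀, a₁, a₂, w₁, w₂, w₃⟩ := exists_isCofiber_of_mem_distTriang t ht
  obtain ⟨X', Y', Z', f', g', H', a'₀, a'₁, a'₂, w'₁, w'₂, w'₃⟩ :=
    exists_isCofiber_of_mem_distTriang t' ht'
  obtain ⟨W, j, j', i, q, q', G⟩ := hF.exists_isCofiberGrid H H'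
  -- the isomorphisms between the nine objects and the objects of the grid
  let b₀₀ := hF.isoOfIso a₀ a'₀
  let b₀₁ := hF.isoOfIso a₀ a'₁
  let b₀₂ := hF.isoOfIso a₀ a'₂
  let b₁₀ := hF.isoOfIso a₁ a'₀
  let b₁₁ := hF.isoOfIso a₁ a'₁
  let b₁₂ := hF.isoOfIso a₁ a'₂
  let b₂₀ := hF.isoOfIso a₂ a'₀
  let b₂₁ := hF.isoOfIso a₂ a'₁
  let b₂₂ := hF.isoOfIso a₂ a'₂
  let w := Iso.refl ((γ E).obj W)
  have u₀ : hF.ho.map (t.mor₁ ×ₘ 𝟙 t'.obj₁) ≫ b₁₀.hom = b₀₀.hom ≫ (γ E).map _ :=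
    hF.map_isoOfIso_left a'₀ w₁
  have v₀ : hF.ho.map (t.mor₂ ×ₘ 𝟙 t'.obj₁) ≫ b₂₀.hom = b₁₀.hom ≫ (γ E).map _ :=
    hF.map_isoOfIso_left a'₀ w₂
  have c₀ : (hF.ho.map (t.mor₃ ×ₘ 𝟙 t'.obj₁) ≫ hF.θShiftApp t.obj₁ t'.obj₁) ≫
      (shiftMapIso b₀₀).hom = b₂₀.hom ≫ (hF.isCofiber_left H X').δ :=
    hF.map_comp_θShiftApp H w₃ a'₀
  have u₁ : hF.ho.map (t.mor₁ ×ₘ 𝟙 t'.obj₂) ≫ b₁₁.hom = b₀₁.hom ≫ (γ E).map _ :=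
    hF.map_isoOfIso_left a'₁ w₁
  have v₁ : hF.ho.map (t.mor₂ ×ₘ 𝟙 t'.obj₂) ≫ b₂₁.hom = b₁₁.hom ≫ (γ E).map _ :=
    hF.map_isoOfIso_left a'₁ w₂
  have c₁ : (hF.ho.map (t.mor₃ ×ₘ 𝟙 t'.obj₂) ≫ hF.θShiftApp t.obj₁ t'.obj₂) ≫
      (shiftMapIso b₀₁).hom = b₂₁.hom ≫ (hF.isCofiber_left H Y').δ :=
    hF.map_comp_θShiftApp H w₃ a'₁
  have u₂ : hF.ho.map (t.mor₁ ×ₘ 𝟙 t'.obj₃) ≫ b₁₂.hom = b₀₂.hom ≫ (γ E).map _ :=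
    hF.map_isoOfIso_left a'₂ w₁
  have v₂ : hF.ho.map (t.mor₂ ×ₘ 𝟙 t'.obj₃) ≫ b₂₂.hom = b₁₂.hom ≫ (γ E).map _ :=
    hF.map_isoOfIso_left a'₂ w₂
  have c₂ : (hF.ho.map (t.mor₃ ×ₘ 𝟙 t'.obj₃) ≫ hF.θShiftApp t.obj₁ t'.obj₃) ≫
      (shiftMapIso b₀₂).hom = b₂₂.hom ≫ (hF.isCofiber_left H Z').δ :=
    hF.map_comp_θShiftApp H w₃ a'₂
  have u'₀ : hF.ho.map (𝟙 t.obj₁ ×ₘ t'.mor₁) ≫ b₀₁.hom = b₀₀.hom ≫ (γ E).map _ :=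
    hF.map_isoOfIso_right a₀ w'₁
  have v'₀ : hF.ho.map (𝟙 t.obj₁ ×ₘ t'.mor₂) ≫ b₀₂.hom = b₀₁.hom ≫ (γ E).map _ :=
    hF.map_isoOfIso_right a₀ w'₂
  have c'₀ : (hF.ho.map (𝟙 t.obj₁ ×ₘ t'.mor₃) ≫ hF.ζShiftApp t.obj₁ t'.obj₁) ≫
      (shiftMapIso b₀₀).hom = b₀₂.hom ≫ (hF.isCofiber_right X H').δ :=
    hF.map_comp_ζShiftApp a₀ H' w'₃
  have u'₁ : hF.ho.map (𝟙 t.obj₂ ×ₘ t'.mor₁) ≫ b₁₁.hom = b₁₀.hom ≫ (γ E).map _ :=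
    hF.map_isoOfIso_right a₁ w'₁
  have v'₁ : hF.ho.map (𝟙 t.obj₂ ×ₘ t'.mor₂) ≫ b₁₂.hom = b₁₁.hom ≫ (γ E).map _ :=
    hF.map_isoOfIso_right a₁ w'₂
  have c'₁ : (hF.ho.map (𝟙 t.obj₂ ×ₘ t'.mor₃) ≫ hF.ζShiftApp t.obj₂ t'.obj₁) ≫
      (shiftMapIso b₁₀).hom = b₁₂.hom ≫ (hF.isCofiber_right Y H').δ :=
    hF.map_comp_ζShiftApp a₁ H' w'₃
  have u'₂ : hF.ho.map (𝟙 t.obj₃ ×ₘ t'.mor₁) ≫ b₂₁.hom = b₂₀.hom ≫ (γ E).map _ :=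
    hF.map_isoOfIso_right a₂ w'₁
  have v'₂ : hF.ho.map (𝟙 t.obj₃ ×ₘ t'.mor₂) ≫ b₂₂.hom = b₂₁.hom ≫ (γ E).map _ :=
    hF.map_isoOfIso_right a₂ w'₂
  have c'₂ : (hF.ho.map (𝟙 t.obj₃ ×ₘ t'.mor₃) ≫ hF.ζShiftApp t.obj₃ t'.obj₁) ≫
      (shiftMapIso b₂₀).hom = b₂₂.hom ≫ (hF.isCofiber_right Z H').δ :=
    hF.map_comp_ζShiftApp a₂ H' w'₃
  have vv : hF.ho.map (t.mor₂ ×ₘ t'.mor₂) ≫ b₂₂.hom = b₁₁.hom ≫ (γ E).map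
      (F.map (g ×ₘ 𝟙 _) ≫ F.map (𝟙 _ ×ₘ g')) := by
    have e : (g ×ₘ 𝟙 Y') ≫ (𝟙 Z ×ₘ g') = (g ×ₘ g') := by simp
    rw [← Functor.map_comp, e]
    exact hF.map_isoOfIso w₂ w'₂
  -- the connecting morphisms with two nontrivial components
  have d : (hF.ho.map (t.mor₃ ×ₘ t'.mor₁) ≫ hF.θShiftApp t.obj₁ t'.obj₂) ≫
      (shiftMapIso b₀₁).hom = b₂₀.hom ≫ G.isCofiber_j.δ := by
    have e : (t.mor₃ ×ₘ t'.mor₁) = (𝟙 _ ×ₘ t'.mor₁) ≫ (t.mor₃ ×ₘ 𝟙 _) := by simp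
    rw [e, Functor.map_comp, assoc, assoc, ← assoc (hF.ho.map (t.mor₃ ×ₘ 𝟙 _)), c₁,
      reassoc_of% u'₂, G.δ_j]
  have d' : (hF.ho.map (t.mor₁ ×ₘ t'.mor₃) ≫ hF.ζShiftApp t.obj₂ t'.obj₁) ≫
      (shiftMapIso b₁₀).hom = b₀₂.hom ≫ G.symm.isCofiber_j.δ := by
    have e : (t.mor₁ ×ₘ t'.mor₃) = (t.mor₁ ×ₘ 𝟙 _) ≫ (𝟙 _ ×ₘ t'.mor₃) := by simp
    rw [e, Functor.map_comp, assoc, assoc, ← assoc (hF.ho.map (𝟙 _ ×ₘ t'.mor₃)), c'₁,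
      reassoc_of% u₂, G.symm.δ_j]
  let j₁ := b₀₁.hom ≫ (γ E).map j
  let j'₁ := b₁₀.hom ≫ (γ E).map j'
  let q₁ := (γ E).map q ≫ b₂₀.inv
  let q'₁ := (γ E).map q' ≫ b₀₂.inv
  let i₁ := (γ E).map i ≫ b₁₁.inv
  let p₁ := b₂₂.hom ≫ G.isCofiber_i.δ ≫ (shiftMapIso w).inv
  have hj : j₁ ≫ w.hom = b₀₁.hom ≫ (γ E).map j := comp_id _
  have hj' : j'₁ ≫ w.hom = b₁₀.hom ≫ (γ E).map j' := comp_id _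
  have hq : q₁ ≫ b₂₀.hom = w.hom ≫ (γ E).map q := by simp [q₁, w]
  have hq' : q'₁ ≫ b₀₂.hom = w.hom ≫ (γ E).map q' := by simp [q'₁, w]
  have hi : i₁ ≫ b₁₁.hom = w.hom ≫ (γ E).map i := by simp [i₁, w]
  have hp : p₁ ≫ (shiftMapIso w).hom = b₂₂.hom ≫ G.isCofiber_i.δ := by simp [p₁]
  have k₁ := G.isHoCartesian₁.of_iso b₀₀ b₀₁ b₁₀ w u₀ u'₀ hj' hj
  have k₂ := G.isHoCartesian₂.of_iso w b₁₁ b₂₀ b₂₁ hq hi u'₂ v₁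
  have k₃ := G.symm.isHoCartesian₂.symm.of_iso w b₀₂ b₁₁ b₁₂ hi hq' v'₁ u₂
  have k₄ := G.isHoCartesian₄.of_iso b₂₁ b₂₂ (shiftMapIso b₀₁) (shiftMapIso w) c₁ v'₂
    (shiftMapIso_naturality hj) hp
  have k₅ := G.symm.isHoCartesian₄.symm.of_iso b₁₂ (shiftMapIso b₁₀) b₂₂ (shiftMapIso w) v₂ c'₁
    (hp.trans (by rw [G.δ_symm_i])) (shiftMapIso_naturality hj')
  have k₆ := G.isUnion.isHoCartesian_suspension.of_iso (shiftMapIso w) (shiftMapIso b₂₀)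
    (shiftMapIso b₀₂) (shiftMapIso (shiftMapIso b₀₀)) (shiftMapIso_naturality hq')
    (shiftMapIso_naturality hq) (shiftMapIso_naturality c'₀)
    (k' := -((hF.ho.map (t.mor₃ ×ₘ 𝟙 t'.obj₁) ≫ hF.θShiftApp t.obj₁ t'.obj₁)⟦(1 : ℤ)⟧'))
    (by
      rw [Preadditive.neg_comp, Preadditive.comp_neg, neg_inj]
      exact shiftMapIso_naturality c₀)
  refine ⟨{
    W := (γ E).obj W
    j := j₁
    q := q₁
    i := i₁
    p := p₁
    j' := j'₁
    q' := q'₁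
    mem₁ := (mem_distTriang_iff_isExact _ _ _).2 (G.isCofiber_j.isExact.of_iso b₀₁ w b₂₀ hj hq
      ((assoc _ _ _).trans d))
    mem₂ := (mem_distTriang_iff_isExact _ _ _).2 (G.isCofiber_i.isExact.of_iso w b₁₁ b₂₂ hi vv
      ((assoc _ _ _).trans hp))
    mem₃ := (mem_distTriang_iff_isExact _ _ _).2 (G.symm.isCofiber_j.isExact.of_iso b₁₀ w b₀₂ hj' hq'
      ((assoc _ _ _).trans d'))
    tri₁ := ?_
    tri₂ := ?_
    tri₃ := ?_
    tri₄ := ?_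
    tri₅ := ?_
    tri₆ := ?_
    sq₁ := k₁.1.symm
    sq₂ := k₂.1.symm
    sq₃ := k₃.1.symm
    sq₄ := k₄.1.symm
    sq₅ := k₅.1.symm
    sq₆ := k₆.1.symm.trans (Preadditive.comp_neg _ _) }, k₁.isHomotopyCartesian,
      k₂.isHomotopyCartesian, k₃.isHomotopyCartesian, k₄.isHomotopyCartesian,
      k₅.isHomotopyCartesian, k₆.isHomotopyCartesian⟩
  · rw [← cancel_mono b₀₂.hom, v'₀, assoc, hq', ← assoc, hj, assoc, ← Functor.map_comp,
      G.isUnion.i'q']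
  · rw [← cancel_mono b₁₁.hom, u₁, assoc, hi, ← assoc, hj, assoc, ← Functor.map_comp, G.ji]
  · rw [← cancel_mono b₁₁.hom, u'₁, assoc, hi, ← assoc, hj', assoc, ← Functor.map_comp, G.j'i]
  · rw [← cancel_mono b₂₀.hom, v₀, assoc, hq, ← assoc, hj', assoc, ← Functor.map_comp,
      G.isUnion.iq]
  · refine (cancel_mono (shiftMapIso b₂₀).hom).1 (Eq.trans ?_ c'₂.symm)
    rw [assoc, shiftMapIso_naturality hq, reassoc_of% hp, G.δ_i_comp_q]
  · refine (cancel_mono (shiftMapIso b₀₂).hom).1 (Eq.trans ?_ c₂.symm)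
    rw [assoc, shiftMapIso_naturality hq', reassoc_of% hp, G.δ_i_comp_q']

end IsBiexactFunctor

end CofibrationCategory

theorem mainTheorem3
    {C : Type u₁} [Category.{v₁} C] [CofibrationCategory C] [HasZeroObject C]
    [CofibrationCategory.ChosenCones C] [CofibrationCategory.IsStable C]
    {D : Type u₂} [Category.{v₂} D] [CofibrationCategory D] [HasZeroObject D]
    [CofibrationCategory.ChosenCones D] [CofibrationCategory.IsStable D]
    {E : Type u₃} [Category.{v₃} E] [CofibrationCategory E] [HasZeroObject E]
    [CofibrationCategory.ChosenCones E] [CofibrationCategory.IsStable E]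
    (F : C × D ⥤ E) (hF : CofibrationCategory.IsBiexactFunctor F) :
    Nonempty (CofibrationCategory.HoTriangulation C) ∧
    Nonempty (CofibrationCategory.HoTriangulation D) ∧
    Nonempty (CofibrationCategory.HoTriangulation E) ∧
    ∀ [CofibrationCategory.HoTriangulation C] [CofibrationCategory.HoTriangulation D]
      [CofibrationCategory.HoTriangulation E],
      ∃ B : TriangulatedBifunctor.Biexact hF.ho,
        hF.IsCanonical B ∧ B.AdmitsStrongVerdierStructure :=
  ⟨CofibrationCategory.nonempty_hoTriangulation C, CofibrationCategory.nonempty_hoTriangulation D,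
    CofibrationCategory.nonempty_hoTriangulation E,
    ⟨hF.biexact, hF.isCanonical, hF.admitsStrongVerdierStructure⟩⟩
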